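/- Let $K$ be a field of characteristic $0$ and let $X$ be a topological space with Lusternik–Schnirelmann category $\mathrm{cat}_{LS}(X)\le 1$; here $\mathrm{cat}_{LS}(X)$ is the least integer $n$ such that $X$ can be covered by $n+1$ open subsets whose inclusions into $X$ are null-homotopic. Then $X$ is formal over $K$: the singular cochain dg-algebra $C^*(X;K)$, with the cup product, is connected to its cohomology algebra $H^*(X;K)$, regarded as a dg-algebra with zero differential, by a finite zigzag of quasi-isomorphisms of (unital, $\mathbb{Z}$-graded, associative) dg-algebras over $K$. -/

import Mathlib

universe u v w

section

open DirectSum CategoryTheory Simplicial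

/-- A (unital, associative, cohomologically `ℤ`-graded) differential graded algebra over `K`. -/
structure DGAlgebra (K : Type v) [Field K] where
  /-- the underlying algebra, i.e. the direct sum of all degrees -/
  carrier : Type w
  [ring : Ring carrier]
  [algebra : Algebra K carrier]
  /-- the submodule of homogeneous elements of degree `n` -/
  deg : ℤ → Submodule K carrier
  [graded : GradedAlgebra deg]
  /-- the differential -/
  d : carrier →ₗ[K] carrier
  d_mem : ∀ {n : ℤ} {a : carrier}, a ∈ deg n → d a ∈ deg (n + 1)
  d_d : ∀ a : carrier, d (d a) = 0
  leibniz : ∀ {n : ℤ} {a : carrier}, a ∈ deg n → ∀ b : carrier,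
    d (a * b) = d a * b + n.negOnePow • (a * d b)

namespace DGAlgebra

variable {K : Type v} [Field K]

attribute [instance] DGAlgebra.ring DGAlgebra.algebra DGAlgebra.graded

/-- A morphism of dg-algebras: a degree-preserving algebra map commuting with the differentials. -/
structure Hom (A B : DGAlgebra.{v, w} K) where
  toAlgHom : A.carrier →ₐ[K] B.carrier
  map_deg : ∀ {n : ℤ} {a : A.carrier}, a ∈ A.deg n → toAlgHom a ∈ B.deg n
  map_d : ∀ a : A.carrier, toAlgHom (A.d a) = B.d (toAlgHom a)

/-- A quasi-isomorphism of dg-algebras: the induced map `ker d / im d → ker d / im d` is injective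
(a cocycle that becomes a coboundary is a coboundary) and surjective (every cocycle of the target
is the image of a cocycle up to a coboundary). -/
def Hom.IsQuasiIso {A B : DGAlgebra.{v, w} K} (f : Hom A B) : Prop :=
  (∀ z : A.carrier, A.d z = 0 → (∃ b, B.d b = f.toAlgHom z) → ∃ a, A.d a = z) ∧
  (∀ y : B.carrier, B.d y = 0 → ∃ z, A.d z = 0 ∧ ∃ b, B.d b = y - f.toAlgHom z)

variable (A : DGAlgebra.{v, w} K)

theorem d_one : A.d 1 = 0 := by
  have h := A.leibniz (SetLike.GradedOne.one_mem : (1 : A.carrier) ∈ A.deg 0) 1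
  simpa using h

theorem d_mul_of_d_eq_zero (a : A.carrier) {b : A.carrier} (hb : A.d b = 0) :
    A.d (a * b) = A.d a * b := by
  induction a using DirectSum.Decomposition.inductionOn A.deg with
  | zero => simp
  | homogeneous m => simp [A.leibniz m.2, hb]
  | add m m' h h' => simp [add_mul, h, h']

/-- The differential commutes with taking homogeneous components. -/
theorem decompose_d (a : A.carrier) (n : ℤ) :
    (decompose A.deg (A.d a) (n + 1) : A.carrier) = A.d (decompose A.deg a n) := by
  induction a using DirectSum.Decomposition.inductionOn A.deg with
  | zero => simp
  | @homogeneous i m =>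
    by_cases h : i = n
    · subst h
      rw [decompose_of_mem_same _ (A.d_mem m.2), decompose_of_mem_same _ m.2]
    · rw [decompose_of_mem_ne _ (A.d_mem m.2) (by simpa using h), decompose_of_mem_ne _ m.2 h,
        map_zero]
  | add m m' h h' => simp [h, h']

theorem d_component_eq_zero {z : A.carrier} (hz : A.d z = 0) (n : ℤ) :
    A.d (decompose A.deg z n) = 0 := by
  rw [← decompose_d, hz]; simp

theorem mul_d_mem_range {z : A.carrier} (hz : A.d z = 0) (a : A.carrier) :
    ∃ b, A.d b = z * A.d a := by
  classical
  suffices h : z * A.d a ∈ LinearMap.range A.d from h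
  rw [← sum_support_decompose A.deg z, Finset.sum_mul]
  refine Submodule.sum_mem _ fun n _ => ⟨n.negOnePow • (decompose A.deg z n * a : A.carrier), ?_⟩
  rw [Units.smul_def, map_zsmul, A.leibniz (decompose A.deg z n).2, A.d_component_eq_zero hz n,
    zero_mul, zero_add, ← Units.smul_def, smul_smul, ← Int.negOnePow_add,
    Int.negOnePow_even _ ⟨n, rfl⟩, one_smul]

/-- The subalgebra of cocycles. -/
def cocycles : Subalgebra K A.carrier where
  carrier := {z | A.d z = 0}
  mul_mem' {a b} ha hb := by
    simp only [Set.mem_ofPred_eq] at *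
    rw [A.d_mul_of_d_eq_zero a hb, ha, zero_mul]
  add_mem' {a b} ha hb := by
    simp only [Set.mem_ofPred_eq] at *
    rw [map_add, ha, hb, add_zero]
  algebraMap_mem' r := by
    simp only [Set.mem_ofPred_eq]
    rw [Algebra.algebraMap_eq_smul_one, map_smul, d_one, smul_zero]

/-- The two-sided ideal of coboundaries in the algebra of cocycles. -/
def coboundaries : Ideal A.cocycles where
  carrier := {z | ∃ a, A.d a = z}
  add_mem' := by
    rintro _ _ ⟨a, ha⟩ ⟨b, hb⟩
    exact ⟨a + b, by simp [ha, hb]⟩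
  zero_mem' := ⟨0, by simp⟩
  smul_mem' := by
    rintro z x ⟨a, ha⟩
    obtain ⟨b, hb⟩ := A.mul_d_mem_range z.2 a
    exact ⟨b, by simp [hb, ha]⟩

instance : A.coboundaries.IsTwoSided where
  mul_mem_of_left {x} z := by
    rintro ⟨a, ha⟩
    exact ⟨a * z, by rw [A.d_mul_of_d_eq_zero a z.2, ha]; simp⟩

/-- The underlying algebra `ker d / im d` of the cohomology algebra. -/
def CohomologyRing : Type w := A.cocycles ⧸ A.coboundaries

instance : Ring A.CohomologyRing :=
  inferInstanceAs (Ring (A.cocycles ⧸ A.coboundaries))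

instance : Algebra K A.CohomologyRing :=
  inferInstanceAs (Algebra K (A.cocycles ⧸ A.coboundaries))

/-- The cohomology class of a cocycle, as a linear map. -/
def toCohomology : A.cocycles →ₗ[K] A.CohomologyRing :=
  (Ideal.Quotient.mkₐ K A.coboundaries).toLinearMap

theorem toCohomology_surjective : Function.Surjective A.toCohomology :=
  Ideal.Quotient.mk_surjective

theorem toCohomology_eq_zero {z : A.cocycles} :
    A.toCohomology z = 0 ↔ ∃ a, A.d a = z :=
  Ideal.Quotient.eq_zero_iff_mem

/-- The degree `n` part of cohomology: the classes of the cocycles of degree `n`. -/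
def cohomologyDeg (n : ℤ) : Submodule K A.CohomologyRing :=
  ((A.deg n).comap A.cocycles.val.toLinearMap).map A.toCohomology

/-- The degree `n` component of a cocycle. -/
def cocycleComponent (n : ℤ) : A.cocycles →ₗ[K] A.cocycles where
  toFun z := ⟨decompose A.deg (z : A.carrier) n, A.d_component_eq_zero z.2 n⟩
  map_add' x y := by ext; simp
  map_smul' r x := by
    ext
    simp only [SetLike.val_smul, decompose_smul, RingHom.id_apply]
    rfl

/-- The degree `n` component of a cohomology class. -/
def cohomologyComponent (n : ℤ) : A.CohomologyRing →ₗ[K] A.CohomologyRing where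
  toFun := Quotient.lift (fun z => A.toCohomology (A.cocycleComponent n z)) (by
    intro x y hxy
    have hxy' : A.toCohomology (x - y) = 0 := by
      rw [map_sub, sub_eq_zero]
      exact Quotient.sound hxy
    rw [← sub_eq_zero, ← map_sub, ← map_sub, toCohomology_eq_zero]
    obtain ⟨a, ha⟩ := A.toCohomology_eq_zero.1 hxy'
    refine ⟨decompose A.deg a (n - 1), ?_⟩
    rw [← decompose_d, sub_add_cancel, ha]; rfl)
  map_add' x y := by
    obtain ⟨x, rfl⟩ := A.toCohomology_surjective x
    obtain ⟨y, rfl⟩ := A.toCohomology_surjective y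
    rw [← map_add]
    change A.toCohomology _ = A.toCohomology _ + A.toCohomology _
    simp
  map_smul' r x := by
    obtain ⟨x, rfl⟩ := A.toCohomology_surjective x
    rw [← map_smul]
    change A.toCohomology _ = r • A.toCohomology _
    simp

theorem cohomologyComponent_toCohomology (n : ℤ) (z : A.cocycles) :
    A.cohomologyComponent n (A.toCohomology z) = A.toCohomology (A.cocycleComponent n z) := rfl

theorem cohomologyComponent_mem (n : ℤ) (x : A.CohomologyRing) :
    A.cohomologyComponent n x ∈ A.cohomologyDeg n := by
  obtain ⟨x, rfl⟩ := A.toCohomology_surjective x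
  exact ⟨A.cocycleComponent n x, (decompose A.deg (x : A.carrier) n).2, rfl⟩

theorem cohomologyComponent_same {n : ℤ} {x : A.CohomologyRing} (hx : x ∈ A.cohomologyDeg n) :
    A.cohomologyComponent n x = x := by
  obtain ⟨z, hz, rfl⟩ := hx
  rw [cohomologyComponent_toCohomology]
  congr 1
  exact Subtype.ext (decompose_of_mem_same A.deg hz)

theorem cohomologyComponent_ne {n m : ℤ} (hnm : n ≠ m) {x : A.CohomologyRing}
    (hx : x ∈ A.cohomologyDeg n) : A.cohomologyComponent m x = 0 := by
  obtain ⟨z, hz, rfl⟩ := hx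
  rw [cohomologyComponent_toCohomology]
  have : A.cocycleComponent m z = 0 := Subtype.ext (decompose_of_mem_ne A.deg hz hnm)
  rw [this, map_zero]

theorem cohomologyDeg_isInternal : DirectSum.IsInternal A.cohomologyDeg := by
  classical
  constructor
  · rw [injective_iff_map_eq_zero]
    intro x hx
    ext n
    have key : ∀ y : ⨁ i, A.cohomologyDeg i,
        A.cohomologyComponent n (DirectSum.coeAddMonoidHom A.cohomologyDeg y) = y n := by
      intro y
      induction y using DirectSum.induction_on with
      | zero => simp
      | of i y =>
        rw [DirectSum.coeAddMonoidHom_of]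
        by_cases h : i = n
        · subst h
          rw [A.cohomologyComponent_same y.2, DirectSum.of_eq_same]
        · rw [A.cohomologyComponent_ne h y.2, DirectSum.of_eq_of_ne _ _ _ (Ne.symm h)]; rfl
      | add y y' h h' => simp [h, h']
    rw [← key, hx]; simp
  · intro x
    obtain ⟨z, rfl⟩ := A.toCohomology_surjective x
    refine ⟨∑ n ∈ (decompose A.deg (z : A.carrier)).support,
      DirectSum.of (fun i => A.cohomologyDeg i) n ⟨A.toCohomology (A.cocycleComponent n z),
        A.cohomologyComponent_mem n (A.toCohomology z)⟩, ?_⟩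
    rw [map_sum]
    simp only [DirectSum.coeAddMonoidHom_of]
    rw [← map_sum]
    congr 1
    apply Subtype.ext
    rw [AddSubmonoidClass.coe_finsetSum]
    exact sum_support_decompose A.deg (z : A.carrier)

noncomputable instance : GradedAlgebra A.cohomologyDeg where
  one_mem := ⟨1, SetLike.GradedOne.one_mem (A := A.deg), rfl⟩
  mul_mem := by
    rintro i j _ _ ⟨x, hx, rfl⟩ ⟨y, hy, rfl⟩
    exact ⟨x * y, SetLike.GradedMul.mul_mem (A := A.deg) hx hy, rfl⟩
  toDecomposition := A.cohomologyDeg_isInternal.chooseDecomposition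

/-- The cohomology algebra `H(A)`, as a dg-algebra with zero differential. -/
noncomputable def cohomology : DGAlgebra.{v, w} K where
  carrier := A.CohomologyRing
  deg := A.cohomologyDeg
  d := 0
  d_mem _ := by simp
  d_d _ := by simp
  leibniz _ _ := by simp

/-- `A` is formal if it is linked to its cohomology algebra by a finite zigzag of
quasi-isomorphisms of dg-algebras. -/
def IsFormal : Prop :=
  Relation.EqvGen (fun B C : DGAlgebra.{v, w} K => ∃ f : Hom B C, f.IsQuasiIso) A A.cohomology

end DGAlgebra

/-- The `n`-cochains of a simplicial set `S` with values in `K`: all functions from the set of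
`n`-simplices to `K`, i.e. the linear dual of the free `K`-module on the `n`-simplices. -/
abbrev SSetCochain (S : SSet.{u}) (K : Type v) (n : ℕ) : Type (max u v) := S _⦋n⦌ → K

namespace SSetCochain

set_option linter.unusedSectionVars false

variable {S : SSet.{u}} {K : Type v} [Field K]

/-- The inclusion of the first `p + 1` vertices `0, …, p` of the `n`-simplex. -/
def front (p n : ℕ) (h : p ≤ n) : ⦋p⦌ ⟶ ⦋n⦌ :=
  SimplexCategory.mkHom ⟨fun i => ⟨i, by omega⟩, fun _ _ hij => hij⟩

/-- The inclusion of the last `q + 1` vertices `n - q, …, n` of the `n`-simplex. -/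
def back (q n : ℕ) (h : q ≤ n) : ⦋q⦌ ⟶ ⦋n⦌ :=
  SimplexCategory.mkHom ⟨fun i => ⟨n - q + i, by omega⟩, fun _ _ hij => by
    simpa using hij⟩

/-- The cup product `(f ∪ g)(σ) = f(σ|[0, …, p]) g(σ|[p, …, p + q])`. -/
def cup {p q : ℕ} (f : SSetCochain S K p) (g : SSetCochain S K q) : SSetCochain S K (p + q) :=
  fun σ => f (S.map (front p (p + q) (by omega)).op σ) * g (S.map (back q (p + q) (by omega)).op σ)

/-- The coboundary `(δ f)(σ) = ∑ᵢ (-1)ⁱ f(∂ᵢ σ)`. -/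
def coboundary (n : ℕ) : SSetCochain S K n →ₗ[K] SSetCochain S K (n + 1) where
  toFun f := fun σ => ∑ i : Fin (n + 2), (-1) ^ (i : ℕ) * f (S.δ i σ)
  map_add' f g := by
    funext σ
    change ∑ i : Fin (n + 2), (-1) ^ (i : ℕ) * (f (S.δ i σ) + g (S.δ i σ)) = _ + _
    simp only [mul_add, Finset.sum_add_distrib]
  map_smul' r f := by
    funext σ
    change ∑ i : Fin (n + 2), (-1) ^ (i : ℕ) * (r * f (S.δ i σ)) = r * _
    rw [Finset.mul_sum]
    exact Finset.sum_congr rfl fun i _ => by ring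

theorem hom_ext {a b : ℕ} {x y : ⦋a⦌ ⟶ ⦋b⦌}
    (h : ∀ i : Fin (a + 1), (x.toOrderHom i : ℕ) = y.toOrderHom i) : x = y := by
  ext i
  exact h i

theorem map_map {a b c : ℕ} (x : ⦋a⦌ ⟶ ⦋b⦌) (y : ⦋b⦌ ⟶ ⦋c⦌) (σ : S _⦋c⦌) :
    S.map x.op (S.map y.op σ) = S.map (x ≫ y).op σ := by
  simp

theorem comp_apply' {a b c : ℕ} (x : ⦋a⦌ ⟶ ⦋b⦌) (y : ⦋b⦌ ⟶ ⦋c⦌) (i : Fin (a + 1)) :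
    (x ≫ y).toOrderHom i = y.toOrderHom (x.toOrderHom i) := rfl

/-- Two cochains whose degrees are propositionally equal agree if they agree on simplices. -/
theorem mk_eq_mk {n m : ℕ} {f : SSetCochain S K n} {g : SSetCochain S K m} (h : m = n)
    (H : ∀ σ : S _⦋n⦌, f σ = g (S.map (front m n h.le).op σ)) :
    (GradedMonoid.mk n f : GradedMonoid (SSetCochain S K)) = GradedMonoid.mk m g := by
  subst h
  congr 1
  funext σ
  rw [H]
  have : front m m le_rfl = 𝟙 _ := hom_ext fun i => rfl
  rw [this]
  simp

theorem front_apply (p n : ℕ) (h : p ≤ n) (i : Fin (p + 1)) :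
    ((front p n h).toOrderHom i : ℕ) = i := rfl

theorem back_apply (q n : ℕ) (h : q ≤ n) (i : Fin (q + 1)) :
    ((back q n h).toOrderHom i : ℕ) = n - q + i := rfl

theorem δ_cases {n : ℕ} (i : Fin (n + 2)) (j : Fin (n + 1)) :
    ((j : ℕ) < i ∧ ((SimplexCategory.δ i).toOrderHom j : ℕ) = j) ∨
      ((i : ℕ) ≤ j ∧ ((SimplexCategory.δ i).toOrderHom j : ℕ) = j + 1) := by
  change ((j : ℕ) < i ∧ ((i.succAbove j : Fin (n + 2)) : ℕ) = j) ∨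
    ((i : ℕ) ≤ j ∧ ((i.succAbove j : Fin (n + 2)) : ℕ) = j + 1)
  simp only [Fin.succAbove, Fin.lt_def, Fin.val_castSucc]
  split_ifs <;> simp <;> omega

/-- Multiplication of homogeneous cochains is the cup product. -/
instance : GradedMonoid.GMul (SSetCochain S K) where
  mul f g := cup f g

/-- The unit is the `0`-cochain with constant value `1`. -/
instance : GradedMonoid.GOne (SSetCochain S K) where
  one := fun _ => 1

theorem cup_assoc_apply {p q r : ℕ} (f : SSetCochain S K p) (g : SSetCochain S K q)
    (h : SSetCochain S K r) (σ : S _⦋p + q + r⦌) :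
    cup (cup f g) h σ =
      cup f (cup g h) (S.map (front (p + (q + r)) (p + q + r) (by omega)).op σ) := by
  simp only [cup, map_map, mul_assoc]
  have e1 : back q (p + q) (by omega) ≫ front (p + q) (p + q + r) (by omega) =
      front q (q + r) (by omega) ≫ back (q + r) (p + (q + r)) (by omega) ≫
        front (p + (q + r)) (p + q + r) (by omega) := by
    apply hom_ext
    intro i
    simp only [comp_apply', front_apply, back_apply]
    omega
  have e2 : back r (p + q + r) (by omega) = back r (q + r) (by omega) ≫
      back (q + r) (p + (q + r)) (by omega) ≫ front (p + (q + r)) (p + q + r) (by omega) := by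
    apply hom_ext
    intro i
    simp only [comp_apply', front_apply, back_apply]
    omega
  rw [e1, e2]
  rfl

theorem back_eq_front (n m : ℕ) (h : n = m) : back n m h.le = front n m h.le := by
  apply hom_ext
  intro i
  simp only [front_apply, back_apply]
  omega

instance : DirectSum.GRing (SSetCochain S K) where
  mul_zero f := by funext σ; exact mul_zero _
  zero_mul f := by funext σ; exact zero_mul _
  mul_add f g h := by funext σ; exact mul_add _ _ _
  add_mul f g h := by funext σ; exact add_mul _ _ _
  one_mul := by
    rintro ⟨n, f⟩
    refine mk_eq_mk (show n = 0 + n by simp) fun σ => ?_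
    change (1 : K) * f (S.map (back n (0 + n) _).op σ) = f _
    rw [one_mul, back_eq_front n (0 + n) (by omega)]
    rfl
  mul_one := by
    rintro ⟨n, f⟩
    refine mk_eq_mk (show n = n + 0 by simp) fun σ => ?_
    change f _ * (1 : K) = f _
    rw [mul_one]
  mul_assoc := by
    rintro ⟨p, f⟩ ⟨q, g⟩ ⟨r, h⟩
    exact mk_eq_mk (show p + (q + r) = p + q + r by omega) fun σ => cup_assoc_apply f g h σ
  natCast n := fun _ => n
  natCast_zero := by funext σ; exact Nat.cast_zero
  natCast_succ n := by funext σ; exact Nat.cast_succ n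
  intCast n := fun _ => n
  intCast_ofNat n := by funext σ; exact Int.cast_natCast n
  intCast_negSucc_ofNat n := by funext σ; exact Int.cast_negSucc n

instance : DirectSum.GAlgebra K (SSetCochain S K) where
  toFun := { toFun := fun r _ => r, map_zero' := rfl, map_add' := fun _ _ => rfl }
  map_one := rfl
  map_mul r s := mk_eq_mk (show 0 + 0 = 0 from rfl) fun σ => rfl
  commutes := by
    rintro r ⟨n, f⟩
    refine mk_eq_mk (show n + 0 = 0 + n by simp) fun σ => ?_
    change r * f (S.map (back n (0 + n) _).op σ) =
      f (S.map (front n (n + 0) _).op (S.map (front (n + 0) (0 + n) _).op σ)) * r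
    rw [mul_comm, back_eq_front n (0 + n) (by omega)]
    exact congrArg (fun x => f x * r) (map_map (front n (n + 0) _) (front (n + 0) (0 + n) _) σ).symm
  smul_def := by
    rintro r ⟨n, f⟩
    refine mk_eq_mk (show 0 + n = n by simp) fun σ => ?_
    change r * f σ = r * f (S.map (back n (0 + n) _).op (S.map (front (0 + n) n _).op σ))
    have e : back n (0 + n) (by omega) ≫ front (0 + n) n (by omega) = 𝟙 _ := by
      apply hom_ext
      intro i
      simp only [comp_apply', front_apply, back_apply]
      change _ = (i : ℕ)
      omega
    have := map_map (back n (0 + n) (by omega)) (front (0 + n) n (by omega)) σ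
    rw [e] at this
    exact congrArg (fun x => r * f x) (by simpa using this.symm)

theorem coboundary_apply {n : ℕ} (f : SSetCochain S K n) (σ : S _⦋n + 1⦌) :
    coboundary n f σ = ∑ i : Fin (n + 2), (-1) ^ (i : ℕ) * f (S.map (SimplexCategory.δ i).op σ) :=
  rfl

theorem coboundary_coboundary (n : ℕ) (f : SSetCochain S K n) :
    coboundary (n + 1) (coboundary n f) = 0 := by
  funext σ
  change _ = (0 : K)
  simp only [coboundary_apply, Finset.mul_sum, map_map, ← Finset.sum_product']
  rw [Finset.univ_product_univ]
  let T : Finset (Fin (n + 3) × Fin (n + 2)) := {ij | (ij.1 : ℕ) ≤ (ij.2 : ℕ)}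
  rw [← Finset.sum_add_sum_compl T, ← eq_neg_iff_add_eq_zero, ← Finset.sum_neg_distrib]
  refine Finset.sum_bij'
    (fun ij hij => (ij.2.succ, Fin.castLT ij.1
      (lt_of_le_of_lt (Finset.mem_filter.mp hij).right (Fin.is_lt ij.2))))
    (fun ij hij => (ij.2.castSucc, ij.1.pred (by
      rintro h
      simp [T, h] at hij))) ?_ ?_ ?_ ?_ ?_
  · rintro ⟨i, j⟩ hij
    simp only [T, Finset.compl_filter, Finset.mem_filter_univ, Fin.val_succ,
      Fin.val_castLT] at hij ⊢
    omega
  · rintro ⟨i, j⟩ hij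
    simp only [T, Finset.compl_filter, Finset.mem_filter_univ, Fin.val_castSucc,
      Fin.val_pred] at hij ⊢
    omega
  · rintro ⟨i, j⟩ hij
    simp
  · rintro ⟨i, j⟩ hij
    simp
  · rintro ⟨i, j⟩ hij
    simp only [T, Finset.mem_filter_univ] at hij
    have : SimplexCategory.δ j ≫ SimplexCategory.δ i =
        SimplexCategory.δ (Fin.castLT i (by omega)) ≫ SimplexCategory.δ j.succ := by
      apply hom_ext
      intro k
      have h1 := δ_cases j k
      have h2 := δ_cases i ((SimplexCategory.δ j).toOrderHom k)
      have h3 := δ_cases (Fin.castLT i (by omega)) k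
      have h4 := δ_cases j.succ ((SimplexCategory.δ (Fin.castLT i (by omega))).toOrderHom k)
      simp only [comp_apply', Fin.val_succ, Fin.val_castLT] at *
      omega
    simp only [this, Fin.val_succ, Fin.val_castLT]
    ring

/-- The coboundary on the direct sum of all cochain groups. -/
noncomputable def totalCoboundary (S : SSet.{u}) (K : Type v) [Field K] :
    (⨁ n, SSetCochain S K n) →ₗ[K] (⨁ n, SSetCochain S K n) :=
  DirectSum.toModule K ℕ _ fun n => DirectSum.lof K ℕ (SSetCochain S K) (n + 1) ∘ₗ coboundary n

theorem totalCoboundary_of (n : ℕ) (f : SSetCochain S K n) :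
    totalCoboundary S K (DirectSum.of _ n f) = DirectSum.of _ (n + 1) (coboundary n f) :=
  DirectSum.toModule_lof K n f

/-- The cochains of degree `k`; there are none in negative degrees. -/
def degree (S : SSet.{u}) (K : Type v) [Field K] : ℤ → Submodule K (⨁ n, SSetCochain S K n) :=
  fun k => match k with
    | Int.ofNat n => LinearMap.range (DirectSum.lof K ℕ (SSetCochain S K) n)
    | Int.negSucc _ => ⊥

theorem of_mem_degree (n : ℕ) (f : SSetCochain S K n) :
    DirectSum.of _ n f ∈ degree S K (n : ℤ) := ⟨f, rfl⟩

theorem eq_of_mem_degree {k : ℤ} {x : ⨁ n, SSetCochain S K n} (hx : x ∈ degree S K k) :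
    x = 0 ∨ ∃ (n : ℕ) (f : SSetCochain S K n), k = n ∧ x = DirectSum.of _ n f := by
  cases k with
  | ofNat n =>
    obtain ⟨f, rfl⟩ := hx
    exact Or.inr ⟨n, f, rfl, rfl⟩
  | negSucc n => exact Or.inl hx

instance : SetLike.GradedMonoid (degree S K) where
  one_mem := of_mem_degree 0 _
  mul_mem := by
    intro i j x y hx hy
    obtain rfl | ⟨p, f, rfl, rfl⟩ := eq_of_mem_degree hx
    · rw [zero_mul]; exact zero_mem _
    obtain rfl | ⟨q, g, rfl, rfl⟩ := eq_of_mem_degree hy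
    · rw [mul_zero]; exact zero_mem _
    rw [DirectSum.of_mul_of]
    exact_mod_cast of_mem_degree (p + q) _

noncomputable instance : DirectSum.Decomposition (degree S K) :=
  DirectSum.Decomposition.ofLinearMap (degree S K)
    (DirectSum.toModule K ℕ _ fun n =>
      DirectSum.lof K ℤ (fun k => degree S K k) (n : ℤ) ∘ₗ
        (DirectSum.lof K ℕ (SSetCochain S K) n).rangeRestrict)
    (by
      ext n f : 2
      rw [LinearMap.comp_apply, LinearMap.comp_apply, DirectSum.toModule_lof]
      exact DirectSum.coeLinearMap_lof (degree S K) (n : ℤ) _)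
    (by
      ext k x : 2
      obtain ⟨x, hx⟩ := x
      simp only [LinearMap.comp_apply, DirectSum.coeLinearMap_lof, LinearMap.id_apply]
      cases k with
      | ofNat n =>
        obtain ⟨f, rfl⟩ := hx
        simp only [DirectSum.toModule_lof]
        rfl
      | negSucc n =>
        have h0 : x = 0 := hx
        have : (⟨x, hx⟩ : degree S K (Int.negSucc n)) = 0 := Subtype.ext h0
        rw [this, h0, map_zero, map_zero])

noncomputable instance : GradedAlgebra (degree S K) where

theorem coboundary_cup_apply {p q : ℕ} (f : SSetCochain S K p) (g : SSetCochain S K q)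
    (σ : S _⦋p + q + 1⦌) :
    coboundary (p + q) (cup f g) σ =
      cup (coboundary p f) g (S.map (front (p + 1 + q) (p + q + 1) (by omega)).op σ) +
      (-1) ^ p * cup f (coboundary q g) σ := by
  have hF : ∀ i : Fin (p + q + 2), (p : ℕ) < i → front p (p + q) (by omega) ≫
      SimplexCategory.δ i = front p (p + q + 1) (by omega) := by
    intro i hi
    apply hom_ext
    intro k
    have h1 := δ_cases i ((front p (p + q) (by omega)).toOrderHom k)
    simp only [comp_apply', front_apply] at *
    omega
  have hB : ∀ i : Fin (p + q + 2), (i : ℕ) ≤ p → back q (p + q) (by omega) ≫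
      SimplexCategory.δ i = back q (p + q + 1) (by omega) := by
    intro i hi
    apply hom_ext
    intro k
    have h1 := δ_cases i ((back q (p + q) (by omega)).toOrderHom k)
    simp only [comp_apply', back_apply] at *
    omega
  have hF' : ∀ (i : Fin (p + q + 2)) (j : Fin (p + 2)), (i : ℕ) = j →
      front p (p + q) (by omega) ≫ SimplexCategory.δ i =
      SimplexCategory.δ j ≫ front (p + 1) (p + q + 1) (by omega) := by
    intro i j hij
    apply hom_ext
    intro k
    have h1 := δ_cases i ((front p (p + q) (by omega)).toOrderHom k)
    have h2 := δ_cases j k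
    simp only [comp_apply', front_apply] at *
    omega
  have hB' : ∀ (i : Fin (p + q + 2)) (j : Fin (q + 2)), (i : ℕ) = p + j →
      back q (p + q) (by omega) ≫ SimplexCategory.δ i =
      SimplexCategory.δ j ≫ back (q + 1) (p + q + 1) (by omega) := by
    intro i j hij
    apply hom_ext
    intro k
    have h1 := δ_cases i ((back q (p + q) (by omega)).toOrderHom k)
    have h2 := δ_cases j k
    simp only [comp_apply', back_apply] at *
    omega
  have e1 : front (p + 1) (p + 1 + q) (by omega) ≫ front (p + 1 + q) (p + q + 1) (by omega) =
      front (p + 1) (p + q + 1) (by omega) := hom_ext fun k => rfl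
  have e2 : back q (p + 1 + q) (by omega) ≫ front (p + 1 + q) (p + q + 1) (by omega) =
      back q (p + q + 1) (by omega) := by
    apply hom_ext
    intro k
    simp only [comp_apply', front_apply, back_apply]
    omega
  have e3 : SimplexCategory.δ (Fin.last (p + 1)) ≫ front (p + 1) (p + q + 1) (by omega) =
      front p (p + q + 1) (by omega) := by
    apply hom_ext
    intro k
    have h1 := δ_cases (Fin.last (p + 1)) k
    simp only [comp_apply', front_apply, Fin.val_last] at *
    omega
  have e4 : SimplexCategory.δ 0 ≫ back (q + 1) (p + q + 1) (by omega) =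
      back q (p + q + 1) (by omega) := by
    apply hom_ext
    intro k
    have h1 := δ_cases 0 k
    simp only [comp_apply', back_apply, Fin.val_zero] at *
    omega
  simp only [cup, coboundary_apply, map_map, e1, e2]
  change _ = _ + (-1) ^ p * (f (S.map (front p (p + q + 1) _).op σ) * ∑ x, _ *
    g (S.map (_ ≫ back (q + 1) (p + q + 1) _).op σ))
  have hsum : ∀ F : Fin (p + q + 2) → K, ∑ i, F i =
      ∑ i : Fin (p + 1), F (Fin.cast (by omega) (Fin.castAdd (q + 1) i)) +
      ∑ i : Fin (q + 1), F (Fin.cast (by omega) (Fin.natAdd (p + 1) i)) := by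
    intro F
    rw [← Fin.sum_univ_add (fun i : Fin ((p + 1) + (q + 1)) => F (Fin.cast (by omega) i))]
    exact Fintype.sum_equiv (finCongr (by omega)) _ _ fun i => rfl
  rw [Fin.sum_univ_castSucc (n := p + 1), Fin.sum_univ_succ (n := q + 1), e3, e4, hsum]
  have s1 := fun i : Fin (p + 1) =>
    hF' (Fin.cast (by omega) (Fin.castAdd (q + 1) i)) i.castSucc rfl
  have s2 := fun i : Fin (p + 1) =>
    hB (Fin.cast (by omega) (Fin.castAdd (q + 1) i)) (by simpa using Nat.lt_succ_iff.1 i.2)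
  have s3 := fun i : Fin (q + 1) =>
    hF (Fin.cast (by omega) (Fin.natAdd (p + 1) i)) (by simp; omega)
  have s4 := fun i : Fin (q + 1) =>
    hB' (Fin.cast (by omega) (Fin.natAdd (p + 1) i)) i.succ (by simp; omega)
  simp only [s1, s2, s3, s4, Fin.val_cast, Fin.val_castAdd, Fin.val_natAdd, Fin.val_castSucc,
    Fin.val_succ, Fin.val_last, Fin.val_zero]
  rw [add_mul, mul_add, mul_add, Finset.sum_mul, Finset.mul_sum, Finset.mul_sum]
  have t1 : ∀ a b c : K, a * (b * c) = a * b * c := fun a b c => (mul_assoc a b c).symm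
  have t2 : ∀ (i : ℕ) (b c : K), (-1) ^ (p + 1 + i) * (b * c) =
      (-1) ^ p * (b * ((-1) ^ (i + 1) * c)) := fun i b c => by ring
  simp only [t2]
  simp only [t1]
  ring

theorem coboundary_cup {p q : ℕ} (f : SSetCochain S K p) (g : SSetCochain S K q) :
    (DirectSum.of (SSetCochain S K) (p + q + 1) (coboundary (p + q) (cup f g))) =
      DirectSum.of (SSetCochain S K) (p + 1 + q) (cup (coboundary p f) g) +
      (p : ℤ).negOnePow •
        DirectSum.of (SSetCochain S K) (p + (q + 1)) (cup f (coboundary q g)) := by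
  have h1 : DirectSum.of (SSetCochain S K) (p + 1 + q) (cup (coboundary p f) g) =
      DirectSum.of (SSetCochain S K) (p + q + 1) (fun σ =>
        cup (coboundary p f) g (S.map (front (p + 1 + q) (p + q + 1) (by omega)).op σ)) :=
    DirectSum.of_eq_of_gradedMonoid_eq
      (mk_eq_mk (show p + 1 + q = p + q + 1 by omega) fun σ => rfl).symm
  have h2 : (p : ℤ).negOnePow •
        DirectSum.of (SSetCochain S K) (p + (q + 1)) (cup f (coboundary q g)) =
      DirectSum.of (SSetCochain S K) (p + q + 1)
        (fun σ => (-1 : K) ^ p * cup f (coboundary q g) σ) := by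
    rw [Units.smul_def, ← map_zsmul]
    congr 1
    funext σ
    change (((p : ℤ).negOnePow : ℤˣ) : ℤ) • cup f (coboundary q g) σ = _
    rw [zsmul_eq_mul]
    simp [Int.negOnePow]
  rw [h1, h2]
  refine Eq.trans ?_ (map_add (DirectSum.of (SSetCochain S K) (p + q + 1)) _ _)
  congr 1
  funext σ
  exact coboundary_cup_apply f g σ

/-- The dg-algebra of cochains on a simplicial set `S`, with the cup product and the coboundary. -/
noncomputable def cochainAlgebra (S : SSet.{u}) (K : Type v) [Field K] :
    DGAlgebra.{v, max u v} K where
  carrier := ⨁ n, SSetCochain S K n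
  deg := degree S K
  d := totalCoboundary S K
  d_mem {k x} hx := by
    obtain rfl | ⟨n, f, rfl, rfl⟩ := eq_of_mem_degree hx
    · rw [map_zero]; exact zero_mem _
    rw [totalCoboundary_of]
    exact_mod_cast of_mem_degree (n + 1) _
  d_d x := by
    induction x using DirectSum.induction_on with
    | zero => simp
    | of n f => rw [totalCoboundary_of, totalCoboundary_of, coboundary_coboundary, map_zero]
    | add x y hx hy => rw [map_add, map_add, hx, hy, add_zero]
  leibniz {k x} hx y := by
    obtain rfl | ⟨p, f, rfl, rfl⟩ := eq_of_mem_degree hx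
    · simp
    induction y using DirectSum.induction_on with
    | zero => simp
    | of q g =>
      rw [totalCoboundary_of, totalCoboundary_of, DirectSum.of_mul_of, DirectSum.of_mul_of,
        DirectSum.of_mul_of, totalCoboundary_of]
      exact coboundary_cup f g
    | add x y hx hy =>
      rw [mul_add, map_add, hx, hy, map_add, mul_add, mul_add, smul_add]
      abel

end SSetCochain

/-- The singular cochain dg-algebra `C*(X; K)` of a topological space `X`. -/
noncomputable def singularCochainAlgebra (X : Type u) [TopologicalSpace X] (K : Type v) [Field K] :
    DGAlgebra.{v, max u v} K :=
  SSetCochain.cochainAlgebra (TopCat.toSSet.obj (TopCat.of X)) K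

/-- `X` is covered by `m` open subsets whose inclusions into `X` are null-homotopic. -/
def HasCategoricalCover (X : Type u) [TopologicalSpace X] (m : ℕ) : Prop :=
  ∃ U : Fin m → Set X, (∀ i, IsOpen (U i)) ∧ (⋃ i, U i) = Set.univ ∧
    ∀ i, (⟨Subtype.val, continuous_subtype_val⟩ : C(U i, X)).Nullhomotopic

/-- The Lusternik-Schnirelmann category of `X`: the least `n` such that `X` is covered by `n + 1`
open subsets that are contractible in `X`, and `⊤` if there is none. (For nonempty `X` a cover by
fewer sets can be padded by repetition; allowing fewer sets only makes the empty space, which is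
covered by no sets at all, have category `0`.) -/
noncomputable def lsCat (X : Type u) [TopologicalSpace X] : ℕ∞ :=
  ⨅ (n : ℕ) (_ : ∃ m ≤ n + 1, HasCategoricalCover X m), (n : ℕ∞)

end

open DirectSum CategoryTheory Simplicial

/-! Suppose `X = U ∪ V` with `U`, `V` open and contractible in `X` to the same point. Running the
null-homotopy of `U` out to the inclusion and that of `V` back gives, on `W = U ∩ V`, a loop of maps
`W → X` based at a constant map, in effect a map from the suspension of `W` to `X`. The prism
operators `P₁`, `P₂` of the two halves add up to a transgression `T : C^*(X) → C^{*-1}(W)`. By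
Mayer–Vietoris, a cocycle of positive degree that vanishes on constant simplices is a coboundary as
soon as its transgression is the restriction of a cocycle of `X` (`exists_coboundary_eq_of_prism`).
Over a field there is therefore a linear map `r : C^{*-1}(W) → H^*(X)` that kills coboundaries and
sends `T a` to the class of such a cocycle `a` (`exists_retraction`).

The map `κ = r T` is the identity on cohomology in positive degrees. With an augmentation `ε` it
would map to the square-zero extension of `K`, were it multiplicative. It is so only up to the
homotopy `F(a, b) = r (± P₁ a ∪ P₂ b)` (`transgression_mul`). The prism operators satisfy an exact
Leibniz rule (`totalPrism_mul`), hence `F` is a strict cocycle relative to `ε` (`pairing_mul`) and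
no higher homotopies appear. One explicit dg-algebra on `A ⊕ H ⊕ H[-1]`, with product twisted by `F`
in the last summand (`rectification`), then maps by quasi-isomorphisms to the cochains and to the
cohomology.

Pulling a cochain back along a constant map gives more than a multiple of the unit, because constant
simplices of positive dimension carry values. So `A` is the quasi-isomorphic subalgebra of cochains
vanishing on those simplices. If the two contraction points lie in different path components, then
`U ∩ V` is empty, cohomology is concentrated in degree zero, and `isFormal_of_acyclic` applies; the
empty space is treated the same way. -/

namespace DGAlgebra

/-! ### Gradings by projections and dg-subalgebras. -/

section Graded

variable {K : Type v} [Field K] {R : Type w} [Ring R] [Algebra K R]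

/-- A family of submodules with compatible projections that spans everything is a grading. -/
theorem isInternal_of_projections (deg : ℤ → Submodule K R) (π : ℤ → R →ₗ[K] R)
    (same : ∀ n, ∀ x ∈ deg n, π n x = x) (ne : ∀ m n, m ≠ n → ∀ x ∈ deg m, π n x = 0)
    (top : ∀ x, x ∈ ⨆ n, deg n) : DirectSum.IsInternal deg := by
  classical
  refine DirectSum.isInternal_submodule_of_iSupIndep_of_iSup_eq_top ?_
    (eq_top_iff.2 fun x _ => top x)
  rw [iSupIndep_def]
  intro n
  rw [Submodule.disjoint_def]
  intro x hx hx'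
  have h0 : (⨆ j, ⨆ (_ : j ≠ n), deg j) ≤ LinearMap.ker (π n) :=
    iSup₂_le fun j hj y hy => ne j n hj y hy
  rw [← same n x hx]
  exact h0 hx'

variable (deg : ℤ → Submodule K R) [GradedAlgebra deg]

/-- The projection onto a homogeneous component. -/
noncomputable def component (n : ℤ) : R →ₗ[K] R :=
  (deg n).subtype ∘ₗ DirectSum.component K ℤ (fun i => deg i) n ∘ₗ
    (decomposeLinearEquiv deg).toLinearMap

theorem component_apply (n : ℤ) (x : R) : component deg n x = decompose deg x n := rfl

theorem component_mem (n : ℤ) (x : R) : component deg n x ∈ deg n := (decompose deg x n).2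

theorem component_same {n : ℤ} {x : R} (hx : x ∈ deg n) : component deg n x = x :=
  decompose_of_mem_same deg hx

theorem component_ne {m n : ℤ} (h : m ≠ n) {x : R} (hx : x ∈ deg m) : component deg n x = 0 :=
  decompose_of_mem_ne deg hx h

theorem map_mem_iSup {M : Type*} [AddCommGroup M] [Module K M] (f : R →ₗ[K] M)
    (D : ℤ → Submodule K M) (h : ∀ n, ∀ x ∈ deg n, ∃ m, f x ∈ D m) (x : R) :
    f x ∈ ⨆ n, D n := by
  induction x using DirectSum.Decomposition.inductionOn deg with
  | zero => simp
  | @homogeneous i m =>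
    obtain ⟨k, hk⟩ := h i m m.2
    exact Submodule.mem_iSup_of_mem k hk
  | add m m' h h' => rw [map_add]; exact add_mem h h'

end Graded

variable {K : Type v} [Field K]

/-- The restriction of a dg-algebra to a homogeneous subalgebra closed under the differential. -/
noncomputable def restrict (B : DGAlgebra.{v, w} K) (S : Subalgebra K B.carrier)
    (hd : ∀ x ∈ S, B.d x ∈ S) (hS : ∀ x ∈ S, ∀ n, component B.deg n x ∈ S) :
    DGAlgebra.{v, w} K where
  carrier := S
  deg n := (B.deg n).comap S.val.toLinearMap
  graded :=
    { one_mem := SetLike.GradedOne.one_mem (A := B.deg)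
      mul_mem := fun _ _ _ _ hx hy => SetLike.GradedMul.mul_mem (A := B.deg) hx hy
      toDecomposition := by
        classical
        refine (isInternal_of_projections _
          (fun n => ((component B.deg n).restrict (p := S.toSubmodule) (q := S.toSubmodule)
            fun x hx => hS x hx n : S →ₗ[K] S))
          (fun n x hx => Subtype.ext (component_same B.deg hx))
          (fun m n h x hx => Subtype.ext (component_ne B.deg h hx)) ?_).chooseDecomposition
        intro x
        have : x = ∑ n ∈ (decompose B.deg (x : B.carrier)).support,
            (⟨component B.deg n x, hS x x.2 n⟩ : S) := by
          apply Subtype.ext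
          rw [AddSubmonoidClass.coe_finsetSum]
          exact (sum_support_decompose B.deg (x : B.carrier)).symm
        rw [this]
        exact Submodule.sum_mem _ fun n _ => Submodule.mem_iSup_of_mem n
          (component_mem B.deg n (x : B.carrier)) }
  d := (B.d.restrict (p := S.toSubmodule) (q := S.toSubmodule) hd : S →ₗ[K] S)
  d_mem h := B.d_mem h
  d_d a := Subtype.ext (B.d_d a)
  leibniz {n a} h b := by
    apply Subtype.ext
    refine (B.leibniz h b).trans ?_
    simp only [Units.smul_def]
    rfl

section Restrict

variable (B : DGAlgebra.{v, w} K) (S : Subalgebra K B.carrier)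
    (hd : ∀ x ∈ S, B.d x ∈ S) (hS : ∀ x ∈ S, ∀ n, component B.deg n x ∈ S)

/-- The inclusion of a restricted dg-algebra. -/
noncomputable def restrictHom : Hom (B.restrict S hd hS) B where
  toAlgHom := S.val
  map_deg h := h
  map_d _ := rfl

/-- The hypothesis says that the quotient complex `B / S` is acyclic. Injectivity on cohomology uses
it for a primitive of an element of `S`, surjectivity for a cocycle, whose differential `0` lies in
`S`. -/
theorem restrictHom_isQuasiIso (h : ∀ b, B.d b ∈ S → ∃ c, b - B.d c ∈ S) :
    (B.restrictHom S hd hS).IsQuasiIso := by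
  constructor
  · rintro z hz ⟨b, hb⟩
    obtain ⟨c, hc⟩ := h b (by rw [hb]; exact z.2)
    refine ⟨⟨_, hc⟩, Subtype.ext ?_⟩
    change B.d (b - B.d c) = S.val z
    rw [map_sub, B.d_d, sub_zero, hb]
    rfl
  · intro y hy
    obtain ⟨c, hc⟩ := h y (by rw [hy]; exact S.zero_mem)
    refine ⟨⟨_, hc⟩, Subtype.ext ?_, c, ?_⟩
    · change B.d (y - B.d c) = 0
      rw [map_sub, B.d_d, sub_zero, hy]
    · change _ = y - (y - B.d c)
      abel

end Restrict

/-! ### Rectification of homotopy-multiplicative maps to square-zero extensions. -/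

/-- Data describing a homotopy-multiplicative chain map from `A` to the square-zero extension of
the ground field by the graded vector space `V`: an augmentation `ε`, a linear part `κ`
and a bilinear part `F` which measures the failure of `ε + κ` to be multiplicative. -/
structure SquareZeroMap (A : DGAlgebra.{v, w} K) {V : Type w} [Ring V] [Algebra K V]
    (degV : ℤ → Submodule K V) where
  ε : A.carrier →ₐ[K] K
  κ : A.carrier →ₗ[K] V
  F : A.carrier →ₗ[K] A.carrier →ₗ[K] V
  ε_deg : ∀ {n : ℤ} {a : A.carrier}, a ∈ A.deg n → n ≠ 0 → ε a = 0
  ε_d : ∀ a, ε (A.d a) = 0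
  κ_deg : ∀ {n : ℤ} {a : A.carrier}, a ∈ A.deg n → κ a ∈ degV n
  κ_d : ∀ a, κ (A.d a) = 0
  F_deg : ∀ {m n : ℤ} {a b : A.carrier}, a ∈ A.deg m → b ∈ A.deg n → F a b ∈ degV (m + n - 1)
  F_one_left : ∀ b, F 1 b = 0
  F_one_right : ∀ a, F a 1 = 0
  -- The Hochschild 2-cocycle identity for `V` as a bimodule through `ε`; it is exactly
  -- associativity of the rectification.
  F_mul : ∀ a b c, F (a * b) c + ε c • F a b = F a (b * c) + ε a • F b c
  -- `κ` is an `ε`-derivation up to the homotopy `F`; this is the Leibniz rule of the rectification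
  -- in the path coordinate.
  κ_mul : ∀ {n : ℤ} {a : A.carrier}, a ∈ A.deg n → ∀ b,
    κ (a * b) = ε a • κ b + ε b • κ a + F (A.d a) b + n.negOnePow • F a (A.d b)

namespace SquareZeroMap

variable {A : DGAlgebra.{v, w} K} {V : Type w} [Ring V] [Algebra K V]
  {degV : ℤ → Submodule K V} (D : SquareZeroMap A degV)

/-- The underlying vector space of the dg-algebra that rectifies a `SquareZeroMap`. -/
@[ext]
structure Carrier (D : SquareZeroMap A degV) where
  base : A.carrier
  fib : V
  path : V

namespace Carrier

variable {D}

/-- The underlying triple. -/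
def toProd : D.Carrier ≃ A.carrier × V × V where
  toFun x := (x.base, x.fib, x.path)
  invFun x := ⟨x.1, x.2.1, x.2.2⟩
  left_inv _ := rfl
  right_inv _ := rfl

instance : AddCommGroup D.Carrier := toProd.addCommGroup

instance : Module K D.Carrier := toProd.module K

@[simp] theorem base_zero : (0 : D.Carrier).base = 0 := rfl
@[simp] theorem fib_zero : (0 : D.Carrier).fib = 0 := rfl
@[simp] theorem path_zero : (0 : D.Carrier).path = 0 := rfl
@[simp] theorem base_add (x y : D.Carrier) : (x + y).base = x.base + y.base := rfl
@[simp] theorem fib_add (x y : D.Carrier) : (x + y).fib = x.fib + y.fib := rfl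
@[simp] theorem path_add (x y : D.Carrier) : (x + y).path = x.path + y.path := rfl
@[simp] theorem base_smul (r : K) (x : D.Carrier) : (r • x).base = r • x.base := rfl
@[simp] theorem fib_smul (r : K) (x : D.Carrier) : (r • x).fib = r • x.fib := rfl
@[simp] theorem path_smul (r : K) (x : D.Carrier) : (r • x).path = r • x.path := rfl

instance : One D.Carrier := ⟨⟨1, 0, 0⟩⟩

/-- A model of the homotopy pullback: `fib` is a point of the square-zero part, and `path` connects
it to `κ base`. Products of two elements of `V` are zero, and the term `F` records that `ε + κ`
preserves products only up to homotopy. -/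
instance : Mul D.Carrier :=
  ⟨fun x y => ⟨x.base * y.base, D.ε x.base • y.fib + D.ε y.base • x.fib,
    D.ε x.base • y.path + D.ε y.base • x.path + D.F x.base y.base⟩⟩

@[simp] theorem base_one : (1 : D.Carrier).base = 1 := rfl
@[simp] theorem fib_one : (1 : D.Carrier).fib = 0 := rfl
@[simp] theorem path_one : (1 : D.Carrier).path = 0 := rfl
@[simp] theorem base_mul (x y : D.Carrier) : (x * y).base = x.base * y.base := rfl
@[simp] theorem fib_mul (x y : D.Carrier) :
    (x * y).fib = D.ε x.base • y.fib + D.ε y.base • x.fib := rfl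
@[simp] theorem path_mul (x y : D.Carrier) :
    (x * y).path = D.ε x.base • y.path + D.ε y.base • x.path + D.F x.base y.base := rfl

instance : Ring D.Carrier :=
  { (inferInstance : AddCommGroup D.Carrier) with
    zero_mul := fun x => by ext <;> simp
    mul_zero := fun x => by ext <;> simp
    one_mul := fun x => by ext <;> simp [D.F_one_left]
    mul_one := fun x => by ext <;> simp [D.F_one_right]
    left_distrib := fun x y z => by
      ext
      · simp [mul_add]
      · simp only [fib_mul, fib_add, base_add, map_add]; module
      · simp only [path_mul, path_add, base_add, map_add]; module
    right_distrib := fun x y z => by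
      ext
      · simp [add_mul]
      · simp only [fib_mul, fib_add, base_add, map_add]; module
      · simp only [path_mul, path_add, base_add, map_add, LinearMap.add_apply]; module
    mul_assoc := fun x y z => by
      ext
      · simp [mul_assoc]
      · simp only [fib_mul, base_mul, map_mul]; module
      · simp only [path_mul, base_mul, map_mul]
        have := D.F_mul x.base y.base z.base
        rw [← sub_eq_zero] at this ⊢
        rw [← this]
        module }

instance : Algebra K D.Carrier :=
  Algebra.ofModule
    (fun r x y => by
      ext
      · simp
      · simp only [fib_mul, base_smul, fib_smul, map_smul, smul_eq_mul]; module
      · simp only [path_mul, base_smul, path_smul, map_smul, smul_eq_mul, LinearMap.smul_apply]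
        module)
    (fun r x y => by
      ext
      · simp
      · simp only [fib_mul, base_smul, fib_smul, map_smul, smul_eq_mul]; module
      · simp only [path_mul, base_smul, path_smul, map_smul, smul_eq_mul]
        module)

/-- The degree `n` part. -/
def deg (D : SquareZeroMap A degV) (n : ℤ) : Submodule K D.Carrier where
  carrier := {x | x.base ∈ A.deg n ∧ x.fib ∈ degV n ∧ x.path ∈ degV (n - 1)}
  add_mem' hx hy := ⟨add_mem hx.1 hy.1, add_mem hx.2.1 hy.2.1, add_mem hx.2.2 hy.2.2⟩
  zero_mem' := ⟨zero_mem _, zero_mem _, zero_mem _⟩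
  smul_mem' r _ hx := ⟨Submodule.smul_mem _ r hx.1, Submodule.smul_mem _ r hx.2.1,
    Submodule.smul_mem _ r hx.2.2⟩

theorem smul_ε_mem {m n k : ℤ} {a : A.carrier} {v : V} (ha : a ∈ A.deg m)
    (hv : v ∈ degV n) (hk : m = 0 → k = n) : D.ε a • v ∈ degV k := by
  by_cases hm : m = 0
  · rw [hk hm]
    exact Submodule.smul_mem _ _ hv
  · rw [D.ε_deg ha hm, zero_smul]
    exact zero_mem _

variable [GradedAlgebra degV]

noncomputable instance : GradedAlgebra (deg D) where
  one_mem := ⟨SetLike.GradedOne.one_mem (A := A.deg), zero_mem _, zero_mem _⟩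
  mul_mem := by
    intro i j x y hx hy
    refine ⟨SetLike.GradedMul.mul_mem (A := A.deg) hx.1 hy.1, add_mem ?_ ?_,
      add_mem (add_mem ?_ ?_) (D.F_deg hx.1 hy.1)⟩
    · exact smul_ε_mem hx.1 hy.2.1 (by omega)
    · exact smul_ε_mem hy.1 hx.2.1 (by omega)
    · exact smul_ε_mem hx.1 hy.2.2 (by omega)
    · exact smul_ε_mem hy.1 hx.2.2 (by omega)
  toDecomposition := by
    classical
    -- Projections are taken coordinatewise, with the path coordinate shifted by one degree.
    refine (isInternal_of_projections (deg D)
      (fun n => { toFun := fun x => ⟨component A.deg n x.base, component degV n x.fib,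
                    component degV (n - 1) x.path⟩
                  map_add' := fun x y => by ext <;> simp
                  map_smul' := fun r x => by ext <;> simp }) ?_ ?_ ?_).chooseDecomposition
    · rintro n x ⟨h1, h2, h3⟩
      ext
      · exact component_same _ h1
      · exact component_same _ h2
      · exact component_same _ h3
    · rintro m n h x ⟨h1, h2, h3⟩
      ext
      · exact component_ne _ h h1
      · exact component_ne _ h h2
      · exact component_ne _ (by omega) h3
    · rintro x
      have e : x = (⟨x.base, 0, 0⟩ + ⟨0, x.fib, 0⟩ + ⟨0, 0, x.path⟩ : D.Carrier) := by
        ext <;> simp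
      rw [e]
      refine add_mem (add_mem ?_ ?_) ?_
      · exact map_mem_iSup A.deg
          { toFun := fun a => (⟨a, 0, 0⟩ : D.Carrier)
            map_add' := fun x y => by ext <;> simp
            map_smul' := fun r x => by ext <;> simp } (deg D)
          (fun n x hx => ⟨n, hx, zero_mem _, zero_mem _⟩) x.base
      · exact map_mem_iSup degV
          { toFun := fun a => (⟨0, a, 0⟩ : D.Carrier)
            map_add' := fun x y => by ext <;> simp
            map_smul' := fun r x => by ext <;> simp } (deg D)
          (fun n x hx => ⟨n, zero_mem _, hx, zero_mem _⟩) x.fib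
      · exact map_mem_iSup degV
          { toFun := fun a => (⟨0, 0, a⟩ : D.Carrier)
            map_add' := fun x y => by ext <;> simp
            map_smul' := fun r x => by ext <;> simp } (deg D)
          (fun n x hx => ⟨n + 1, zero_mem _, zero_mem _, by simpa using hx⟩) x.path

end Carrier

open Carrier

variable [GradedAlgebra degV]

/-- The dg-algebra that rectifies a `SquareZeroMap`: it maps to `A` by a quasi-isomorphism, and
strictly to the square-zero extension. -/
noncomputable def rectification : DGAlgebra.{v, w} K where
  carrier := D.Carrier
  deg := Carrier.deg D
  d :=
    { toFun := fun x => ⟨A.d x.base, 0, D.κ x.base - x.fib⟩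
      map_add' := fun x y => by
        ext
        · simp
        · simp
        · simp only [base_add, fib_add, path_add, map_add]; abel
      map_smul' := fun r x => by ext <;> simp [smul_sub] }
  d_mem {n x} h := ⟨A.d_mem h.1, zero_mem _, by
    simpa using sub_mem (D.κ_deg h.1) h.2.1⟩
  d_d x := by
    ext
    · exact A.d_d _
    · rfl
    · change D.κ (A.d x.base) - 0 = 0
      rw [D.κ_d, sub_zero]
  leibniz {n x} h y := by
    have hz : ∀ z : D.Carrier, n.negOnePow • z =
        ⟨n.negOnePow • z.base, n.negOnePow • z.fib, n.negOnePow • z.path⟩ := fun z => by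
      simp only [Units.smul_def]
      rfl
    -- The sign disappears because `ε` vanishes outside degree zero, where the sign is `1`.
    have hε : ∀ v : V, n.negOnePow • (D.ε x.base • v) = D.ε x.base • v := fun v => by
      by_cases hn : n = 0
      · simp [hn]
      · rw [D.ε_deg h.1 hn, zero_smul, smul_zero]
    rw [hz]
    ext
    · exact A.leibniz h.1 y.base
    · simp [D.ε_d]
    · simp only [LinearMap.coe_mk, AddHom.coe_mk, path_mul, path_add, base_mul, fib_mul, D.ε_d,
        D.κ_mul h.1, zero_smul, zero_add, add_zero, smul_add, hε, smul_sub]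
      abel

theorem rectification_d (x : D.Carrier) :
    D.rectification.d x = (⟨A.d x.base, 0, D.κ x.base - x.fib⟩ : D.Carrier) := rfl

/-- The projection of the rectification to the source. -/
noncomputable def toSource : Hom D.rectification A where
  toAlgHom := AlgHom.ofLinearMap
    { toFun := fun x : D.Carrier => x.base, map_add' := fun _ _ => rfl, map_smul' := fun _ _ => rfl }
    rfl (fun _ _ => rfl)
  map_deg h := h.1
  map_d _ := rfl

theorem toSource_apply (x : D.Carrier) : D.toSource.toAlgHom x = x.base := rfl

/-- The fibre and path coordinates form a contractible complex. The fibre `κ a - z.path` of the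
witness makes the path coordinate of its differential equal to `z.path`; the cocycle condition
forces `z.fib = κ (d a) = 0`. -/
theorem exists_d_eq {z : D.Carrier} (hz : D.rectification.d z = 0) {a : A.carrier}
    (ha : A.d a = z.base) : ∃ y, D.rectification.d y = z := by
  refine ⟨(⟨a, D.κ a - z.path, 0⟩ : D.Carrier), ?_⟩
  rw [rectification_d] at hz
  have h3 : D.κ z.base - z.fib = 0 := congrArg Carrier.path hz
  rw [← ha, D.κ_d, zero_sub, neg_eq_zero] at h3
  exact Carrier.ext ha h3.symm (sub_sub_cancel _ _)

theorem toSource_isQuasiIso : D.toSource.IsQuasiIso := by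
  constructor
  · rintro z hz ⟨a, ha⟩
    exact D.exists_d_eq hz ha
  · intro y hy
    -- The fibre must be `κ y` for the path coordinate of the differential to vanish.
    refine ⟨(⟨y, D.κ y, 0⟩ : D.Carrier), ?_, 0, ?_⟩
    · exact Carrier.ext hy rfl (sub_self _)
    · rw [toSource_apply, map_zero, sub_self]

end SquareZeroMap

/-! ### The map from the rectification to cohomology. -/

variable (B : DGAlgebra.{v, w} K)

/-- The part of a cohomology class in nonzero degrees. -/
def cohomologyReduced : B.CohomologyRing →ₗ[K] B.CohomologyRing :=
  LinearMap.id - B.cohomologyComponent 0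

theorem cohomologyReduced_apply (x : B.CohomologyRing) :
    B.cohomologyReduced x = x - B.cohomologyComponent 0 x := rfl

theorem cohomologyReduced_idem (x : B.CohomologyRing) :
    B.cohomologyReduced (B.cohomologyReduced x) = B.cohomologyReduced x := by
  simp only [cohomologyReduced_apply, map_sub,
    B.cohomologyComponent_same (B.cohomologyComponent_mem 0 x)]
  abel

theorem cohomologyReduced_algebraMap (r : K) :
    B.cohomologyReduced (algebraMap K _ r) = 0 := by
  rw [cohomologyReduced_apply, B.cohomologyComponent_same, sub_self]
  exact SetLike.algebraMap_mem_graded B.cohomologyDeg r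

variable {B}

theorem Hom.IsQuasiIso.comp {A B C : DGAlgebra.{v, w} K} {f : Hom A B} {g : Hom B C}
    (hf : f.IsQuasiIso) (hg : g.IsQuasiIso) :
    (⟨g.toAlgHom.comp f.toAlgHom, fun h => g.map_deg (f.map_deg h), fun a => by
      simp [f.map_d, g.map_d]⟩ : Hom A C).IsQuasiIso := by
  constructor
  · rintro z hz ⟨c, hc⟩
    exact hf.1 z hz (hg.1 _ (by rw [← f.map_d, hz, map_zero]) ⟨c, hc⟩)
  · intro y hy
    obtain ⟨z, hz, c, hc⟩ := hg.2 y hy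
    obtain ⟨x, hx, b, hb⟩ := hf.2 z hz
    refine ⟨x, hx, c + g.toAlgHom b, ?_⟩
    rw [map_add, hc, ← g.map_d, hb, map_sub]
    simp

namespace SquareZeroMap

variable {A : DGAlgebra.{v, w} K} (D : SquareZeroMap A B.cohomologyDeg) (f : Hom A B)

/-- For closed `b` the only term with a degree-dependent sign drops out, so the formula is additive
in `a` and needs no homogeneity. -/
theorem κ_mul_of_d_eq_zero (a : A.carrier) {b : A.carrier} (hb : A.d b = 0) :
    D.κ (a * b) = D.ε a • D.κ b + D.ε b • D.κ a + D.F (A.d a) b := by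
  induction a using DirectSum.Decomposition.inductionOn A.deg with
  | zero => simp
  | homogeneous m => simp [D.κ_mul m.2, hb]
  | add m m' h h' =>
    rw [add_mul, map_add, h, h']
    simp only [map_add, LinearMap.add_apply]
    module

/-- The image of a cocycle under a morphism. -/
def _root_.DGAlgebra.Hom.mapCocycle {a : A.carrier} (ha : A.d a = 0) : B.cocycles :=
  ⟨f.toAlgHom a, by
    change B.d _ = 0
    rw [← f.map_d, ha, map_zero]⟩

variable {D f} (hf : f.IsQuasiIso)
  (hD : ∀ (a : A.carrier) (ha : A.d a = 0), B.toCohomology (f.mapCocycle ha) =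
    algebraMap K B.CohomologyRing (D.ε a) + B.cohomologyReduced (D.κ a))

include hf hD

/-- Subtracting the scalar `ε a` from a representing cocycle `a` keeps it closed and removes the
scalar part of its class. -/
theorem exists_cohomologyReduced_eq (v : B.CohomologyRing) :
    ∃ (a : A.carrier) (ha : A.d a = 0), D.ε a = 0 ∧
      B.toCohomology (f.mapCocycle ha) = B.cohomologyReduced v := by
  obtain ⟨y, rfl⟩ := B.toCohomology_surjective v
  obtain ⟨a, ha, b, hb⟩ := hf.2 y y.2
  have hy : B.toCohomology y = B.toCohomology (f.mapCocycle ha) := by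
    rw [← sub_eq_zero, ← map_sub, toCohomology_eq_zero]
    exact ⟨b, hb⟩
  have h1 : A.d (a - algebraMap K _ (D.ε a)) = 0 := by
    rw [map_sub, ha, Algebra.algebraMap_eq_smul_one, map_smul, A.d_one, smul_zero, sub_zero]
  have h0 : D.ε (a - algebraMap K _ (D.ε a)) = 0 := by simp
  refine ⟨a - algebraMap K _ (D.ε a), h1, h0, ?_⟩
  have h2 : f.mapCocycle h1 = f.mapCocycle ha - algebraMap K _ (D.ε a) := by
    apply Subtype.ext
    change f.toAlgHom _ = f.toAlgHom a - algebraMap K _ (D.ε a)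
    simp
  have h3 : B.toCohomology (algebraMap K _ (D.ε a)) = algebraMap K _ (D.ε a) := rfl
  rw [h2, map_sub, hy, h3, hD, map_add, cohomologyReduced_algebraMap, cohomologyReduced_idem,
    add_sub_cancel_left, zero_add]

/-- The vanishing of cup products: for closed `a`, `b` with `ε a = ε b = 0`, every term in the
formula for `κ (a * b)` is zero, and so is `ε (a * b)`. Hence the projection of the square-zero
extension to cohomology is multiplicative. -/
theorem cohomologyReduced_mul (v w : B.CohomologyRing) :
    B.cohomologyReduced v * B.cohomologyReduced w = 0 := by
  obtain ⟨a, ha, ha0, hav⟩ := exists_cohomologyReduced_eq hf hD v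
  obtain ⟨b, hb, hb0, hbw⟩ := exists_cohomologyReduced_eq hf hD w
  have hab : A.d (a * b) = 0 := by rw [A.d_mul_of_d_eq_zero a hb, ha, zero_mul]
  have h1 : f.mapCocycle ha * f.mapCocycle hb = f.mapCocycle hab :=
    Subtype.ext (map_mul f.toAlgHom a b).symm
  have h2 : B.toCohomology (f.mapCocycle ha) * B.toCohomology (f.mapCocycle hb) =
    B.toCohomology (f.mapCocycle ha * f.mapCocycle hb) := rfl
  rw [← hav, ← hbw, h2, h1, hD, D.κ_mul_of_d_eq_zero a hb, ha, map_mul, ha0, hb0]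
  simp

/-- The algebra map from the rectification to cohomology. -/
noncomputable def toCohomologyAlgHom : D.Carrier →ₐ[K] B.CohomologyRing :=
  AlgHom.ofLinearMap
    { toFun := fun x => algebraMap K B.CohomologyRing (D.ε x.base) + B.cohomologyReduced x.fib
      map_add' := fun x y => by
        simp only [Carrier.base_add, Carrier.fib_add, map_add]
        abel
      map_smul' := fun r x => by
        simp only [Carrier.base_smul, Carrier.fib_smul, map_smul, smul_eq_mul, map_mul,
          RingHom.id_apply, smul_add]
        rw [Algebra.smul_def r (algebraMap K B.CohomologyRing _)] }
    (by simp)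
    (fun x y => by
      simp only [LinearMap.coe_mk, AddHom.coe_mk, Carrier.base_mul, Carrier.fib_mul]
      rw [add_mul, mul_add, mul_add, cohomologyReduced_mul hf hD, map_mul, map_mul, map_add,
        map_smul, map_smul, ← Algebra.smul_def (D.ε x.base) (B.cohomologyReduced _),
        ← Algebra.commutes (D.ε y.base) (B.cohomologyReduced _),
        ← Algebra.smul_def (D.ε y.base) (B.cohomologyReduced _)]
      abel)

theorem toCohomologyAlgHom_apply (x : D.Carrier) : toCohomologyAlgHom hf hD x =
    algebraMap K B.CohomologyRing (D.ε x.base) + B.cohomologyReduced x.fib := rfl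

/-- The path coordinate of `d x = 0` gives `fib = κ base`. So on classes this map agrees with `f`
composed with the projection to `A`, and its quasi-isomorphism property comes from that of `f`. -/
theorem toCohomologyAlgHom_of_d_eq_zero {x : D.Carrier} (hx : D.rectification.d x = 0)
    (hx' : A.d x.base = 0) :
    toCohomologyAlgHom hf hD x = B.toCohomology (f.mapCocycle hx') := by
  have h3 : D.κ x.base - x.fib = 0 := congrArg Carrier.path hx
  rw [toCohomologyAlgHom_apply, hD, sub_eq_zero.1 h3]

/-- The morphism from the rectification to cohomology. -/
noncomputable def toCohomologyHom : Hom D.rectification B.cohomology where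
  toAlgHom := toCohomologyAlgHom hf hD
  map_deg {n x} h := by
    change algebraMap K B.CohomologyRing (D.ε (Carrier.base x)) +
      B.cohomologyReduced (Carrier.fib x) ∈ B.cohomologyDeg n
    by_cases hn : n = 0
    · subst hn
      rw [cohomologyReduced_apply, B.cohomologyComponent_same h.2.1, sub_self, add_zero]
      exact SetLike.algebraMap_mem_graded B.cohomologyDeg _
    · rw [D.ε_deg h.1 hn, map_zero, zero_add, cohomologyReduced_apply,
        B.cohomologyComponent_ne hn h.2.1, sub_zero]
      exact h.2.1
  map_d x := by
    change algebraMap K B.CohomologyRing (D.ε (A.d (Carrier.base x))) +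
      B.cohomologyReduced 0 = 0
    rw [D.ε_d, map_zero, map_zero, add_zero]

theorem toCohomologyHom_isQuasiIso : (toCohomologyHom hf hD).IsQuasiIso := by
  constructor
  · rintro z hz ⟨b, hb⟩
    have hz' : A.d (Carrier.base z) = 0 := congrArg Carrier.base hz
    have h0 : toCohomologyAlgHom hf hD z = 0 := hb.symm
    rw [toCohomologyAlgHom_of_d_eq_zero hf hD hz hz', toCohomology_eq_zero] at h0
    obtain ⟨a, ha⟩ := hf.1 _ hz' h0
    exact D.exists_d_eq hz ha
  · intro y _
    obtain ⟨z, rfl⟩ := B.toCohomology_surjective y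
    obtain ⟨a, ha, b, hb⟩ := hf.2 z z.2
    have hx : D.rectification.d (⟨a, D.κ a, 0⟩ : D.Carrier) = 0 :=
      Carrier.ext ha rfl (sub_self _)
    refine ⟨(⟨a, D.κ a, 0⟩ : D.Carrier), hx, 0, ?_⟩
    have h1 : B.toCohomology z = toCohomologyAlgHom hf hD ⟨a, D.κ a, 0⟩ := by
      rw [toCohomologyAlgHom_of_d_eq_zero hf hD hx ha, ← sub_eq_zero, ← map_sub,
        toCohomology_eq_zero]
      exact ⟨b, hb⟩
    rw [map_zero]
    exact (sub_eq_zero.2 h1).symm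

/-- A dg-algebra that admits a map to a square-zero extension inducing the identity in cohomology
is formal. -/
theorem isFormal : B.IsFormal :=
  -- The zigzag is `B ← rectification → H(B)`, the left leg passing through `A`.
  .trans _ _ _ (.symm _ _ (.rel _ _ ⟨_, D.toSource_isQuasiIso.comp hf⟩))
    (.rel _ _ ⟨_, toCohomologyHom_isQuasiIso hf hD⟩)

end SquareZeroMap

end DGAlgebra

/-! ### Formality when cohomology is concentrated in degree zero. -/

namespace DGAlgebra

variable {K : Type v} [Field K]

theorem sub_component_zero_mem_range (B : DGAlgebra.{v, w} K)
    (h : ∀ n ≠ 0, ∀ x ∈ B.deg n, B.d x = 0 → ∃ y, B.d y = x) {x : B.carrier} (hx : B.d x = 0) :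
    ∃ y, B.d y = x - component B.deg 0 x := by
  classical
  change _ ∈ LinearMap.range B.d
  have hsum := sum_support_decompose B.deg x
  have hn : ∀ n ≠ 0, (decompose B.deg x n : B.carrier) ∈ LinearMap.range B.d := fun n hn =>
    h n hn _ (decompose B.deg x n).2 (B.d_component_eq_zero hx n)
  have key : x - component B.deg 0 x =
      ∑ n ∈ (decompose B.deg x).support.erase 0, (decompose B.deg x n : B.carrier) := by
    by_cases h0 : 0 ∈ (decompose B.deg x).support
    · rw [Finset.sum_erase_eq_sub h0, hsum, component_apply]
    · rw [Finset.erase_eq_of_notMem h0, hsum, component_apply]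
      rw [DFinsupp.notMem_support_iff] at h0
      rw [h0]
      simp
  rw [key]
  exact Submodule.sum_mem _ fun n hn' => hn n (Finset.ne_of_mem_erase hn')

/-- A nonnegatively graded dg-algebra whose cohomology is concentrated in degree zero is formal. -/
theorem isFormal_of_acyclic (B : DGAlgebra.{v, w} K) (hneg : ∀ x ∈ B.deg (-1), x = 0)
    (h : ∀ n ≠ 0, ∀ x ∈ B.deg n, B.d x = 0 → ∃ y, B.d y = x) : B.IsFormal := by
  -- The degree-zero cocycles `S` represent all of cohomology, and the zigzag is `B ← S → H(B)`.
  let S : Subalgebra K B.carrier :=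
    { carrier := {x | x ∈ B.deg 0 ∧ B.d x = 0}
      mul_mem' := fun {a b} ha hb => ⟨by
        simpa using SetLike.GradedMul.mul_mem (A := B.deg) ha.1 hb.1,
        B.cocycles.mul_mem ha.2 hb.2⟩
      add_mem' := fun {a b} ha hb => ⟨add_mem ha.1 hb.1, B.cocycles.add_mem ha.2 hb.2⟩
      algebraMap_mem' := fun r => ⟨SetLike.algebraMap_mem_graded B.deg r,
        B.cocycles.algebraMap_mem r⟩ }
  have hd : ∀ x ∈ S, B.d x ∈ S := fun x hx => by rw [hx.2]; exact S.zero_mem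
  have hS : ∀ x ∈ S, ∀ n, component B.deg n x ∈ S := fun x hx n => by
    by_cases hn : 0 = n
    · subst hn
      rw [component_same _ hx.1]
      exact hx
    · rw [component_ne _ hn hx.1]
      exact S.zero_mem
  have h1 : (B.restrictHom S hd hS).IsQuasiIso := by
    refine B.restrictHom_isQuasiIso S hd hS fun b hb => ?_
    -- As `d b` has degree zero, it is the differential of the component of `b` in degree `-1`,
    -- which vanishes.
    have hb0 : B.d b = 0 := by
      rw [← component_same B.deg hb.1, component_apply]
      have := B.decompose_d b (-1)
      rw [hneg _ (decompose B.deg b (-1)).2, map_zero] at this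
      exact this
    obtain ⟨c, hc⟩ := B.sub_component_zero_mem_range h hb0
    refine ⟨c, ?_⟩
    rw [hc, sub_sub_cancel]
    exact ⟨component_mem _ _ _, B.d_component_eq_zero hb0 0⟩
  have hle : S ≤ B.cocycles := fun x hx => hx.2
  let g : Hom (B.restrict S hd hS) B.cohomology :=
    { toAlgHom := ((Ideal.Quotient.mkₐ K B.coboundaries).comp (Subalgebra.inclusion hle) :
        S →ₐ[K] B.cocycles ⧸ B.coboundaries)
      map_deg := fun {n a} ha => ⟨Subalgebra.inclusion hle a, ha, rfl⟩
      map_d := fun a => by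
        have : (B.restrict S hd hS).d a = 0 := Subtype.ext a.2.2
        exact (congrArg _ this).trans
          (map_zero ((Ideal.Quotient.mkₐ K B.coboundaries).comp (Subalgebra.inclusion hle))) }
  have h2 : g.IsQuasiIso := by
    constructor
    · rintro z hz ⟨b, hb⟩
      have h0 : B.toCohomology (Subalgebra.inclusion hle z) = 0 := hb.symm
      rw [toCohomology_eq_zero] at h0
      exact h1.1 z hz h0
    · intro y _
      obtain ⟨z, rfl⟩ := B.toCohomology_surjective y
      obtain ⟨a, ha, b, hb⟩ := h1.2 z z.2
      refine ⟨a, ha, 0, ?_⟩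
      have : B.toCohomology z = B.toCohomology (Subalgebra.inclusion hle a) := by
        rw [← sub_eq_zero, ← map_sub, toCohomology_eq_zero]
        exact ⟨b, hb⟩
      rw [map_zero]
      exact (sub_eq_zero.2 this).symm
  exact .trans _ _ _ (.symm _ _ (.rel _ _ ⟨_, h1⟩)) (.rel _ _ ⟨_, h2⟩)

end DGAlgebra

/-! ### Simplicial homotopies and the prism operator. -/

namespace SSetCochain

variable {S T : SSet.{u}} {K : Type v} [Field K]

/-- A map of simplicial sets, as a family of functions on simplices. -/
@[ext]
structure SimplexMap (S T : SSet.{u}) where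
  toFun : ∀ n : ℕ, S _⦋n⦌ → T _⦋n⦌
  map : ∀ {m n : ℕ} (θ : ⦋m⦌ ⟶ ⦋n⦌) (σ : S _⦋n⦌),
    T.map θ.op (toFun n σ) = toFun m (S.map θ.op σ)

/-- The map induced by a map of simplicial sets on cochains. -/
def pullback (φ : SimplexMap S T) (n : ℕ) : SSetCochain T K n →ₗ[K] SSetCochain S K n where
  toFun f σ := f (φ.toFun n σ)
  map_add' _ _ := rfl
  map_smul' _ _ := rfl

theorem pullback_apply (φ : SimplexMap S T) {n : ℕ} (f : SSetCochain T K n) (σ : S _⦋n⦌) :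
    pullback φ n f σ = f (φ.toFun n σ) := rfl

theorem pullback_coboundary (φ : SimplexMap S T) {n : ℕ} (f : SSetCochain T K n) :
    pullback φ (n + 1) (coboundary n f) = coboundary n (pullback φ n f) := by
  funext σ
  simp only [coboundary_apply, pullback_apply, φ.map]

/-- The map induced by a map of simplicial sets on the direct sum of all cochain groups. -/
noncomputable def totalPullback (φ : SimplexMap S T) (K : Type v) [Field K] :
    (⨁ n, SSetCochain T K n) →ₗ[K] (⨁ n, SSetCochain S K n) :=
  DirectSum.toModule K ℕ _ fun n => DirectSum.lof K ℕ (SSetCochain S K) n ∘ₗ pullback φ n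

theorem totalPullback_of (φ : SimplexMap S T) (n : ℕ) (f : SSetCochain T K n) :
    totalPullback φ K (DirectSum.of (SSetCochain T K) n f) =
      DirectSum.of (SSetCochain S K) n (pullback φ n f) :=
  DirectSum.toModule_lof K n f

theorem of_eq_of {n m : ℕ} (h : m = n) {f : SSetCochain S K n} {g : SSetCochain S K m}
    (H : ∀ σ : S _⦋n⦌, f σ = g (S.map (front m n h.le).op σ)) :
    DirectSum.of (SSetCochain S K) m g = DirectSum.of (SSetCochain S K) n f :=
  (DirectSum.of_eq_of_gradedMonoid_eq (mk_eq_mk h H)).symm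

/-- The sign automorphism `f ↦ (-1) ^ n f` for `f` of degree `n`. -/
noncomputable def sign (S : SSet.{u}) (K : Type v) [Field K] :
    (⨁ n, SSetCochain S K n) →ₗ[K] (⨁ n, SSetCochain S K n) :=
  DirectSum.toModule K ℕ _ fun n => (-1 : K) ^ n • DirectSum.lof K ℕ (SSetCochain S K) n

theorem sign_of (n : ℕ) (f : SSetCochain S K n) :
    sign S K (DirectSum.of _ n f) = (-1 : K) ^ n • DirectSum.of (SSetCochain S K) n f :=
  DirectSum.toModule_lof K n f

/-- The vertex map of the `i`-th face. -/
def face (n i : ℕ) : ⦋n⦌ ⟶ ⦋n + 1⦌ :=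
  SimplexCategory.mkHom ⟨fun j => ⟨if (j : ℕ) < i then j else j + 1, by split_ifs <;> omega⟩,
    fun a b hab => by
      simp only [Fin.le_def] at hab ⊢
      split_ifs <;> omega⟩

theorem face_apply (n i : ℕ) (j : Fin (n + 1)) :
    ((face n i).toOrderHom j : ℕ) = if (j : ℕ) < i then (j : ℕ) else j + 1 := rfl

/-- With faces indexed by natural numbers, coboundaries become sums over ranges and simplicial
identities become linear arithmetic. -/
theorem δ_eq_face {n : ℕ} (i : Fin (n + 2)) : SimplexCategory.δ i = face n i := by
  apply hom_ext
  intro j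
  rw [face_apply]
  have := δ_cases i j
  split_ifs <;> omega

theorem coboundary_eq_sum_range {n : ℕ} (f : SSetCochain S K n) (σ : S _⦋n + 1⦌) :
    coboundary n f σ = ∑ i ∈ Finset.range (n + 2), (-1) ^ i * f (S.map (face n i).op σ) := by
  rw [coboundary_apply, Finset.sum_range]
  simp only [δ_eq_face]

/-- The vertex map of the `i`-th degeneracy. -/
def degeneracy (n m : ℕ) (h : n = m + 1) (i : ℕ) : ⦋n⦌ ⟶ ⦋m⦌ :=
  -- The cap at `m` takes effect only for `i > m`; for `i ≤ m` this is the usual degeneracy.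
  SimplexCategory.mkHom ⟨fun j => ⟨min (if (j : ℕ) ≤ i then j else j - 1) m, by omega⟩,
    fun a b hab => by
      simp only [Fin.le_def] at hab ⊢
      split_ifs <;> omega⟩

theorem degeneracy_apply (n m : ℕ) (h : n = m + 1) (i : ℕ) (j : Fin (n + 1)) :
    ((degeneracy n m h i).toOrderHom j : ℕ) = min (if (j : ℕ) ≤ i then (j : ℕ) else j - 1) m := rfl

/-- A homotopy of maps `S → T` of simplicial sets: a map from the product of `S` with the
(codiscrete) interval to `T`. -/
structure SimplexHomotopy (S T : SSet.{u}) where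
  toFun : ∀ n : ℕ, S _⦋n⦌ → (Fin (n + 1) → Bool) → T _⦋n⦌
  map : ∀ {m n : ℕ} (θ : ⦋m⦌ ⟶ ⦋n⦌) (σ : S _⦋n⦌) (χ : Fin (n + 1) → Bool),
    T.map θ.op (toFun n σ χ) = toFun m (S.map θ.op σ) (fun i => χ (θ.toOrderHom i))

namespace SimplexHomotopy

variable (H : SimplexHomotopy S T)

/-- The maps at the two ends of a homotopy. -/
def endpoint (b : Bool) : SimplexMap S T where
  toFun n σ := H.toFun n σ fun _ => b
  map θ σ := H.map θ σ _

/-- The prism operator. -/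
def prism (n m : ℕ) (h : n = m + 1) : SSetCochain T K n →ₗ[K] SSetCochain S K m where
  -- The `i`-th top simplex of the prism: vertex `i` is doubled, its first copy and everything
  -- before it at the bottom, the rest at the top.
  toFun f σ := ∑ i ∈ Finset.range n, (-1) ^ i *
    f (H.toFun n (S.map (degeneracy n m h i).op σ) fun j => decide (i < j))
  map_add' f g := by
    funext σ
    simp only [Pi.add_apply, mul_add, Finset.sum_add_distrib]
  map_smul' r f := by
    funext σ
    simp only [Pi.smul_apply, smul_eq_mul, RingHom.id_apply, Finset.mul_sum]
    exact Finset.sum_congr rfl fun i _ => by ring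

theorem prism_apply {n m : ℕ} (h : n = m + 1) (f : SSetCochain T K n) (σ : S _⦋m⦌) :
    H.prism n m h f σ = ∑ i ∈ Finset.range n, (-1) ^ i *
      f (H.toFun n (S.map (degeneracy n m h i).op σ) fun j => decide (i < j)) := rfl

/-- The cancellation pattern of the prism: `a` holds the terms of the prism of a coboundary, `b`
those of the coboundary of a prism. The entries of `a` away from `j = i` and `j = i + 1` cancel `b`;
these two are the interior walls and telescope through `G`. -/
theorem _root_.Finset.sum_prism {a b : ℕ → ℕ → K} {G : ℕ → K} (n : ℕ)
    (h1 : ∀ i j, j ≤ i → i < n → a (i + 1) j = -b i j)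
    (h2 : ∀ i j, i < j → j ≤ n → a i (j + 1) = -b i j)
    (h3 : ∀ i ≤ n, a i i = G i) (h4 : ∀ i ≤ n, a i (i + 1) = -G (i + 1)) :
    ∑ i ∈ Finset.range n, ∑ j ∈ Finset.range (n + 1), b i j +
      ∑ i ∈ Finset.range (n + 1), ∑ j ∈ Finset.range (n + 2), a i j =
      G 0 - G (n + 1) := by
  have ha : ∀ i ∈ Finset.range (n + 1), ∑ j ∈ Finset.range (n + 2), a i j =
      ∑ j ∈ Finset.range i, a i j + (G i - G (i + 1)) - ∑ j ∈ Finset.Ico (i + 1) (n + 1), b i j := by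
    intro i hi
    rw [Finset.mem_range] at hi
    have e1 : ∑ j ∈ Finset.Ico (i + 2) (n + 2), a i j =
        - ∑ j ∈ Finset.Ico (i + 1) (n + 1), b i j := by
      rw [← Finset.sum_Ico_add' (fun j => a i j) (i + 1) (n + 1) 1, ← Finset.sum_neg_distrib]
      refine Finset.sum_congr rfl fun j hj => ?_
      rw [Finset.mem_Ico] at hj
      exact h2 i j (by omega) (by omega)
    rw [← Finset.sum_range_add_sum_Ico _ (show i + 2 ≤ n + 2 by omega), e1,
      Finset.sum_range_succ, Finset.sum_range_succ, h3 i (by omega), h4 i (by omega)]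
    ring
  have hb : ∀ i ∈ Finset.range n, ∑ j ∈ Finset.range (n + 1), b i j =
      ∑ j ∈ Finset.range (i + 1), b i j + ∑ j ∈ Finset.Ico (i + 1) (n + 1), b i j := by
    intro i hi
    rw [Finset.mem_range] at hi
    rw [Finset.sum_range_add_sum_Ico _ (by omega)]
  have e2 : ∑ i ∈ Finset.range n, ∑ j ∈ Finset.range (i + 1), a (i + 1) j =
      - ∑ i ∈ Finset.range n, ∑ j ∈ Finset.range (i + 1), b i j := by
    rw [← Finset.sum_neg_distrib]
    refine Finset.sum_congr rfl fun i hi => ?_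
    rw [← Finset.sum_neg_distrib]
    refine Finset.sum_congr rfl fun j hj => ?_
    rw [Finset.mem_range] at hi hj
    exact h1 i j (by omega) hi
  -- The outer sums differ in length by one, but the extra terms, at `i = 0` below the diagonal and
  -- at `i = n` above it, are empty sums.
  rw [Finset.sum_congr rfl ha, Finset.sum_congr rfl hb, Finset.sum_sub_distrib,
    Finset.sum_add_distrib, Finset.sum_add_distrib,
    Finset.sum_range_sub', Finset.sum_range_succ' (fun i => ∑ j ∈ Finset.range i, a i j), e2,
    Finset.sum_range_succ (fun i => ∑ j ∈ Finset.Ico (i + 1) (n + 1), b i j)]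
  simp

/-- The term of the coboundary of the prism operator at a given position. -/
theorem prism_coboundary_eq {n : ℕ} (f : SSetCochain T K n) (σ : S _⦋n⦌) :
    H.prism (n + 1) n rfl (coboundary n f) σ =
      ∑ i ∈ Finset.range (n + 1), ∑ j ∈ Finset.range (n + 2), (-1) ^ (i + j) *
        f (H.toFun n (S.map (face n j ≫ degeneracy (n + 1) n rfl i).op σ)
          fun k => decide (i < ((face n j).toOrderHom k : ℕ))) := by
  rw [prism_apply]
  refine Finset.sum_congr rfl fun i _ => ?_
  rw [coboundary_eq_sum_range, Finset.mul_sum]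
  refine Finset.sum_congr rfl fun j _ => ?_
  rw [H.map, map_map, pow_add, mul_assoc]

theorem coboundary_prism_add {n : ℕ} (f : SSetCochain T K (n + 1)) :
    coboundary n (H.prism (n + 1) n rfl f) +
      H.prism (n + 2) (n + 1) rfl (coboundary (n + 1) f) =
      pullback (H.endpoint true) (n + 1) f - pullback (H.endpoint false) (n + 1) f := by
  funext σ
  have e1 : coboundary n (H.prism (n + 1) n rfl f) σ =
      ∑ i ∈ Finset.range (n + 1), ∑ j ∈ Finset.range (n + 2), (-1) ^ (i + j) *
        f (H.toFun (n + 1) (S.map (degeneracy (n + 1) n rfl i ≫ face n j).op σ)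
          fun k => decide (i < (k : ℕ))) := by
    rw [coboundary_eq_sum_range, Finset.sum_comm]
    refine Finset.sum_congr rfl fun j _ => ?_
    rw [prism_apply, Finset.mul_sum]
    refine Finset.sum_congr rfl fun i _ => ?_
    rw [map_map, pow_add]
    ring
  have key := Finset.sum_prism (K := K)
    (a := fun i j => (-1) ^ (i + j) *
        f (H.toFun (n + 1) (S.map (face (n + 1) j ≫ degeneracy (n + 2) (n + 1) rfl i).op σ)
          fun k => decide (i < ((face (n + 1) j).toOrderHom k : ℕ))))
    (b := fun i j => (-1) ^ (i + j) *
        f (H.toFun (n + 1) (S.map (degeneracy (n + 1) n rfl i ≫ face n j).op σ)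
          fun k => decide (i < (k : ℕ))))
    -- `G i` is the wall with its first `i` vertices at the bottom, so `G 0` and `G (n + 2)` are the
    -- two ends of the homotopy.
    (G := fun i => f (H.toFun (n + 1) σ fun k => decide (i ≤ (k : ℕ)))) (n + 1) ?_ ?_ ?_ ?_
  · change coboundary n (H.prism (n + 1) n rfl f) σ +
      H.prism (n + 2) (n + 1) rfl (coboundary (n + 1) f) σ = _
    rw [e1, prism_coboundary_eq]
    refine key.trans ?_
    change _ = f (H.toFun (n + 1) σ fun _ => true) - f (H.toFun (n + 1) σ fun _ => false)
    congr 4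
    funext k
    simp only [decide_eq_false_iff_not]
    omega
  · intro i j hji hi
    have e : face (n + 1) j ≫ degeneracy (n + 2) (n + 1) rfl (i + 1) =
        degeneracy (n + 1) n rfl i ≫ face n j := by
      apply hom_ext
      intro k
      simp only [comp_apply', face_apply, degeneracy_apply]
      split_ifs <;> omega
    have e' : (fun k : Fin (n + 1 + 1) => decide (i + 1 < ((face (n + 1) j).toOrderHom k : ℕ))) =
        fun k : Fin (n + 1 + 1) => decide (i < (k : ℕ)) := by
      funext k
      rw [decide_eq_decide, face_apply]
      split_ifs <;> omega
    simp only [e, e']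
    ring
  · intro i j hij hj
    have e : face (n + 1) (j + 1) ≫ degeneracy (n + 2) (n + 1) rfl i =
        degeneracy (n + 1) n rfl i ≫ face n j := by
      apply hom_ext
      intro k
      simp only [comp_apply', face_apply, degeneracy_apply]
      split_ifs <;> omega
    have e' : (fun k : Fin (n + 1 + 1) => decide (i < ((face (n + 1) (j + 1)).toOrderHom k : ℕ))) =
        fun k : Fin (n + 1 + 1) => decide (i < (k : ℕ)) := by
      funext k
      rw [decide_eq_decide, face_apply]
      split_ifs <;> omega
    simp only [e, e']
    ring
  · intro i hi
    have e : face (n + 1) i ≫ degeneracy (n + 2) (n + 1) rfl i = 𝟙 _ := by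
      apply hom_ext
      intro k
      simp only [comp_apply', face_apply, degeneracy_apply]
      change _ = (k : ℕ)
      split_ifs <;> omega
    have e' : (fun k : Fin (n + 1 + 1) => decide (i < ((face (n + 1) i).toOrderHom k : ℕ))) =
        fun k : Fin (n + 1 + 1) => decide (i ≤ (k : ℕ)) := by
      funext k
      rw [decide_eq_decide, face_apply]
      split_ifs <;> omega
    simp [e, e', ← two_mul]
  · intro i hi
    have e : face (n + 1) (i + 1) ≫ degeneracy (n + 2) (n + 1) rfl i = 𝟙 _ := by
      apply hom_ext
      intro k
      simp only [comp_apply', face_apply, degeneracy_apply]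
      change _ = (k : ℕ)
      split_ifs <;> omega
    have e' : (fun k : Fin (n + 1 + 1) => decide (i < ((face (n + 1) (i + 1)).toOrderHom k : ℕ))) =
        fun k : Fin (n + 1 + 1) => decide (i + 1 ≤ (k : ℕ)) := by
      funext k
      rw [decide_eq_decide, face_apply]
      split_ifs <;> omega
    simp [e, e', ← two_mul, ← add_assoc, pow_succ]

end SimplexHomotopy

end SSetCochain

/-! ### Operators on the direct sum of all cochain groups. -/

namespace SSetCochain

variable {S T : SSet.{u}} {K : Type v} [Field K]

section Total

instance : IsScalarTower K (⨁ n, SSetCochain S K n) (⨁ n, SSetCochain S K n) :=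
  ⟨fun r x y => Algebra.smul_mul_assoc r x y⟩

instance : SMulCommClass K (⨁ n, SSetCochain S K n) (⨁ n, SSetCochain S K n) :=
  ⟨fun r x y => (Algebra.mul_smul_comm r x y).symm⟩

theorem total_neg_smul (r : K) (x : ⨁ n, SSetCochain S K n) : (-r) • x = -(r • x) :=
  neg_smul r x

theorem total_negOnePow_smul (n : ℕ) (x : ⨁ n, SSetCochain S K n) :
    (n : ℤ).negOnePow • x = (-1 : K) ^ n • x := by
  induction n with
  | zero => rw [pow_zero, one_smul]; simp
  | succ n ih =>
    rw [pow_succ, mul_neg_one, total_neg_smul, ← ih, Nat.cast_succ, Int.negOnePow_succ,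
      Units.neg_smul]

theorem totalCoboundary_apply (x : ⨁ n, SSetCochain S K n) (n : ℕ) :
    totalCoboundary S K x (n + 1) = coboundary n (x n) := by
  induction x using DirectSum.induction_on with
  | zero => simp
  | of m f =>
    rw [totalCoboundary_of]
    by_cases h : m = n
    · subst h
      rw [DirectSum.of_eq_same, DirectSum.of_eq_same]
    · rw [DirectSum.of_eq_of_ne _ _ _ (by omega), DirectSum.of_eq_of_ne _ _ _ (by omega), map_zero]
  | add x y hx hy => rw [map_add, DirectSum.add_apply, hx, hy, DirectSum.add_apply, map_add]

theorem totalCoboundary_apply_zero (x : ⨁ n, SSetCochain S K n) :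
    totalCoboundary S K x 0 = 0 := by
  induction x using DirectSum.induction_on with
  | zero => simp
  | of m f => rw [totalCoboundary_of, DirectSum.of_eq_of_ne _ _ _ (by omega)]
  | add x y hx hy => rw [map_add, DirectSum.add_apply, hx, hy, add_zero]

theorem totalPullback_apply (φ : SimplexMap S T) (x : ⨁ n, SSetCochain T K n) (n : ℕ) :
    totalPullback φ K x n = pullback φ n (x n) := by
  induction x using DirectSum.induction_on with
  | zero => simp
  | of m f =>
    rw [totalPullback_of]
    by_cases h : m = n
    · subst h
      rw [DirectSum.of_eq_same, DirectSum.of_eq_same]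
    · rw [DirectSum.of_eq_of_ne _ _ _ (by omega), DirectSum.of_eq_of_ne _ _ _ (by omega), map_zero]
  | add x y hx hy => rw [map_add, DirectSum.add_apply, hx, hy, DirectSum.add_apply, map_add]

theorem component_natCast (x : ⨁ n, SSetCochain S K n) (n : ℕ) :
    DGAlgebra.component (degree S K) n x = DirectSum.of (SSetCochain S K) n (x n) := by
  induction x using DirectSum.induction_on with
  | zero => simp
  | of m f =>
    by_cases h : m = n
    · subst h
      rw [DirectSum.of_eq_same, DGAlgebra.component_same _ (of_mem_degree m f)]
    · rw [DirectSum.of_eq_of_ne _ _ _ (by omega), map_zero,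
        DGAlgebra.component_ne _ (by exact_mod_cast h) (of_mem_degree m f)]
  | add x y hx hy => rw [map_add, hx, hy, DirectSum.add_apply, map_add]

theorem component_negSucc (x : ⨁ n, SSetCochain S K n) (n : ℕ) :
    DGAlgebra.component (degree S K) (Int.negSucc n) x = 0 :=
  DGAlgebra.component_mem (degree S K) (Int.negSucc n) x

theorem sign_sign (x : ⨁ n, SSetCochain S K n) : sign S K (sign S K x) = x := by
  induction x using DirectSum.induction_on with
  | zero => simp
  | of n f => rw [sign_of, map_smul, sign_of, smul_smul, ← mul_pow]; simp
  | add x y hx hy => rw [map_add, map_add, hx, hy]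

theorem sign_mul (x y : ⨁ n, SSetCochain S K n) :
    sign S K (x * y) = sign S K x * sign S K y := by
  induction x using DirectSum.induction_on with
  | zero => simp
  | of p f =>
    induction y using DirectSum.induction_on with
    | zero => simp
    | of q g =>
      rw [DirectSum.of_mul_of, sign_of, sign_of, sign_of, smul_mul_smul_comm, DirectSum.of_mul_of,
        pow_add]
    | add x y hx hy => rw [mul_add, map_add, map_add, hx, hy, mul_add]
  | add x y hx hy => rw [add_mul, map_add, map_add, hx, hy, add_mul]

theorem sign_one : sign S K 1 = 1 := by
  refine (sign_of 0 _).trans ?_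
  rw [pow_zero, one_smul]
  rfl

theorem sign_totalCoboundary (x : ⨁ n, SSetCochain S K n) :
    sign S K (totalCoboundary S K x) = -totalCoboundary S K (sign S K x) := by
  induction x using DirectSum.induction_on with
  | zero => simp
  | of n f =>
    rw [totalCoboundary_of, sign_of, sign_of, map_smul, totalCoboundary_of, pow_succ, mul_neg_one,
      total_neg_smul]
  | add x y hx hy => rw [map_add, map_add, hx, hy, map_add, map_add, neg_add]

/-- Absorbing the Leibniz sign into `sign` gives an identity for inhomogeneous cochains, so later
computations need no degrees. -/
theorem totalCoboundary_mul (x y : ⨁ n, SSetCochain S K n) :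
    totalCoboundary S K (x * y) =
      totalCoboundary S K x * y + sign S K x * totalCoboundary S K y := by
  induction x using DirectSum.induction_on with
  | zero => simp
  | of n f =>
    have h := (cochainAlgebra S K).leibniz (of_mem_degree n f) y
    refine h.trans ?_
    rw [sign_of, smul_mul_assoc]
    congr 1
    exact total_negOnePow_smul n _
  | add x y hx hy => rw [add_mul, map_add, map_add, map_add, hx, hy, add_mul, add_mul]; abel

end Total

/-! ### Constant simplices and reduced cochains. -/

section Constant

/-- The constant simplex at a vertex. -/
def constSimplex (n : ℕ) (x : T _⦋0⦌) : T _⦋n⦌ :=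
  T.map (SimplexCategory.mkHom ⟨fun _ => 0, fun _ _ _ => le_rfl⟩ : ⦋n⦌ ⟶ ⦋0⦌).op x

theorem map_constSimplex {m n : ℕ} (θ : ⦋m⦌ ⟶ ⦋n⦌) (x : T _⦋0⦌) :
    T.map θ.op (constSimplex n x) = constSimplex m x := by
  rw [constSimplex, map_map]
  congr 3

theorem constSimplex_zero (x : T _⦋0⦌) : constSimplex 0 x = x := by
  have : (SimplexCategory.mkHom ⟨fun _ => 0, fun _ _ _ => le_rfl⟩ : ⦋0⦌ ⟶ ⦋0⦌) = 𝟙 _ :=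
    hom_ext fun i => by simp
  rw [constSimplex, this]
  simp

/-- The values of a cochain on the constant simplices at a vertex, as a polynomial. -/
noncomputable def evalConstLinear (K : Type v) [Field K] (x : T _⦋0⦌) :
    (⨁ n, SSetCochain T K n) →ₗ[K] Polynomial K :=
  DirectSum.toModule K ℕ _ fun n =>
    Polynomial.monomial n ∘ₗ LinearMap.proj (constSimplex n x)

theorem evalConstLinear_of (x : T _⦋0⦌) (n : ℕ) (f : SSetCochain T K n) :
    evalConstLinear K x (DirectSum.of (SSetCochain T K) n f) =
      Polynomial.monomial n (f (constSimplex n x)) :=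
  DirectSum.toModule_lof K n f

theorem coeff_evalConstLinear (x : T _⦋0⦌) (a : ⨁ n, SSetCochain T K n) (n : ℕ) :
    (evalConstLinear K x a).coeff n = a n (constSimplex n x) := by
  induction a using DirectSum.induction_on with
  | zero => simp
  | of m f =>
    rw [evalConstLinear_of, Polynomial.coeff_monomial]
    split_ifs with h
    · subst h
      rw [DirectSum.of_eq_same]
    · rw [DirectSum.of_eq_of_ne _ _ _ (Ne.symm h)]
      rfl
  | add a b ha hb =>
    rw [map_add, Polynomial.coeff_add, ha, hb, DirectSum.add_apply, Pi.add_apply]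

/-- Front and back faces of a constant simplex are constant at the same vertex, so cup products
evaluate to products, with the variable recording the degree. -/
theorem evalConstLinear_mul (x : T _⦋0⦌) (a b : ⨁ n, SSetCochain T K n) :
    evalConstLinear K x (a * b) = evalConstLinear K x a * evalConstLinear K x b := by
  induction a using DirectSum.induction_on with
  | zero => simp
  | of p f =>
    induction b using DirectSum.induction_on with
    | zero => simp
    | of q g =>
      rw [DirectSum.of_mul_of, evalConstLinear_of, evalConstLinear_of, evalConstLinear_of,
        Polynomial.monomial_mul_monomial]
      change Polynomial.monomial (p + q) (f _ * g _) = _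
      rw [map_constSimplex, map_constSimplex]
    | add b b' h h' => rw [mul_add, map_add, map_add, h, h', mul_add]
  | add a a' h h' => rw [add_mul, map_add, map_add, h, h', add_mul]

/-- The algebra map given by the values of a cochain on the constant simplices at a vertex. -/
noncomputable def evalConst (K : Type v) [Field K] (x : T _⦋0⦌) :
    (⨁ n, SSetCochain T K n) →ₐ[K] Polynomial K where
  toFun := evalConstLinear K x
  map_one' := (evalConstLinear_of x 0 _).trans Polynomial.monomial_zero_one
  map_mul' := evalConstLinear_mul x
  map_zero' := map_zero _
  map_add' := map_add _
  commutes' _ := evalConstLinear_of x 0 _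

theorem coeff_evalConst (x : T _⦋0⦌) (a : ⨁ n, SSetCochain T K n) (n : ℕ) :
    (evalConst K x a).coeff n = a n (constSimplex n x) :=
  coeff_evalConstLinear x a n

/-- The augmentation given by a vertex. -/
noncomputable def augmentation (K : Type v) [Field K] (x : T _⦋0⦌) :
    (⨁ n, SSetCochain T K n) →ₐ[K] K :=
  (Polynomial.aeval 0).comp (evalConst K x)

theorem augmentation_apply (x : T _⦋0⦌) (a : ⨁ n, SSetCochain T K n) :
    augmentation K x a = a 0 x := by
  have := coeff_evalConst x a 0
  rw [constSimplex_zero] at this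
  rw [← this, augmentation, AlgHom.comp_apply, Polynomial.coeff_zero_eq_aeval_zero]

/-- The subalgebra of cochains that vanish on all constant simplices of positive dimension. -/
noncomputable def reducedSubalgebra (T : SSet.{u}) (K : Type v) [Field K] :
    Subalgebra K (⨁ n, SSetCochain T K n) :=
  -- As a preimage of the constant polynomials, this is closed under products with no further
  -- argument.
  ⨅ x : T _⦋0⦌, (⊥ : Subalgebra K (Polynomial K)).comap (evalConst K x)

theorem mem_reducedSubalgebra {a : ⨁ n, SSetCochain T K n} :
    a ∈ reducedSubalgebra T K ↔ ∀ (x : T _⦋0⦌) (n : ℕ), a (n + 1) (constSimplex (n + 1) x) = 0 := by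
  simp only [reducedSubalgebra, Algebra.mem_iInf, Subalgebra.mem_comap, Algebra.mem_bot,
    Set.mem_range, ← coeff_evalConst]
  refine forall_congr' fun x => ⟨?_, fun h => ⟨(evalConst K x a).coeff 0, ?_⟩⟩
  · rintro ⟨r, hr⟩ n
    rw [← hr, Polynomial.algebraMap_eq, Polynomial.coeff_C_of_ne_zero (by omega)]
  · ext n
    cases n with
    | zero => simp
    | succ n => rw [h, Polynomial.algebraMap_eq, Polynomial.coeff_C_of_ne_zero (by omega)]

/-- All `n + 2` faces are the same constant simplex, and the alternating sum of `n + 2` signs is `0`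
or `1` according to parity. -/
theorem coboundary_constSimplex {n : ℕ} (f : SSetCochain T K n) (x : T _⦋0⦌) :
    coboundary n f (constSimplex (n + 1) x) =
      if Even n then 0 else f (constSimplex n x) := by
  rw [coboundary_eq_sum_range]
  simp only [map_constSimplex]
  rw [← Finset.sum_mul]
  have : ∀ k, ∑ i ∈ Finset.range k, (-1 : K) ^ i = if Even k then 0 else 1 := fun k => by
    exact neg_one_geom_sum
  rw [this]
  by_cases h : Even n <;> simp [h, Nat.even_add]

theorem totalCoboundary_mem_reducedSubalgebra {a : ⨁ n, SSetCochain T K n}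
    (ha : a ∈ reducedSubalgebra T K) : totalCoboundary T K a ∈ reducedSubalgebra T K := by
  rw [mem_reducedSubalgebra] at ha ⊢
  intro x n
  rw [totalCoboundary_apply, coboundary_constSimplex]
  split_ifs with h
  · rfl
  -- Here `n` is odd, hence positive, so the unconstrained values in degree zero never enter.
  · obtain ⟨k, rfl⟩ := Nat.exists_eq_succ_of_ne_zero (show n ≠ 0 by rintro rfl; simp at h)
    exact ha x k

theorem component_mem_reducedSubalgebra {a : ⨁ n, SSetCochain T K n}
    (ha : a ∈ reducedSubalgebra T K) (k : ℤ) :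
    DGAlgebra.component (degree T K) k a ∈ reducedSubalgebra T K := by
  cases k with
  | ofNat m =>
    rw [mem_reducedSubalgebra] at ha ⊢
    intro x n
    change DGAlgebra.component (degree T K) (m : ℤ) a (n + 1) _ = 0
    rw [component_natCast]
    by_cases h : m = n + 1
    · subst h
      rw [DirectSum.of_eq_same]
      exact ha x n
    · rw [DirectSum.of_eq_of_ne _ _ _ (by omega)]; rfl
  | negSucc m =>
    rw [component_negSucc]
    exact zero_mem _

/-- The restriction of cochains to degenerate simplices along the first degeneracy. -/
noncomputable def pullbackDegeneracy (T : SSet.{u}) (K : Type v) [Field K] :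
    (⨁ n, SSetCochain T K n) →ₗ[K] (⨁ n, SSetCochain T K n) :=
  DirectSum.toModule K ℕ _ fun n => match n with
    | 0 => 0
    | m + 1 => DirectSum.lof K ℕ (SSetCochain T K) m ∘ₗ
        { toFun := fun f σ => f (T.map (degeneracy (m + 1) m rfl 0).op σ)
          map_add' := fun _ _ => rfl
          map_smul' := fun _ _ => rfl }

theorem pullbackDegeneracy_apply (a : ⨁ n, SSetCochain T K n) (n : ℕ) (σ : T _⦋n⦌) :
    pullbackDegeneracy T K a n σ = a (n + 1) (T.map (degeneracy (n + 1) n rfl 0).op σ) := by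
  induction a using DirectSum.induction_on with
  | zero => simp
  | of m f =>
    have h : pullbackDegeneracy T K (DirectSum.of (SSetCochain T K) m f) = _ :=
      DirectSum.toModule_lof K m f
    rw [h]
    cases m with
    | zero => rw [DirectSum.of_eq_of_ne _ _ _ (by omega)]; rfl
    | succ m =>
      by_cases h : m = n
      · subst h
        rw [DirectSum.of_eq_same]
        exact congrFun (DirectSum.of_eq_same (β := SSetCochain T K) m _) σ
      · rw [DirectSum.of_eq_of_ne _ _ _ (by omega)]
        exact congrFun (DirectSum.of_eq_of_ne (β := SSetCochain T K) _ _ _ (by omega)) σ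
  | add a b ha hb =>
    rw [map_add, DirectSum.add_apply, DirectSum.add_apply, Pi.add_apply, Pi.add_apply, ha, hb]

/-- On constant simplices at a vertex the differentials alternate between zero and the identity, so
this complex is acyclic in positive degrees. The witness takes on a constant `n`-simplex the value
of `a` one dimension higher. For odd `n` its coboundary cancels `a` in degree `n + 1`; for even `n`
that value of `a` is already zero by the hypothesis on the coboundary of `a`. -/
theorem exists_sub_totalCoboundary_mem {a : ⨁ n, SSetCochain T K n}
    (ha : totalCoboundary T K a ∈ reducedSubalgebra T K) :
    ∃ c, a - totalCoboundary T K c ∈ reducedSubalgebra T K := by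
  refine ⟨pullbackDegeneracy T K a, ?_⟩
  rw [mem_reducedSubalgebra] at ha ⊢
  intro x n
  have h := ha x (n + 1)
  rw [totalCoboundary_apply, coboundary_constSimplex] at h
  rw [DirectSum.sub_apply, Pi.sub_apply, totalCoboundary_apply, coboundary_constSimplex,
    pullbackDegeneracy_apply, map_constSimplex]
  by_cases hn : Even n
  · rw [if_neg (by simpa [Nat.even_add_one] using hn)] at h
    rw [if_pos hn, h, sub_zero]
  · rw [if_neg hn, sub_self]

/-- The purpose of reduced cochains: a constant map acts on them by the augmentation alone, with no
terms in positive degree. -/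
theorem totalPullback_const {φ : SimplexMap S T} {x : T _⦋0⦌}
    (hφ : ∀ n σ, φ.toFun n σ = constSimplex n x) {a : ⨁ n, SSetCochain T K n}
    (ha : a ∈ reducedSubalgebra T K) :
    totalPullback φ K a = augmentation K x a • 1 := by
  refine DFinsupp.ext fun n => ?_
  change totalPullback φ K a n =
    (augmentation K x a • (1 : ⨁ n, SSetCochain S K n) : ⨁ n, SSetCochain S K n) n
  rw [totalPullback_apply, DirectSum.smul_apply]
  funext σ
  rw [pullback_apply, hφ]
  cases n with
  | zero =>
    change _ = augmentation K x a * 1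
    rw [augmentation_apply, constSimplex_zero, mul_one]
  | succ n =>
    rw [mem_reducedSubalgebra.1 ha x n]
    have : (1 : ⨁ n, SSetCochain S K n) (n + 1) = 0 :=
      DirectSum.of_eq_of_ne (β := SSetCochain S K) _ _ _ (by omega)
    rw [this]
    simp

end Constant

/-! ### The Leibniz rule for the prism operator. -/

namespace SimplexHomotopy

variable (H : SimplexHomotopy S T)

theorem prism_coboundary_zero (f : SSetCochain T K 0) :
    H.prism 1 0 rfl (coboundary 0 f) =
      pullback (H.endpoint true) 0 f - pullback (H.endpoint false) 0 f := by
  funext σ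
  have e : ∀ j i, face 0 j ≫ degeneracy 1 0 rfl i = 𝟙 _ := fun j i => by
    apply hom_ext
    intro k
    simp
  rw [prism_coboundary_eq]
  simp only [e, Finset.sum_range_succ, Finset.sum_range_zero, face_apply]
  simp [pullback_apply, endpoint]
  exact (sub_eq_add_neg _ _).symm

/-- The prism operator on a single cochain group, with values in the direct sum. -/
noncomputable def prismSummand (K : Type v) [Field K] :
    ∀ n, SSetCochain T K n →ₗ[K] (⨁ n, SSetCochain S K n) := fun n => match n with
  | 0 => 0
  | m + 1 => DirectSum.lof K ℕ (SSetCochain S K) m ∘ₗ H.prism (m + 1) m rfl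

/-- The prism operator on the direct sum of all cochain groups. -/
noncomputable def totalPrism (K : Type v) [Field K] :
    (⨁ n, SSetCochain T K n) →ₗ[K] (⨁ n, SSetCochain S K n) :=
  DirectSum.toModule K ℕ _ (H.prismSummand K)

theorem totalPrism_of_zero (f : SSetCochain T K 0) :
    H.totalPrism K (DirectSum.of (SSetCochain T K) 0 f) = 0 :=
  DirectSum.toModule_lof K 0 f

theorem totalPrism_of {n m : ℕ} (h : n = m + 1) (f : SSetCochain T K n) :
    H.totalPrism K (DirectSum.of (SSetCochain T K) n f) =
      DirectSum.of (SSetCochain S K) m (H.prism n m h f) := by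
  subst h
  exact DirectSum.toModule_lof K (m + 1) f

theorem totalCoboundary_totalPrism_add (a : ⨁ n, SSetCochain T K n) :
    totalCoboundary S K (H.totalPrism K a) + H.totalPrism K (totalCoboundary T K a) =
      totalPullback (H.endpoint true) K a - totalPullback (H.endpoint false) K a := by
  induction a using DirectSum.induction_on with
  | zero => simp
  | of n f =>
    rw [totalCoboundary_of, totalPullback_of, totalPullback_of, H.totalPrism_of rfl, ← map_sub]
    cases n with
    | zero => rw [totalPrism_of_zero, map_zero, zero_add, prism_coboundary_zero]
    | succ n =>
      rw [H.totalPrism_of rfl, totalCoboundary_of, ← map_add, coboundary_prism_add]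
  | add a b ha hb =>
    simp only [map_add] at ha hb ⊢
    rw [add_sub_add_comm, ← ha, ← hb]
    abel

theorem sign_totalPrism (a : ⨁ n, SSetCochain T K n) :
    sign S K (H.totalPrism K a) = -H.totalPrism K (sign T K a) := by
  induction a using DirectSum.induction_on with
  | zero => simp
  | of n f =>
    rw [sign_of, map_smul]
    cases n with
    | zero => simp [totalPrism_of_zero]
    | succ n => rw [H.totalPrism_of rfl, sign_of, pow_succ, mul_neg_one, total_neg_smul, neg_neg]
  | add a b ha hb => rw [map_add, map_add, ha, hb, map_add, map_add, neg_add]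

theorem totalPrism_one : H.totalPrism K 1 = 0 := H.totalPrism_of_zero _

theorem _root_.SSetCochain.degeneracy_cases {n m : ℕ} (h : n = m + 1) (i : ℕ)
    (j : Fin (n + 1)) :
    ((j : ℕ) ≤ i ∧ ((degeneracy n m h i).toOrderHom j : ℕ) = min (j : ℕ) m) ∨
      (i < (j : ℕ) ∧ ((degeneracy n m h i).toOrderHom j : ℕ) = min ((j : ℕ) - 1) m) := by
  rw [degeneracy_apply]
  split_ifs <;> omega

/-- Cut a product of degrees `p` and `q` at vertex `p`. If the doubled vertex is `i < p`, the back
face lies wholly at the top; if it is `p + i`, the front face lies wholly at the bottom. Thus the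
prism operator is exactly, not only up to homotopy, a derivation between the two ends. -/
theorem totalPrism_mul (a b : ⨁ n, SSetCochain T K n) :
    H.totalPrism K (a * b) = H.totalPrism K a * totalPullback (H.endpoint true) K b +
      sign S K (totalPullback (H.endpoint false) K a) * H.totalPrism K b := by
  induction a using DirectSum.induction_on with
  | zero => simp
  | add a a' h h' =>
    rw [add_mul, map_add, h, h']
    simp only [map_add, add_mul]
    abel
  | of p f =>
  induction b using DirectSum.induction_on with
  | zero => simp
  | add b b' h h' =>
    rw [mul_add, map_add, h, h']
    simp only [map_add, mul_add]
    abel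
  | of q g =>
  rw [totalPullback_of, totalPullback_of, sign_of, DirectSum.of_mul_of]
  obtain hpq | ⟨m, hm⟩ : p + q = 0 ∨ ∃ m, p + q = m + 1 := by
    cases h : p + q with
    | zero => exact Or.inl rfl
    | succ m => exact Or.inr ⟨m, rfl⟩
  · obtain ⟨rfl, rfl⟩ : p = 0 ∧ q = 0 := by omega
    refine (H.totalPrism_of_zero (K := K) _).trans ?_
    rw [totalPrism_of_zero, totalPrism_of_zero, zero_mul, mul_zero, add_zero]
  rw [H.totalPrism_of hm]
  -- The prism simplices whose doubled vertex lies in the front factor.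
  have e1 : H.totalPrism K (DirectSum.of (SSetCochain T K) p f) *
      DirectSum.of (SSetCochain S K) q (pullback (H.endpoint true) q g) =
      DirectSum.of (SSetCochain S K) m (fun σ => ∑ i ∈ Finset.range p, (-1) ^ i *
        (f (H.toFun p (S.map (front p (p + q) (by omega) ≫ degeneracy (p + q) m hm i).op σ)
          fun j => decide (i < (j : ℕ))) * g (H.toFun q (S.map (back q (p + q) (by omega) ≫
            degeneracy (p + q) m hm i).op σ) fun _ => true))) := by
    cases p with
    | zero => rw [totalPrism_of_zero, zero_mul]; exact (map_zero _).symm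
    | succ p' =>
      rw [H.totalPrism_of rfl, DirectSum.of_mul_of]
      refine of_eq_of (by omega) fun σ => ?_
      change _ = H.prism (p' + 1) p' rfl f _ * pullback (H.endpoint true) q g _
      rw [prism_apply, Finset.sum_mul]
      refine Finset.sum_congr rfl fun i hi => ?_
      rw [Finset.mem_range] at hi
      rw [map_map, map_map, map_map, mul_assoc, pullback_apply]
      have h1 : front (p' + 1) (p' + 1 + q) (by omega) ≫ degeneracy (p' + 1 + q) m hm i =
          degeneracy (p' + 1) p' rfl i ≫ front p' (p' + q) (by omega) ≫
            front (p' + q) m (by omega) := by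
        apply hom_ext
        intro k
        have c1 := degeneracy_cases hm i ((front (p' + 1) (p' + 1 + q) (by omega)).toOrderHom k)
        have c2 := degeneracy_cases (n := p' + 1) (m := p') rfl i k
        simp only [comp_apply', front_apply] at *
        omega
      have h2 : back q (p' + 1 + q) (by omega) ≫ degeneracy (p' + 1 + q) m hm i =
          back q (p' + q) (by omega) ≫ front (p' + q) m (by omega) := by
        apply hom_ext
        intro k
        have c1 := degeneracy_cases hm i ((back q (p' + 1 + q) (by omega)).toOrderHom k)
        simp only [comp_apply', front_apply, back_apply] at *
        omega
      rw [h1, h2]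
      rfl
  -- The prism simplices whose doubled vertex is `p + i`; the sign `(-1) ^ p` comes from this shift
  -- of index.
  have e2 : ((-1 : K) ^ p • DirectSum.of (SSetCochain S K) p
        (pullback (H.endpoint false) p f)) *
      H.totalPrism K (DirectSum.of (SSetCochain T K) q g) =
      DirectSum.of (SSetCochain S K) m (fun σ => ∑ i ∈ Finset.range q, (-1) ^ (p + i) *
        (f (H.toFun p (S.map (front p (p + q) (by omega) ≫ degeneracy (p + q) m hm (p + i)).op σ)
          fun _ => false) * g (H.toFun q (S.map (back q (p + q) (by omega) ≫
            degeneracy (p + q) m hm (p + i)).op σ) fun j => decide (i < (j : ℕ))))) := by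
    cases q with
    | zero => rw [totalPrism_of_zero, mul_zero]; exact (map_zero _).symm
    | succ q' =>
      rw [H.totalPrism_of rfl, smul_mul_assoc, DirectSum.of_mul_of]
      rw [← DirectSum.lof_eq_of K, ← map_smul, DirectSum.lof_eq_of K]
      refine of_eq_of (by omega) fun σ => ?_
      change _ = (-1) ^ p * (pullback (H.endpoint false) p f _ * H.prism (q' + 1) q' rfl g _)
      rw [prism_apply, Finset.mul_sum, Finset.mul_sum]
      refine Finset.sum_congr rfl fun i hi => ?_
      rw [Finset.mem_range] at hi
      rw [map_map, map_map, map_map, pullback_apply]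
      have h1 : front p (p + (q' + 1)) (by omega) ≫ degeneracy (p + (q' + 1)) m hm (p + i) =
          front p (p + q') (by omega) ≫ front (p + q') m (by omega) := by
        apply hom_ext
        intro k
        have c1 := degeneracy_cases hm (p + i) ((front p (p + (q' + 1)) (by omega)).toOrderHom k)
        simp only [comp_apply', front_apply] at *
        omega
      have h2 : back (q' + 1) (p + (q' + 1)) (by omega) ≫
          degeneracy (p + (q' + 1)) m hm (p + i) =
          degeneracy (q' + 1) q' rfl i ≫ back q' (p + q') (by omega) ≫
            front (p + q') m (by omega) := by
        apply hom_ext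
        intro k
        have c1 := degeneracy_cases hm (p + i)
          ((back (q' + 1) (p + (q' + 1)) (by omega)).toOrderHom k)
        have c2 := degeneracy_cases (n := q' + 1) (m := q') rfl i k
        simp only [comp_apply', front_apply, back_apply] at *
        omega
      rw [h1, h2, pow_add, Category.assoc]
      change _ = (-1) ^ p * (f (H.toFun p _ fun _ => false) * _)
      ring
  rw [e1, e2, ← map_add]
  congr 1
  funext σ
  change H.prism (p + q) m hm (cup f g) σ = _ + _
  rw [prism_apply, Finset.sum_range_add]
  congr 1
  · refine Finset.sum_congr rfl fun i hi => ?_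
    rw [Finset.mem_range] at hi
    simp only [cup, H.map, map_map]
    congr 5
    funext k
    rw [decide_eq_true_iff, back_apply]
    omega
  · refine Finset.sum_congr rfl fun i hi => ?_
    rw [Finset.mem_range] at hi
    simp only [cup, H.map, map_map]
    congr 5
    · funext k
      rw [decide_eq_false_iff_not, front_apply]
      omega
    · funext k
      rw [decide_eq_decide, back_apply]
      omega

end SimplexHomotopy

end SSetCochain

/-! ### Affine geometry of the standard simplex. -/

/-- The standard topological `n`-simplex. -/
abbrev TopSimplex (n : ℕ) : Type := stdSimplex ℝ (Fin (n + 1))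

namespace TopSimplex

variable {m n p : ℕ}

/-- The point with barycentric coordinates `x` in the affine simplex with vertices `v`. -/
noncomputable def comb (v : Fin (m + 1) → TopSimplex n) (x : TopSimplex m) : TopSimplex n :=
  ⟨∑ i, x i • (v i : Fin (n + 1) → ℝ),
    (convex_stdSimplex ℝ (Fin (n + 1))).sum_mem (fun i _ => x.2.1 i) x.2.2 fun i _ => (v i).2⟩

theorem coe_comb (v : Fin (m + 1) → TopSimplex n) (x : TopSimplex m) :
    (comb v x : Fin (n + 1) → ℝ) = ∑ i, x i • (v i : Fin (n + 1) → ℝ) := rfl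

theorem comb_apply (v : Fin (m + 1) → TopSimplex n) (x : TopSimplex m) (j : Fin (n + 1)) :
    comb v x j = ∑ i, x i * v i j := by
  rw [coe_comb, Finset.sum_apply]
  rfl

theorem continuous_comb (v : Fin (m + 1) → TopSimplex n) : Continuous (comb v) := by
  refine Continuous.subtype_mk ?_ _
  refine continuous_finsetSum _ fun i _ =>
    Continuous.fun_smul (f := fun x : TopSimplex m => x i) ?_ continuous_const
  exact (continuous_apply i).comp continuous_subtype_val

/-- The affine simplex with given vertices, as a continuous map. -/
noncomputable def combMap (v : Fin (m + 1) → TopSimplex n) : C(TopSimplex m, TopSimplex n) :=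
  ⟨comb v, continuous_comb v⟩

theorem ext_apply {x y : TopSimplex n} (h : ∀ j, x j = y j) : x = y :=
  Subtype.ext (funext h)

theorem comb_comb (w : Fin (n + 1) → TopSimplex p) (v : Fin (m + 1) → TopSimplex n)
    (x : TopSimplex m) : comb w (comb v x) = comb (fun i => comb w (v i)) x := by
  refine ext_apply fun j => ?_
  simp only [comb_apply, Finset.sum_mul, Finset.mul_sum]
  rw [Finset.sum_comm]
  exact Finset.sum_congr rfl fun i _ => Finset.sum_congr rfl fun k _ => by ring

/-- The vertices of the standard simplex. -/
noncomputable def vertex (i : Fin (n + 1)) : TopSimplex n := ⟨_, single_mem_stdSimplex ℝ i⟩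

theorem comb_vertex (x : TopSimplex n) : comb vertex x = x := by
  refine ext_apply fun j => ?_
  rw [comb_apply]
  change ∑ i, x i * (Pi.single i (1 : ℝ) : Fin (n + 1) → ℝ) j = _
  simp [Pi.single_apply]

theorem comb_apply_vertex (v : Fin (m + 1) → TopSimplex n) (i : Fin (m + 1)) :
    comb v (vertex i) = v i := by
  refine ext_apply fun j => ?_
  rw [comb_apply]
  change ∑ k, (Pi.single i (1 : ℝ) : Fin (m + 1) → ℝ) k * v k j = _
  simp [Pi.single_apply]

theorem comb_comp (v : Fin (n + 1) → TopSimplex p) (θ : Fin (m + 1) → Fin (n + 1))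
    (x : TopSimplex m) : comb (v ∘ θ) x = comb v (stdSimplex.map θ x) := by
  refine ext_apply fun j => ?_
  simp only [comb_apply, stdSimplex.map_coe, FunOnFinite.linearMap_apply_apply, Finset.sum_mul,
    Function.comp_apply]
  rw [← Finset.sum_fiberwise Finset.univ θ]
  refine Finset.sum_congr rfl fun i _ => Finset.sum_congr rfl fun k hk => ?_
  rw [Finset.mem_filter] at hk
  rw [hk.2]

/-- The barycenter of a tuple of points. -/
noncomputable def bary (v : Fin (m + 1) → TopSimplex n) : TopSimplex n :=
  comb v stdSimplex.barycenter

theorem comb_mem {c : Set (Fin (n + 1) → ℝ)} (hc : Convex ℝ c) {v : Fin (m + 1) → TopSimplex n}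
    (hv : ∀ i, (v i : Fin (n + 1) → ℝ) ∈ c) (x : TopSimplex m) :
    (comb v x : Fin (n + 1) → ℝ) ∈ c :=
  hc.sum_mem (fun i _ => x.2.1 i) x.2.2 fun i _ => hv i

/-- The difference `v j - bary v` is the average of the `m + 1` vectors `v j - v i`, one of which is
zero. -/
theorem dist_bary_le (v : Fin (m + 1) → TopSimplex n) {D : ℝ}
    (hv : ∀ i j, dist (v i) (v j) ≤ D) (j : Fin (m + 1)) :
    dist (v j) (bary v) ≤ m / (m + 1) * D := by
  have hm : (0 : ℝ) < m + 1 := by positivity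
  have e : (v j : Fin (n + 1) → ℝ) - (bary v : Fin (n + 1) → ℝ) =
      ((m : ℝ) + 1)⁻¹ • ∑ i, ((v j : Fin (n + 1) → ℝ) - v i) := by
    rw [bary, coe_comb, Finset.sum_sub_distrib, smul_sub, Finset.sum_const, Finset.card_univ,
      Fintype.card_fin, ← Nat.cast_smul_eq_nsmul ℝ, smul_smul, Finset.smul_sum]
    congr 1
    · push_cast
      rw [inv_mul_cancel₀ hm.ne', one_smul]
    · refine Finset.sum_congr rfl fun i _ => ?_
      congr 1
      change (stdSimplex.barycenter : stdSimplex ℝ (Fin (m + 1))).val i = _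
      rw [stdSimplex.barycenter_apply, Fintype.card_fin]
      push_cast
      rfl
  rw [Subtype.dist_eq, dist_eq_norm]
  change ‖(v j : Fin (n + 1) → ℝ) - (bary v : Fin (n + 1) → ℝ)‖ ≤ _
  rw [e, norm_smul, norm_inv, Real.norm_of_nonneg hm.le]
  have : ‖∑ i, ((v j : Fin (n + 1) → ℝ) - v i)‖ ≤ m * D := by
    rw [← Finset.add_sum_erase _ _ (Finset.mem_univ j), sub_self, zero_add]
    refine (norm_sum_le_of_le (n := fun _ => D) _ (fun i _ => ?_)).trans_eq ?_
    · rw [← dist_eq_norm]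
      exact hv j i
    · rw [Finset.sum_const, Finset.card_erase_of_mem (Finset.mem_univ j), Finset.card_univ,
        Fintype.card_fin]
      simp
  rw [div_mul_eq_mul_div, div_eq_inv_mul]
  exact mul_le_mul_of_nonneg_left this (by positivity)

end TopSimplex

open TopSimplex

/-! ### Affine chains and barycentric subdivision. -/

/-- Affine `m`-chains in the standard `n`-simplex. -/
abbrev AffineChain (K : Type v) [Field K] (n m : ℕ) : Type v :=
  (Fin (m + 1) → TopSimplex n) →₀ K

namespace AffineChain

variable {K : Type v} [Field K] {n p m : ℕ}

/-- The boundary of an affine chain. -/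
noncomputable def boundary : AffineChain K n (m + 1) →ₗ[K] AffineChain K n m :=
  Finsupp.linearCombination K fun v =>
    ∑ i : Fin (m + 2), (-1 : K) ^ (i : ℕ) • Finsupp.single (v ∘ i.succAbove) 1

theorem boundary_single (v : Fin (m + 2) → TopSimplex n) :
    boundary (Finsupp.single v (1 : K)) =
      ∑ i : Fin (m + 2), (-1 : K) ^ (i : ℕ) • Finsupp.single (v ∘ i.succAbove) 1 := by
  rw [boundary, Finsupp.linearCombination_single, one_smul]

/-- The cone on an affine chain. -/
noncomputable def cone (b : TopSimplex n) : AffineChain K n m →ₗ[K] AffineChain K n (m + 1) :=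
  Finsupp.lmapDomain K K fun v => Fin.cons b v

theorem cone_single (b : TopSimplex n) (v : Fin (m + 1) → TopSimplex n) :
    cone b (Finsupp.single v (1 : K)) = Finsupp.single (Fin.cons b v) 1 := by
  rw [cone, Finsupp.lmapDomain_apply, Finsupp.mapDomain_single]

theorem cons_comp_succAbove (b : TopSimplex n) (v : Fin (m + 2) → TopSimplex n)
    (i : Fin (m + 2)) :
    (Fin.cons b v : Fin (m + 3) → TopSimplex n) ∘ i.succ.succAbove =
      Fin.cons b (v ∘ i.succAbove) := by
  funext j
  refine Fin.cases ?_ (fun j => ?_) j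
  · simp
  · simp

theorem induction_single {M : Type*} [AddCommGroup M] [Module K M]
    {f g : AffineChain K n m →ₗ[K] M}
    (h : ∀ v, f (Finsupp.single v 1) = g (Finsupp.single v 1)) (x : AffineChain K n m) :
    f x = g x := by
  have : f = g := Finsupp.lhom_ext' fun v => LinearMap.ext_ring (h v)
  rw [this]

/-- Deleting the apex returns `x`; deleting any other vertex gives a cone on a face, with the sign
shifted by one. -/
theorem boundary_cone (b : TopSimplex n) (x : AffineChain K n (m + 1)) :
    boundary (cone b x) = x - cone b (boundary x) := by
  refine induction_single (f := boundary ∘ₗ cone b) (g := LinearMap.id - cone b ∘ₗ boundary)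
    (fun v => ?_) x
  simp only [LinearMap.comp_apply, LinearMap.sub_apply, LinearMap.id_apply]
  rw [cone_single, boundary_single, Fin.sum_univ_succ, boundary_single, map_sum, sub_eq_add_neg,
    ← Finset.sum_neg_distrib]
  congr 1
  · simp only [Fin.val_zero, pow_zero, one_smul]
    congr 1
  · refine Finset.sum_congr rfl fun i _ => ?_
    rw [map_smul, cone_single, cons_comp_succAbove, Fin.val_succ, pow_succ, mul_neg_one, neg_smul]

theorem boundary_single_one (u : Fin 2 → TopSimplex n) :
    boundary (m := 0) (Finsupp.single u (1 : K)) =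
      Finsupp.single (fun _ => u 1) 1 - Finsupp.single (fun _ => u 0) 1 := by
  have h := boundary_single (K := K) (m := 0) u
  rw [Fin.sum_univ_succ, Fin.sum_univ_succ, Fin.sum_univ_zero] at h
  have e0 : u ∘ (0 : Fin 2).succAbove = fun _ => u 1 := by
    funext i
    rw [Subsingleton.elim i 0]
    rfl
  have e1 : u ∘ (Fin.succ 0 : Fin 2).succAbove = fun _ => u 0 := by
    funext i
    rw [Subsingleton.elim i 0]
    rfl
  refine h.trans ?_
  erw [e0, e1]
  simp [sub_eq_add_neg]

theorem boundary_boundary_single (v : Fin (m + 3) → TopSimplex n) :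
    boundary (boundary (Finsupp.single v (1 : K))) = 0 := by
  -- Every simplex is the cone from its first vertex on the opposite face, so the cone formula
  -- reduces the claim to lower dimension.
  have hv : Finsupp.single v (1 : K) = cone (v 0) (Finsupp.single (Fin.tail v) 1) := by
    rw [cone_single, Fin.cons_self_tail]
  rw [hv, boundary_cone, map_sub]
  induction m with
  | zero =>
    rw [boundary_single_one, map_sub, map_sub, cone_single, cone_single, boundary_single_one,
      boundary_single_one]
    simp
  | succ m ih =>
    rw [boundary_cone]
    have hw : Finsupp.single (Fin.tail v) (1 : K) =
        cone (Fin.tail v 0) (Finsupp.single (Fin.tail (Fin.tail v)) 1) := by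
      rw [cone_single, Fin.cons_self_tail]
    have := ih (Fin.tail v) hw
    rw [hw]
    rw [boundary_cone (Fin.tail v 0), map_sub (boundary), this]
    simp

theorem boundary_boundary (x : AffineChain K n (m + 2)) : boundary (boundary x) = 0 := by
  refine induction_single (f := boundary ∘ₗ boundary) (g := 0) (fun v => ?_) x
  exact boundary_boundary_single v

/-- The barycentric subdivision operator. -/
noncomputable def subdiv : ∀ m, AffineChain K n m →ₗ[K] AffineChain K n m := fun m => match m with
  | 0 => LinearMap.id
  | m + 1 => Finsupp.linearCombination K fun v =>
      cone (bary v) (subdiv m (boundary (Finsupp.single v 1)))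

/-- The chain homotopy between the identity and the barycentric subdivision operator. -/
noncomputable def homotopy : ∀ m, AffineChain K n m →ₗ[K] AffineChain K n (m + 1) :=
  fun m => match m with
  | 0 => 0
  | m + 1 => Finsupp.linearCombination K fun v =>
      cone (bary v) (Finsupp.single v 1 - homotopy m (boundary (Finsupp.single v 1)))

theorem subdiv_single (v : Fin (m + 2) → TopSimplex n) :
    subdiv (m + 1) (Finsupp.single v (1 : K)) =
      cone (bary v) (subdiv m (boundary (Finsupp.single v 1))) := by
  rw [subdiv, Finsupp.linearCombination_single, one_smul]

theorem homotopy_single (v : Fin (m + 2) → TopSimplex n) :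
    homotopy (m + 1) (Finsupp.single v (1 : K)) =
      cone (bary v) (Finsupp.single v 1 - homotopy m (boundary (Finsupp.single v 1))) := by
  rw [homotopy, Finsupp.linearCombination_single, one_smul]

/-- By the cone formula the boundary is `v - H ∂v` minus the cone on `∂v - ∂H∂v`. By induction and
`∂∂ = 0` the latter chain is the subdivision of `∂v`, whose cone is the subdivision of `v`. -/
theorem boundary_homotopy (x : AffineChain K n (m + 1)) :
    boundary (homotopy (m + 1) x) = x - subdiv (m + 1) x - homotopy m (boundary x) := by
  induction m with
  | zero =>
    refine induction_single (f := boundary ∘ₗ homotopy 1)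
      (g := LinearMap.id - subdiv 1 - homotopy 0 ∘ₗ boundary) (fun v => ?_) x
    simp only [LinearMap.comp_apply, LinearMap.sub_apply, LinearMap.id_apply]
    rw [homotopy_single, boundary_cone, subdiv_single, homotopy, subdiv]
    simp
  | succ m ih =>
    refine induction_single (f := boundary ∘ₗ homotopy (m + 2))
      (g := LinearMap.id - subdiv (m + 2) - homotopy (m + 1) ∘ₗ boundary) (fun v => ?_) x
    simp only [LinearMap.comp_apply, LinearMap.sub_apply, LinearMap.id_apply]
    rw [homotopy_single, boundary_cone, subdiv_single, map_sub, ih, boundary_boundary]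
    simp only [map_zero, sub_zero, sub_sub_cancel]
    abel

/-- Obtained by applying the boundary to the homotopy formula, with no separate induction. -/
theorem boundary_subdiv (x : AffineChain K n (m + 1)) :
    boundary (subdiv (m + 1) x) = subdiv m (boundary x) := by
  have h := congrArg boundary (boundary_homotopy x)
  rw [boundary_boundary, map_sub, map_sub] at h
  cases m with
  | zero =>
    rw [homotopy] at h
    simp only [LinearMap.zero_apply, map_zero, sub_zero] at h
    rw [subdiv, LinearMap.id_apply]
    exact (sub_eq_zero.1 h.symm).symm
  | succ m =>
    rw [boundary_homotopy, boundary_boundary, map_zero, sub_zero, sub_sub_sub_cancel_left] at h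
    exact (sub_eq_zero.1 h.symm).symm

theorem boundary_subdiv_pow (k : ℕ) (x : AffineChain K n (m + 1)) :
    boundary ((subdiv (m + 1) ^ k) x) = (subdiv m ^ k) (boundary x) := by
  induction k with
  | zero => rfl
  | succ k ih => rw [pow_succ', pow_succ', Module.End.mul_apply, Module.End.mul_apply,
      boundary_subdiv, ih]

theorem homotopy_boundary_subdiv_pow (k : ℕ) (x : AffineChain K n (m + 1)) :
    homotopy m ((subdiv m ^ k) (boundary x)) = (subdiv (m + 1) ^ k) x -
      (subdiv (m + 1) ^ (k + 1)) x - boundary (homotopy (m + 1) ((subdiv (m + 1) ^ k) x)) := by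
  rw [← boundary_subdiv_pow, boundary_homotopy, pow_succ', Module.End.mul_apply]
  abel

section Push

/-- The map induced on affine chains by the affine map with given values on vertices. -/
noncomputable def push (w : Fin (n + 1) → TopSimplex p) (m : ℕ) :
    AffineChain K n m →ₗ[K] AffineChain K p m :=
  Finsupp.lmapDomain K K fun v i => comb w (v i)

theorem push_single (w : Fin (n + 1) → TopSimplex p) (v : Fin (m + 1) → TopSimplex n) :
    push w m (Finsupp.single v (1 : K)) = Finsupp.single (fun i => comb w (v i)) 1 := by
  rw [push, Finsupp.lmapDomain_apply, Finsupp.mapDomain_single]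

variable (w : Fin (n + 1) → TopSimplex p)

theorem push_boundary (x : AffineChain K n (m + 1)) :
    push w m (boundary x) = boundary (push w (m + 1) x) := by
  refine induction_single (f := push w m ∘ₗ boundary) (g := boundary ∘ₗ push w (m + 1))
    (fun v => ?_) x
  simp only [LinearMap.comp_apply]
  rw [push_single, boundary_single, boundary_single, map_sum]
  simp only [map_smul, push_single]
  rfl

theorem push_cone (b : TopSimplex n) (x : AffineChain K n m) :
    push w (m + 1) (cone b x) = cone (comb w b) (push w m x) := by
  refine induction_single (f := push w (m + 1) ∘ₗ cone b) (g := cone (comb w b) ∘ₗ push w m)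
    (fun v => ?_) x
  simp only [LinearMap.comp_apply]
  rw [push_single, cone_single, push_single, cone_single]
  congr 1
  funext i
  refine Fin.cases ?_ (fun i => ?_) i <;> simp

/-- Affine maps preserve barycentres and commute with cones and boundaries. -/
theorem push_subdiv (x : AffineChain K n m) : push w m (subdiv m x) = subdiv m (push w m x) := by
  induction m with
  | zero => rfl
  | succ m ih =>
    refine induction_single (f := push w (m + 1) ∘ₗ subdiv (m + 1))
      (g := subdiv (m + 1) ∘ₗ push w (m + 1)) (fun v => ?_) x
    simp only [LinearMap.comp_apply]
    rw [subdiv_single, push_cone, ih, push_boundary, push_single, subdiv_single, bary, comb_comb]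
    rfl

theorem push_homotopy (x : AffineChain K n m) :
    push w (m + 1) (homotopy m x) = homotopy m (push w m x) := by
  induction m with
  | zero => simp [homotopy]
  | succ m ih =>
    refine induction_single (f := push w (m + 2) ∘ₗ homotopy (m + 1))
      (g := homotopy (m + 1) ∘ₗ push w (m + 1)) (fun v => ?_) x
    simp only [LinearMap.comp_apply]
    rw [homotopy_single, push_cone, map_sub, ih, push_boundary, push_single, homotopy_single, bary,
      comb_comb]
    rfl

theorem push_subdiv_pow (k : ℕ) (x : AffineChain K n m) :
    push w m ((subdiv m ^ k) x) = (subdiv m ^ k) (push w m x) := by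
  induction k with
  | zero => rfl
  | succ k ih => rw [pow_succ', pow_succ', Module.End.mul_apply, Module.End.mul_apply,
      push_subdiv, ih]

end Push

section Support

theorem map_mem_of_supported {M : Type*} [AddCommGroup M] [Module K M]
    (f : AffineChain K n m →ₗ[K] M) {s : Set (Fin (m + 1) → TopSimplex n)} {W : Submodule K M}
    (h : ∀ v ∈ s, f (Finsupp.single v 1) ∈ W) {x : AffineChain K n m}
    (hx : x ∈ Finsupp.supported K K s) : f x ∈ W := by
  rw [Finsupp.supported_eq_span_single] at hx
  have : Submodule.span K ((fun i => Finsupp.single i (1 : K)) '' s) ≤ W.comap f := by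
    rw [Submodule.span_le]
    rintro _ ⟨v, hv, rfl⟩
    exact h v hv
  exact this hx

/-- The chains all of whose vertices lie in a given set. -/
def within (K : Type v) [Field K] (m : ℕ) (c : Set (Fin (n + 1) → ℝ)) :
    Submodule K (AffineChain K n m) :=
  Finsupp.supported K K {v | ∀ i, (v i : Fin (n + 1) → ℝ) ∈ c}

variable {c : Set (Fin (n + 1) → ℝ)}

theorem single_mem_within {v : Fin (m + 1) → TopSimplex n}
    (hv : ∀ i, (v i : Fin (n + 1) → ℝ) ∈ c) : Finsupp.single v (1 : K) ∈ within K m c :=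
  Finsupp.single_mem_supported K 1 hv

theorem boundary_mem_within {x : AffineChain K n (m + 1)} (hx : x ∈ within K (m + 1) c) :
    boundary x ∈ within K m c := by
  refine map_mem_of_supported _ (fun v hv => ?_) hx
  rw [boundary_single]
  exact Submodule.sum_mem _ fun i _ => Submodule.smul_mem _ _ (single_mem_within fun j => hv _)

theorem cone_mem_within {b : TopSimplex n} (hb : (b : Fin (n + 1) → ℝ) ∈ c)
    {x : AffineChain K n m} (hx : x ∈ within K m c) : cone b x ∈ within K (m + 1) c := by
  refine map_mem_of_supported _ (fun v hv => ?_) hx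
  rw [cone_single]
  exact single_mem_within fun i => Fin.cases hb (fun j => hv j) i

theorem subdiv_mem_within (hc : Convex ℝ c) {x : AffineChain K n m} (hx : x ∈ within K m c) :
    subdiv m x ∈ within K m c := by
  induction m with
  | zero => exact hx
  | succ m ih =>
    refine map_mem_of_supported _ (fun v hv => ?_) hx
    rw [subdiv_single]
    exact cone_mem_within (comb_mem hc hv _) (ih (boundary_mem_within (single_mem_within hv)))

theorem homotopy_mem_within (hc : Convex ℝ c) {x : AffineChain K n m} (hx : x ∈ within K m c) :
    homotopy m x ∈ within K (m + 1) c := by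
  induction m with
  | zero => exact zero_mem _
  | succ m ih =>
    refine map_mem_of_supported _ (fun v hv => ?_) hx
    rw [homotopy_single]
    exact cone_mem_within (comb_mem hc hv _)
      (sub_mem (single_mem_within hv) (ih (boundary_mem_within (single_mem_within hv))))

/-- The chains whose simplices have diameter at most `D`. -/
def diamLE (K : Type v) [Field K] (n m : ℕ) (D : ℝ) : Submodule K (AffineChain K n m) :=
  Finsupp.supported K K {v | ∀ i j, dist (v i) (v j) ≤ D}

/-- A simplex of the subdivision is the cone from the barycentre on a simplex of the subdivided
boundary. Edges at the barycentre are bounded by `dist_bary_le`, the others by induction, since `m /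
(m + 1)` increases with `m`. -/
theorem subdiv_mem_diamLE {D : ℝ} {x : AffineChain K n m} (hx : x ∈ diamLE K n m D) :
    subdiv m x ∈ diamLE K n m (m / (m + 1) * D) := by
  induction m with
  | zero =>
    refine map_mem_of_supported _ (fun v _ => ?_) hx
    refine Finsupp.single_mem_supported K 1 fun i j => ?_
    rw [show i = j by omega]
    simp
  | succ m ih =>
    refine map_mem_of_supported _ (fun v hv => ?_) hx
    rw [subdiv_single]
    have hD : 0 ≤ D := dist_nonneg.trans (hv 0 0)
    -- A convex set that contains the vertices also contains the subdivided boundary, so every new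
    -- vertex is this close to the barycentre.
    set c := Metric.closedBall (bary v : Fin (n + 1) → ℝ) ((m + 1 : ℕ) / ((m + 1 : ℕ) + 1) * D)
    have hvc : ∀ i, (v i : Fin (n + 1) → ℝ) ∈ c := fun i => dist_bary_le v hv i
    have h1 : subdiv m (boundary (Finsupp.single v (1 : K))) ∈ within K m c :=
      subdiv_mem_within (convex_closedBall _ _) (boundary_mem_within (single_mem_within hvc))
    have h2 : subdiv m (boundary (Finsupp.single v (1 : K))) ∈ diamLE K n m (m / (m + 1) * D) := by
      refine ih ?_
      rw [boundary_single]
      exact Submodule.sum_mem _ fun i _ => Submodule.smul_mem _ _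
        (Finsupp.single_mem_supported K 1 fun j k => hv _ _)
    have h3 := Submodule.mem_inf.2 ⟨h1, h2⟩
    rw [within, diamLE, ← Finsupp.supported_inter] at h3
    refine map_mem_of_supported _ (fun w hw => ?_) h3
    rw [cone_single]
    refine Finsupp.single_mem_supported K 1 ?_
    have hle : (m : ℝ) / (m + 1) * D ≤ (m + 1 : ℕ) / ((m + 1 : ℕ) + 1) * D := by
      refine mul_le_mul_of_nonneg_right ?_ hD
      rw [div_le_div_iff₀ (by positivity) (by positivity)]
      push_cast
      nlinarith
    have h0 : 0 ≤ ((m + 1 : ℕ) : ℝ) / ((m + 1 : ℕ) + 1) * D := by positivity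
    have hb : ∀ i, dist (w i) (bary v) ≤ (m + 1 : ℕ) / ((m + 1 : ℕ) + 1) * D := fun i => hw.1 i
    intro i j
    refine Fin.cases ?_ (fun i => ?_) i <;> refine Fin.cases ?_ (fun j => ?_) j
    · simpa using h0
    · simpa [dist_comm] using hb j
    · simpa using hb i
    · simpa using (hw.2 i j).trans hle

theorem subdiv_pow_mem_diamLE {D : ℝ} {x : AffineChain K n m} (hx : x ∈ diamLE K n m D) (k : ℕ) :
    (subdiv m ^ k) x ∈ diamLE K n m ((m / (m + 1)) ^ k * D) := by
  induction k with
  | zero => simpa using hx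
  | succ k ih =>
    rw [pow_succ', mul_assoc, pow_succ', Module.End.mul_apply]
    exact subdiv_mem_diamLE ih

end Support

end AffineChain

/-! ### Singular simplices and the small simplices theorem. -/

/-- The singular simplicial set of a topological space. -/
noncomputable abbrev Sing (X : Type u) [TopologicalSpace X] : SSet.{u} :=
  TopCat.toSSet.obj (TopCat.of X)

namespace Sing

variable {X Y : Type u} [TopologicalSpace X] [TopologicalSpace Y] {m n : ℕ}

/-- Singular simplices are continuous maps from a standard simplex. -/
noncomputable def equiv (X : Type u) [TopologicalSpace X] (n : ℕ) :
    (Sing X) _⦋n⦌ ≃ C(TopSimplex n, X) :=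
  TopCat.toSSetObjEquiv (TopCat.of X) (Opposite.op ⦋n⦌)

/-- The singular simplex given by a continuous map. -/
noncomputable def mk (σ : C(TopSimplex n, X)) : (Sing X) _⦋n⦌ := (equiv X n).symm σ

/-- The continuous map on a standard simplex induced by a map of vertices. -/
noncomputable def simplexMap (θ : ⦋m⦌ ⟶ ⦋n⦌) : C(TopSimplex m, TopSimplex n) :=
  ⟨_, stdSimplex.continuous_map θ.toOrderHom⟩

theorem map_mk (θ : ⦋m⦌ ⟶ ⦋n⦌) (σ : C(TopSimplex n, X)) :
    (Sing X).map θ.op (mk σ) = mk (σ.comp (simplexMap θ)) := rfl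

theorem mk_equiv (σ : (Sing X) _⦋n⦌) : mk (equiv X n σ) = σ := (equiv X n).symm_apply_apply σ

theorem equiv_mk (σ : C(TopSimplex n, X)) : equiv X n (mk σ) = σ := (equiv X n).apply_symm_apply σ

theorem simplexMap_eq_combMap (θ : ⦋m⦌ ⟶ ⦋n⦌) :
    simplexMap θ = TopSimplex.combMap (TopSimplex.vertex ∘ θ.toOrderHom) := by
  ext x : 1
  change stdSimplex.map θ.toOrderHom x = TopSimplex.comb _ x
  rw [TopSimplex.comb_comp, TopSimplex.comb_vertex]

end Sing

open SSetCochain TopSimplex AffineChain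

namespace Sing

variable {X : Type u} [TopologicalSpace X] {K : Type v} [Field K] {m n p : ℕ}

/-- The value of a cochain on the image of an affine chain under a singular simplex. -/
noncomputable def pairing (a : SSetCochain (Sing X) K m) (σ : C(TopSimplex n, X)) :
    AffineChain K n m →ₗ[K] K :=
  Finsupp.linearCombination K fun v => a (mk (σ.comp (combMap v)))

theorem pairing_single (a : SSetCochain (Sing X) K m) (σ : C(TopSimplex n, X))
    (v : Fin (m + 1) → TopSimplex n) :
    pairing a σ (Finsupp.single v 1) = a (mk (σ.comp (combMap v))) := by
  rw [pairing, Finsupp.linearCombination_single, one_smul]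

theorem pairing_boundary (a : SSetCochain (Sing X) K m) (σ : C(TopSimplex n, X))
    (x : AffineChain K n (m + 1)) :
    pairing a σ (boundary x) = pairing (coboundary m a) σ x := by
  refine induction_single (f := pairing a σ ∘ₗ boundary) (fun v => ?_) x
  rw [LinearMap.comp_apply, boundary_single, pairing_single, coboundary_apply, map_sum]
  refine Finset.sum_congr rfl fun i _ => ?_
  rw [map_smul, pairing_single, map_mk, smul_eq_mul]
  congr 3
  ext x : 1
  exact congrArg σ (comb_comp v _ x)

theorem pairing_push (a : SSetCochain (Sing X) K m) (σ : C(TopSimplex p, X))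
    (w : Fin (n + 1) → TopSimplex p) (x : AffineChain K n m) :
    pairing a (σ.comp (combMap w)) x = pairing a σ (push w m x) := by
  refine induction_single (g := pairing a σ ∘ₗ push w m) (fun v => ?_) x
  rw [LinearMap.comp_apply, push_single, pairing_single, pairing_single]
  congr 2
  ext x : 1
  exact congrArg σ (comb_comb w v x)

/-- The tautological affine chain. -/
noncomputable def unitChain (K : Type v) [Field K] (n : ℕ) : AffineChain K n n :=
  Finsupp.single vertex 1

theorem pairing_unitChain (a : SSetCochain (Sing X) K n) (σ : C(TopSimplex n, X)) :
    pairing a σ (unitChain K n) = a (mk σ) := by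
  rw [unitChain, pairing_single]
  congr 2
  ext x : 1
  exact congrArg σ (comb_vertex x)

variable {U V : Set X}

/-- The affine chains whose simplices lie in a ball that is mapped into one of two given sets. -/
def smallChains (K : Type v) [Field K] (U V : Set X) (σ : C(TopSimplex n, X)) (m : ℕ) :
    Submodule K (AffineChain K n m) :=
  -- Convexity of `c` makes smallness survive the subdivision homotopy, all of whose new vertices
  -- are convex combinations of old ones.
  Finsupp.supported K K {v | ∃ c : Set (Fin (n + 1) → ℝ), Convex ℝ c ∧
    (∀ i, (v i : Fin (n + 1) → ℝ) ∈ c) ∧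
    ((∀ x : TopSimplex n, (x : Fin (n + 1) → ℝ) ∈ c → σ x ∈ U) ∨
      (∀ x : TopSimplex n, (x : Fin (n + 1) → ℝ) ∈ c → σ x ∈ V))}

theorem homotopy_mem_smallChains {σ : C(TopSimplex n, X)} {x : AffineChain K n m}
    (hx : x ∈ smallChains K U V σ m) : homotopy m x ∈ smallChains K U V σ (m + 1) := by
  refine map_mem_of_supported _ ?_ hx
  rintro v ⟨c, hc, hv, h⟩
  have := homotopy_mem_within hc (single_mem_within (K := K) hv)
  refine Finsupp.supported_mono ?_ this
  exact fun w hw => ⟨c, hc, hw, h⟩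

theorem pairing_eq_zero_of_small {a : SSetCochain (Sing X) K m}
    (haU : ∀ σ : C(TopSimplex m, X), (∀ x, σ x ∈ U) → a (mk σ) = 0)
    (haV : ∀ σ : C(TopSimplex m, X), (∀ x, σ x ∈ V) → a (mk σ) = 0)
    {σ : C(TopSimplex n, X)} {x : AffineChain K n m} (hx : x ∈ smallChains K U V σ m) :
    pairing a σ x = 0 := by
  rw [← Submodule.mem_bot K]
  refine map_mem_of_supported _ ?_ hx
  rintro v ⟨c, hc, hv, h⟩
  rw [pairing_single, Submodule.mem_bot]
  rcases h with h | h
  · exact haU _ fun x => h _ (comb_mem hc hv x)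
  · exact haV _ fun x => h _ (comb_mem hc hv x)

/-- Diameters decay like `(n / (n + 1)) ^ k` and eventually fall below a Lebesgue number of the
pulled-back cover. Smallness for all later `k` is what makes the series in
`exists_coboundary_eq_of_small` finite. -/
theorem exists_subdiv_pow_mem_smallChains (hU : IsOpen U) (hV : IsOpen V) (hUV : U ∪ V = Set.univ)
    (σ : C(TopSimplex n, X)) :
    ∃ N, ∀ k ≥ N, (subdiv n ^ k) (unitChain K n) ∈ smallChains K U V σ n := by
  obtain ⟨δ, hδ, hball⟩ := lebesgue_number_lemma_of_metric (s := Set.univ)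
    (c := fun b : Bool => σ ⁻¹' (if b then U else V)) isCompact_univ
    (fun b => by cases b <;> simp [hU.preimage σ.continuous, hV.preimage σ.continuous])
    (fun x _ => by
      have : σ x ∈ U ∪ V := by rw [hUV]; trivial
      rcases this with h | h
      · exact Set.mem_iUnion.2 ⟨true, h⟩
      · exact Set.mem_iUnion.2 ⟨false, h⟩)
  have hr : (n : ℝ) / (n + 1) < 1 := by
    rw [div_lt_one (by positivity)]
    linarith
  obtain ⟨N, hN⟩ := exists_pow_lt_of_lt_one (y := (n : ℝ) / (n + 1)) hδ hr
  refine ⟨N, fun k hk => ?_⟩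
  have h1 : unitChain K n ∈ diamLE K n n 1 := by
    refine Finsupp.single_mem_supported K 1 fun i j => ?_
    refine (dist_pi_le_iff zero_le_one).2 fun l => ?_
    have hi := mem_Icc_of_mem_stdSimplex (vertex i).2 l
    have hj := mem_Icc_of_mem_stdSimplex (vertex j).2 l
    exact Real.dist_le_of_mem_Icc_01 hi hj
  have h2 := subdiv_pow_mem_diamLE h1 k
  refine Finsupp.supported_mono ?_ h2
  intro v hv
  have hlt : ((n : ℝ) / (n + 1)) ^ k * 1 < δ := by
    rw [mul_one]
    exact (pow_le_pow_of_le_one (by positivity) hr.le hk).trans_lt hN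
  refine ⟨Metric.ball (v 0 : Fin (n + 1) → ℝ) δ, convex_ball _ _,
    fun i => (hv i 0).trans_lt hlt, ?_⟩
  obtain ⟨b, hb⟩ := hball (v 0) trivial
  cases b
  · exact Or.inr fun x hx => by simpa using hb (show x ∈ Metric.ball (v 0) δ from hx)
  · exact Or.inl fun x hx => by simpa using hb (show x ∈ Metric.ball (v 0) δ from hx)

/-- A cocycle that vanishes on the simplices subordinate to an open cover is a coboundary. -/
theorem exists_coboundary_eq_of_small (hU : IsOpen U) (hV : IsOpen V) (hUV : U ∪ V = Set.univ)
    {a : SSetCochain (Sing X) K (n + 1)} (ha : coboundary (n + 1) a = 0)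
    (haU : ∀ σ : C(TopSimplex (n + 1), X), (∀ x, σ x ∈ U) → a (mk σ) = 0)
    (haV : ∀ σ : C(TopSimplex (n + 1), X), (∀ x, σ x ∈ V) → a (mk σ) = 0) :
    ∃ b : SSetCochain (Sing X) K n, coboundary n b = a := by
  choose N hN using fun σ : C(TopSimplex n, X) =>
    exists_subdiv_pow_mem_smallChains (K := K) hU hV hUV σ
  -- The primitive is the sum over all `k` of `a` on the homotopy applied to the `k`-th subdivision;
  -- only finitely many terms are nonzero for each `σ`.
  let t : C(TopSimplex n, X) → ℕ → K := fun σ k =>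
    pairing a σ (homotopy n ((subdiv n ^ k) (unitChain K n)))
  have ht : ∀ σ M, N σ ≤ M → ∑ k ∈ Finset.range (N σ), t σ k = ∑ k ∈ Finset.range M, t σ k := by
    intro σ M hM
    rw [← Finset.sum_range_add_sum_Ico _ hM, left_eq_add]
    refine Finset.sum_eq_zero fun k hk => ?_
    exact pairing_eq_zero_of_small haU haV
      (homotopy_mem_smallChains (hN σ k (Finset.mem_Ico.1 hk).1))
  refine ⟨fun s => ∑ k ∈ Finset.range (N (equiv X n s)), t (equiv X n s) k, ?_⟩
  funext s
  obtain ⟨σ, rfl⟩ : ∃ σ, s = mk σ := ⟨equiv X _ s, (mk_equiv s).symm⟩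
  obtain ⟨N', hN'⟩ := exists_subdiv_pow_mem_smallChains (K := K) hU hV hUV σ
  let f : Fin (n + 2) → C(TopSimplex n, X) := fun i => σ.comp (simplexMap (SimplexCategory.δ i))
  -- A common cutoff for `σ` and all its faces.
  let M := N' + ∑ i, N (f i)
  have hM : ∀ i, N (f i) ≤ M := fun i =>
    (Finset.single_le_sum (f := fun i => N (f i)) (fun _ _ => Nat.zero_le _)
      (Finset.mem_univ i)).trans (Nat.le_add_left _ _)
  rw [coboundary_apply]
  have e1 : ∀ i : Fin (n + 2), equiv X n ((Sing X).map (SimplexCategory.δ i).op (mk σ)) = f i :=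
    fun i => equiv_mk (f i)
  simp only [e1, ht _ M (hM _), Finset.mul_sum]
  rw [Finset.sum_comm]
  -- As `a` vanishes on boundaries, the homotopy formula leaves a telescoping difference of
  -- successive subdivisions. After `M` steps the chain is small and only the value of `a` on `σ`
  -- remains.
  have e2 : ∀ k, ∑ i : Fin (n + 2), (-1 : K) ^ (i : ℕ) * t (f i) k =
      pairing a σ ((subdiv (n + 1) ^ k) (unitChain K (n + 1))) -
        pairing a σ ((subdiv (n + 1) ^ (k + 1)) (unitChain K (n + 1))) := by
    intro k
    have e3 : ∀ i : Fin (n + 2), t (f i) k = pairing a σ (homotopy n ((subdiv n ^ k)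
        (Finsupp.single (vertex ∘ i.succAbove) 1))) := by
      intro i
      change pairing a (σ.comp (simplexMap _)) _ = _
      rw [simplexMap_eq_combMap, pairing_push, push_homotopy, push_subdiv_pow, unitChain,
        push_single]
      congr 5
      funext j
      rw [comb_apply_vertex]
      rfl
    simp only [e3]
    have e4 := congrArg (pairing a σ) (homotopy_boundary_subdiv_pow k (unitChain K (n + 1)))
    rw [map_sub, map_sub, pairing_boundary, ha] at e4
    have e5 : pairing (0 : SSetCochain (Sing X) K (n + 2)) σ = 0 := by
      ext v
      simp [pairing]
    rw [e5, LinearMap.zero_apply, sub_zero] at e4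
    rw [← e4, unitChain, boundary_single]
    simp only [map_sum, map_smul, smul_eq_mul]
  rw [Finset.sum_congr rfl fun k _ => e2 k, Finset.sum_range_sub', pow_zero,
    pairing_eq_zero_of_small haU haV (hN' M (Nat.le_add_right _ _)), sub_zero]
  exact pairing_unitChain a σ

end Sing

/-! ### Homotopies of spaces, gluing of cochains and Mayer–Vietoris. -/

namespace SSetCochain

variable {R S T : SSet.{u}} {K : Type v} [Field K]

/-- The restriction of a homotopy along a map of simplicial sets. -/
def SimplexHomotopy.precomp (H : SimplexHomotopy S T) (φ : SimplexMap R S) :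
    SimplexHomotopy R T where
  toFun n σ χ := H.toFun n (φ.toFun n σ) χ
  map θ σ χ := by rw [H.map, φ.map]

theorem SimplexHomotopy.precomp_prism (H : SimplexHomotopy S T) (φ : SimplexMap R S) {n m : ℕ}
    (h : n = m + 1) (f : SSetCochain T K n) :
    (H.precomp φ).prism n m h f = pullback φ m (H.prism n m h f) := by
  funext σ
  rw [pullback_apply, prism_apply, prism_apply]
  simp only [φ.map]
  rfl

/-- The composition of maps of simplicial sets. -/
def SimplexMap.comp (ψ : SimplexMap S T) (φ : SimplexMap R S) : SimplexMap R T where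
  toFun n σ := ψ.toFun n (φ.toFun n σ)
  map θ σ := by rw [ψ.map, φ.map]

theorem SimplexHomotopy.precomp_endpoint (H : SimplexHomotopy S T) (φ : SimplexMap R S)
    (b : Bool) : (H.precomp φ).endpoint b = (H.endpoint b).comp φ := rfl

end SSetCochain

namespace Sing

variable {W X Y : Type u} [TopologicalSpace W] [TopologicalSpace X] [TopologicalSpace Y]
  {K : Type v} [Field K] {m n : ℕ}

/-- The map of singular simplicial sets induced by a continuous map. -/
noncomputable def ofMap (f : C(W, X)) : SimplexMap (Sing W) (Sing X) where
  toFun n σ := mk (f.comp (equiv W n σ))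
  map _ _ := rfl

/-- The affine function on a simplex with values `0` or `1` at the vertices. -/
noncomputable def level (χ : Fin (n + 1) → Bool) : C(TopSimplex n, unitInterval) where
  toFun x := ⟨∑ j, x j * (if χ j then 1 else 0), by
    have h : ∀ j, x j * (if χ j then (1 : ℝ) else 0) ≤ x j := fun j => by
      split_ifs
      · rw [mul_one]
      · rw [mul_zero]; exact x.2.1 j
    exact ⟨Finset.sum_nonneg fun j _ => mul_nonneg (x.2.1 j) (by split_ifs <;> simp),
      (Finset.sum_le_sum fun j _ => h j).trans_eq x.2.2⟩⟩
  continuous_toFun := by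
    refine Continuous.subtype_mk ?_ _
    refine continuous_finsetSum _ fun i _ => Continuous.fun_mul ?_ continuous_const
    exact (continuous_apply i).comp continuous_subtype_val

theorem level_true (x : TopSimplex n) : level (fun _ => true) x = 1 := by
  apply Subtype.ext
  change ∑ j, x j * (if true then 1 else 0) = (1 : ℝ)
  simp

theorem level_false (x : TopSimplex n) : level (fun _ => false) x = 0 := by
  apply Subtype.ext
  change ∑ j, x j * (if false then 1 else 0) = (0 : ℝ)
  simp

theorem level_simplexMap (χ : Fin (n + 1) → Bool) (θ : ⦋m⦌ ⟶ ⦋n⦌) (x : TopSimplex m) :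
    level χ (simplexMap θ x) = level (fun i => χ (θ.toOrderHom i)) x := by
  apply Subtype.ext
  change ∑ j, stdSimplex.map θ.toOrderHom x j * (if χ j then (1 : ℝ) else 0) =
    ∑ j, x j * (if χ (θ.toOrderHom j) then (1 : ℝ) else 0)
  simp only [stdSimplex.map_coe, FunOnFinite.linearMap_apply_apply, Finset.sum_mul]
  rw [← Finset.sum_fiberwise Finset.univ θ.toOrderHom]
  refine Finset.sum_congr rfl fun i _ => Finset.sum_congr rfl fun k hk => ?_
  rw [Finset.mem_filter] at hk
  rw [hk.2]

/-- The simplicial homotopy induced by a homotopy of continuous maps. -/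
noncomputable def ofHomotopy {f g : C(W, X)} (H : f.Homotopy g) :
    SimplexHomotopy (Sing W) (Sing X) where
  toFun n σ χ := mk (H.toContinuousMap.comp ((level χ).prodMk (equiv W n σ)))
  map θ σ χ := by
    rw [map_mk]
    congr 1
    ext x : 1
    change H (level χ (simplexMap θ x), _) = H (level _ x, _)
    rw [level_simplexMap]
    rfl

theorem ofHomotopy_endpoint_true {f g : C(W, X)} (H : f.Homotopy g) :
    (ofHomotopy H).endpoint true = ofMap g := by
  refine SimplexMap.ext (funext fun n => funext fun σ => ?_)
  change mk _ = mk _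
  congr 1
  ext x : 1
  change H (level _ x, _) = _
  rw [level_true, H.apply_one]
  rfl

theorem ofHomotopy_endpoint_false {f g : C(W, X)} (H : f.Homotopy g) :
    (ofHomotopy H).endpoint false = ofMap f := by
  refine SimplexMap.ext (funext fun n => funext fun σ => ?_)
  change mk _ = mk _
  congr 1
  ext x : 1
  change H (level _ x, _) = _
  rw [level_false, H.apply_zero]
  rfl

/-- A point as a singular simplex. -/
noncomputable def point (x : X) : (Sing X) _⦋0⦌ := mk (ContinuousMap.const _ x)

theorem ofMap_const (x : X) (σ : (Sing W) _⦋n⦌) :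
    (ofMap (ContinuousMap.const W x)).toFun n σ = constSimplex n (point x) := rfl

theorem exists_eq_point (s : (Sing X) _⦋0⦌) : ∃ x, s = point x := by
  refine ⟨equiv X 0 s default, ?_⟩
  rw [← mk_equiv s, equiv_mk]
  change mk _ = mk _
  congr 1
  ext x : 1
  rw [Subsingleton.elim x default]
  rfl

section Glue

variable {U V : Set X}

/-- The inclusion of a subset. -/
abbrev incl (U : Set X) : C(U, X) := ⟨Subtype.val, continuous_subtype_val⟩

/-- The inclusion of the intersection into the first subset. -/
def inclLeft (U V : Set X) : C((U ∩ V : Set X), U) :=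
  ⟨Set.inclusion Set.inter_subset_left, continuous_inclusion _⟩

/-- The inclusion of the intersection into the second subset. -/
def inclRight (U V : Set X) : C((U ∩ V : Set X), V) :=
  ⟨Set.inclusion Set.inter_subset_right, continuous_inclusion _⟩

/-- The lift of a simplex to a subset containing it. -/
noncomputable def lift (σ : C(TopSimplex n, X)) (h : ∀ x, σ x ∈ U) : (Sing U) _⦋n⦌ :=
  mk ⟨fun x => ⟨σ x, h x⟩, σ.continuous.subtype_mk h⟩

theorem lift_ofMap_incl (σ : (Sing U) _⦋n⦌) (h : ∀ x, equiv X n ((ofMap (incl U)).toFun n σ) x ∈ U) :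
    lift (equiv X n ((ofMap (incl U)).toFun n σ)) h = σ :=
  mk_equiv σ

-- A simplex inside `U` or `V` takes the value of its lift, and any other simplex takes the value
-- `0`. Compatibility on `U ∩ V` settles the overlap.
open Classical in
theorem exists_glue (bU : SSetCochain (Sing U) K n) (bV : SSetCochain (Sing V) K n)
    (h : pullback (ofMap (inclLeft U V)) n bU = pullback (ofMap (inclRight U V)) n bV) :
    ∃ b : SSetCochain (Sing X) K n,
      pullback (ofMap (incl U)) n b = bU ∧ pullback (ofMap (incl V)) n b = bV := by
  refine ⟨fun σ => if hU : ∀ x, equiv X n σ x ∈ U then bU (lift _ hU) else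
    if hV : ∀ x, equiv X n σ x ∈ V then bV (lift _ hV) else 0, ?_, ?_⟩
  · funext σ
    have hU : ∀ x, equiv X n ((ofMap (incl U)).toFun n σ) x ∈ U := fun x => (equiv U n σ x).2
    rw [pullback_apply, dif_pos hU, lift_ofMap_incl]
  · funext σ
    have hV : ∀ x, equiv X n ((ofMap (incl V)).toFun n σ) x ∈ V := fun x => (equiv V n σ x).2
    rw [pullback_apply]
    by_cases hU : ∀ x, equiv X n ((ofMap (incl V)).toFun n σ) x ∈ U
    · rw [dif_pos hU]
      have := congrFun h (lift (equiv X n ((ofMap (incl V)).toFun n σ)) fun x => ⟨hU x, hV x⟩)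
      refine this.trans ?_
      rw [pullback_apply]
      congr 1
    · rw [dif_neg hU, dif_pos hV, lift_ofMap_incl]

open Classical in
theorem exists_extend (c : SSetCochain (Sing U) K n) :
    ∃ b : SSetCochain (Sing X) K n, pullback (ofMap (incl U)) n b = c := by
  refine ⟨fun σ => if hU : ∀ x, equiv X n σ x ∈ U then c (lift _ hU) else 0, ?_⟩
  funext σ
  have hU : ∀ x, equiv X n ((ofMap (incl U)).toFun n σ) x ∈ U := fun x => (equiv U n σ x).2
  rw [pullback_apply, dif_pos hU, lift_ofMap_incl]

/-- Exactness of the Mayer–Vietoris sequence: subtracting the cocycle `e` from `bU` keeps it a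
primitive of `a` on `U` and lets it glue with `bV`. The error `a - δb` then vanishes on simplices
inside `U` or `V`, so `exists_coboundary_eq_of_small` applies. -/
theorem exists_coboundary_eq_of_glue (hU : IsOpen U) (hV : IsOpen V) (hUV : U ∪ V = Set.univ)
    {a : SSetCochain (Sing X) K (n + 1)} (ha : coboundary (n + 1) a = 0)
    {bU : SSetCochain (Sing U) K n} {bV : SSetCochain (Sing V) K n}
    (hbU : coboundary n bU = pullback (ofMap (incl U)) (n + 1) a)
    (hbV : coboundary n bV = pullback (ofMap (incl V)) (n + 1) a)
    {e : SSetCochain (Sing X) K n} (he : coboundary n e = 0)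
    (h : pullback (ofMap (inclLeft U V)) n bU - pullback (ofMap (inclRight U V)) n bV =
      pullback (ofMap (incl (U ∩ V))) n e) :
    ∃ b : SSetCochain (Sing X) K n, coboundary n b = a := by
  obtain ⟨b, h1, h2⟩ := exists_glue (bU - pullback (ofMap (incl U)) n e) bV (by
    rw [map_sub]
    have : pullback (ofMap (inclLeft U V)) n (pullback (ofMap (incl U)) n e) =
      pullback (ofMap (incl (U ∩ V))) n e := rfl
    rw [this, ← h, sub_sub_cancel])
  have hU' : pullback (ofMap (incl U)) (n + 1) (a - coboundary n b) = 0 := by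
    rw [map_sub, pullback_coboundary, h1, map_sub, ← pullback_coboundary, he, hbU, map_zero,
      sub_zero, sub_self]
  have hV' : pullback (ofMap (incl V)) (n + 1) (a - coboundary n b) = 0 := by
    rw [map_sub, pullback_coboundary, h2, hbV, sub_self]
  obtain ⟨b', hb'⟩ := exists_coboundary_eq_of_small (a := a - coboundary n b) hU hV hUV
    (by rw [map_sub, ha, coboundary_coboundary, sub_zero])
    (fun σ hσ => congrFun hU' (lift σ hσ)) (fun σ hσ => congrFun hV' (lift σ hσ))
  exact ⟨b' + b, by rw [map_add, hb', sub_add_cancel]⟩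

end Glue

end Sing

/-! ### Transgression along a loop of homotopies. -/

namespace SSetCochain

variable {R S : SSet.{u}} {K : Type v} [Field K]

/-- Two composable homotopies, from a constant map to `middle` and back to the same constant map. -/
structure HomotopyLoop (R S : SSet.{u}) where
  middle : SimplexMap R S
  base : S _⦋0⦌
  fst : SimplexHomotopy R S
  snd : SimplexHomotopy R S
  fst_true : fst.endpoint true = middle
  fst_false : ∀ n σ, (fst.endpoint false).toFun n σ = constSimplex n base
  snd_true : ∀ n σ, (snd.endpoint true).toFun n σ = constSimplex n base
  snd_false : snd.endpoint false = middle

namespace HomotopyLoop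

variable (L : HomotopyLoop R S)

/-- The prism operator of the concatenated homotopy. -/
noncomputable def transgression (K : Type v) [Field K] :
    (⨁ n, SSetCochain S K n) →ₗ[K] (⨁ n, SSetCochain R K n) :=
  L.fst.totalPrism K + L.snd.totalPrism K

/-- The homotopy for the multiplicativity of the prism operator of the concatenated homotopy. -/
noncomputable def pairing (K : Type v) [Field K] :
    (⨁ n, SSetCochain S K n) →ₗ[K] (⨁ n, SSetCochain S K n) →ₗ[K] (⨁ n, SSetCochain R K n) :=
  (LinearMap.mul K (⨁ n, SSetCochain R K n)).compl₁₂
    (sign R K ∘ₗ L.fst.totalPrism K) (L.snd.totalPrism K)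

theorem transgression_apply (a : ⨁ n, SSetCochain S K n) :
    L.transgression K a = L.fst.totalPrism K a + L.snd.totalPrism K a := rfl

theorem pairing_apply (a b : ⨁ n, SSetCochain S K n) :
    L.pairing K a b = sign R K (L.fst.totalPrism K a) * L.snd.totalPrism K b := rfl

variable {a b c : ⨁ n, SSetCochain S K n}

theorem totalCoboundary_fst (ha : a ∈ reducedSubalgebra S K) :
    totalCoboundary R K (L.fst.totalPrism K a) = totalPullback L.middle K a -
      augmentation K L.base a • 1 - L.fst.totalPrism K (totalCoboundary S K a) := by
  rw [eq_sub_iff_add_eq, L.fst.totalCoboundary_totalPrism_add, L.fst_true,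
    totalPullback_const L.fst_false ha]

theorem totalCoboundary_snd (ha : a ∈ reducedSubalgebra S K) :
    totalCoboundary R K (L.snd.totalPrism K a) = augmentation K L.base a • 1 -
      totalPullback L.middle K a - L.snd.totalPrism K (totalCoboundary S K a) := by
  rw [eq_sub_iff_add_eq, L.snd.totalCoboundary_totalPrism_add, L.snd_false,
    totalPullback_const L.snd_true ha]

/-- The constant end of the first homotopy is its bottom, that of the second its top. So the
augmentation acts on the left factor here and on the right factor in `snd_mul`. -/
theorem fst_mul (ha : a ∈ reducedSubalgebra S K) (b : ⨁ n, SSetCochain S K n) :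
    L.fst.totalPrism K (a * b) = L.fst.totalPrism K a * totalPullback L.middle K b +
      augmentation K L.base a • L.fst.totalPrism K b := by
  rw [L.fst.totalPrism_mul, L.fst_true, totalPullback_const L.fst_false ha, map_smul, sign_one,
    smul_one_mul]

theorem snd_mul (a : ⨁ n, SSetCochain S K n) (hb : b ∈ reducedSubalgebra S K) :
    L.snd.totalPrism K (a * b) = augmentation K L.base b • L.snd.totalPrism K a +
      sign R K (totalPullback L.middle K a) * L.snd.totalPrism K b := by
  rw [L.snd.totalPrism_mul, L.snd_false, totalPullback_const L.snd_true hb, mul_smul_one]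

/-- The contributions of the middle map cancel, and those of the two constant ends cancel because
they share the base point. -/
theorem totalCoboundary_transgression (ha : a ∈ reducedSubalgebra S K) :
    L.transgression K (totalCoboundary S K a) =
      totalCoboundary R K (-L.transgression K a) := by
  rw [map_neg, transgression_apply, transgression_apply, map_add, L.totalCoboundary_fst ha,
    L.totalCoboundary_snd ha]
  abel

/-- The Leibniz rules of the two halves leave the cross terms `P₁ a` times the middle of `b` and the
signed middle of `a` times `P₂ b`. In the coboundary of `pairing`, the formulas for `d (P₁ a)` and
`d (P₂ b)` turn these middles into augmentations. -/
theorem transgression_mul (ha : a ∈ reducedSubalgebra S K) (hb : b ∈ reducedSubalgebra S K) :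
    L.transgression K (a * b) = augmentation K L.base a • L.transgression K b +
      augmentation K L.base b • L.transgression K a + L.pairing K (totalCoboundary S K a) b +
      L.pairing K (sign S K a) (totalCoboundary S K b) +
      totalCoboundary R K (-L.pairing K a b) := by
  have h : sign R K (L.fst.totalPrism K (sign S K a)) = -L.fst.totalPrism K a := by
    rw [L.fst.sign_totalPrism, sign_sign]
  have h' : totalCoboundary R K (sign R K (L.fst.totalPrism K a)) =
      -sign R K (totalCoboundary R K (L.fst.totalPrism K a)) := by
    rw [sign_totalCoboundary, neg_neg]
  have e₂ (p w : ⨁ n, SSetCochain R K n) : -p * w = -(p * w) := neg_mul p w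
  have e₁ (p q w : ⨁ n, SSetCochain R K n) (r : K) :
      -(p - r • 1 - q) * w = -(p * w) + r • w + q * w := by
    rw [e₂, ← smul_one_mul r w, sub_mul _ q w, sub_mul p _ w]
    abel
  simp only [transgression_apply, pairing_apply, h, map_neg]
  rw [totalCoboundary_mul, sign_sign, h', L.totalCoboundary_fst ha,
    L.totalCoboundary_snd hb, L.fst_mul ha, L.snd_mul _ hb]
  simp only [map_sub, map_smul, sign_one, e₁, e₂, mul_sub, mul_smul_one, smul_add]
  abel

/-- Both sides contain the same triple product of `P₁ a`, the middle of `b` and `P₂ c`, up to the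
same signs; the remaining terms match by the two Leibniz rules. -/
theorem pairing_mul (ha : a ∈ reducedSubalgebra S K) (b : ⨁ n, SSetCochain S K n)
    (hc : c ∈ reducedSubalgebra S K) :
    L.pairing K (a * b) c + augmentation K L.base c • L.pairing K a b =
      L.pairing K a (b * c) + augmentation K L.base a • L.pairing K b c := by
  simp only [pairing_apply, L.fst_mul ha, L.snd_mul b hc, map_add, map_smul, sign_mul, mul_add,
    add_mul, smul_mul_assoc, mul_smul_comm, mul_assoc]
  abel

theorem pairing_one_left (b : ⨁ n, SSetCochain S K n) : L.pairing K 1 b = 0 := by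
  rw [pairing_apply, SimplexHomotopy.totalPrism_one, map_zero, zero_mul]

theorem pairing_one_right (a : ⨁ n, SSetCochain S K n) : L.pairing K a 1 = 0 := by
  rw [pairing_apply, SimplexHomotopy.totalPrism_one, mul_zero]

theorem transgression_of_zero (f : SSetCochain S K 0) :
    L.transgression K (DirectSum.of (SSetCochain S K) 0 f) = 0 := by
  rw [transgression_apply, SimplexHomotopy.totalPrism_of_zero, SimplexHomotopy.totalPrism_of_zero,
    add_zero]

theorem transgression_of_succ {n : ℕ} (f : SSetCochain S K (n + 1)) :
    L.transgression K (DirectSum.of (SSetCochain S K) (n + 1) f) =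
      DirectSum.of (SSetCochain R K) n
        (L.fst.prism (n + 1) n rfl f + L.snd.prism (n + 1) n rfl f) := by
  rw [transgression_apply, SimplexHomotopy.totalPrism_of _ rfl,
    SimplexHomotopy.totalPrism_of _ rfl, map_add]

theorem _root_.SSetCochain.sign_mem_degree {n : ℤ} (ha : a ∈ degree S K n) :
    sign S K a ∈ degree S K n := by
  obtain rfl | ⟨m, f, rfl, rfl⟩ := eq_of_mem_degree ha
  · rw [map_zero]; exact zero_mem _
  · rw [sign_of]; exact Submodule.smul_mem _ _ ha

theorem _root_.SSetCochain.SimplexHomotopy.totalPrism_mem_degree (H : SimplexHomotopy R S)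
    {n : ℤ} (ha : a ∈ degree S K n) : H.totalPrism K a ∈ degree R K (n - 1) := by
  obtain rfl | ⟨m, f, rfl, rfl⟩ := eq_of_mem_degree ha
  · rw [map_zero]; exact zero_mem _
  · cases m with
    | zero => rw [H.totalPrism_of_zero]; exact zero_mem _
    | succ m =>
      rw [H.totalPrism_of rfl, Nat.cast_succ, add_sub_cancel_right]
      exact of_mem_degree m _

theorem transgression_mem_degree {n : ℤ} (ha : a ∈ degree S K n) :
    L.transgression K a ∈ degree R K (n - 1) :=
  add_mem (L.fst.totalPrism_mem_degree ha) (L.snd.totalPrism_mem_degree ha)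

theorem pairing_mem_degree {m n : ℤ} (ha : a ∈ degree S K m) (hb : b ∈ degree S K n) :
    L.pairing K a b ∈ degree R K (m - 1 + (n - 1)) :=
  SetLike.GradedMul.mul_mem (A := degree R K)
    (sign_mem_degree (L.fst.totalPrism_mem_degree ha)) (L.snd.totalPrism_mem_degree hb)

theorem _root_.SSetCochain.sign_eq_negOnePow_smul {n : ℤ} (ha : a ∈ degree S K n) :
    sign S K a = n.negOnePow • a := by
  obtain rfl | ⟨m, f, rfl, rfl⟩ := eq_of_mem_degree ha
  · simp
  · rw [sign_of, total_negOnePow_smul]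

end HomotopyLoop

end SSetCochain

/-! ### The square-zero map of a homotopy loop. -/

namespace SSetCochain

variable {R S : SSet.{u}} {K : Type v} [Field K]

/-- The dg-algebra of cochains that vanish on constant simplices of positive dimension. -/
noncomputable def reducedAlgebra (S : SSet.{u}) (K : Type v) [Field K] :
    DGAlgebra.{v, max u v} K :=
  (cochainAlgebra S K).restrict (reducedSubalgebra S K)
    (fun _ h => totalCoboundary_mem_reducedSubalgebra h)
    (fun _ h n => component_mem_reducedSubalgebra h n)

/-- The inclusion of the cochains that vanish on constant simplices of positive dimension. -/
noncomputable def reducedInclusion (S : SSet.{u}) (K : Type v) [Field K] :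
    DGAlgebra.Hom (reducedAlgebra S K) (cochainAlgebra S K) :=
  (cochainAlgebra S K).restrictHom _ _ _

theorem reducedInclusion_isQuasiIso : (reducedInclusion S K).IsQuasiIso :=
  (cochainAlgebra S K).restrictHom_isQuasiIso _ _ _ fun _ h => exists_sub_totalCoboundary_mem h

/-- A homogeneous cocycle as an element of the algebra of cocycles. -/
noncomputable def ofCocycle {n : ℕ} {f : SSetCochain S K n} (hf : coboundary n f = 0) :
    (cochainAlgebra S K).cocycles :=
  ⟨DirectSum.of (SSetCochain S K) n f, by
    change totalCoboundary S K _ = 0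
    rw [totalCoboundary_of, hf, map_zero]⟩

theorem toCohomology_ofCocycle_mem {n : ℕ} {f : SSetCochain S K n} (hf : coboundary n f = 0) :
    (cochainAlgebra S K).toCohomology (ofCocycle hf) ∈ (cochainAlgebra S K).cohomologyDeg n :=
  ⟨ofCocycle hf, of_mem_degree n f, rfl⟩

theorem augmentation_totalCoboundary (x : S _⦋0⦌) (a : ⨁ n, SSetCochain S K n) :
    augmentation K x (totalCoboundary S K a) = 0 := by
  rw [augmentation_apply, totalCoboundary_apply_zero]
  rfl

namespace HomotopyLoop

-- The map `r` is a left inverse of the transgression on cohomology: it raises degree by one, kills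
-- coboundaries and recovers the class of a reduced cocycle. The condition `h0` says that
-- degree-zero cocycles are constant.
variable (L : HomotopyLoop R S)
  (r : (⨁ n, SSetCochain R K n) →ₗ[K] (cochainAlgebra S K).CohomologyRing)
  (hr_deg : ∀ (n : ℕ) (f : SSetCochain R K n),
    r (DirectSum.of (SSetCochain R K) n f) ∈ (cochainAlgebra S K).cohomologyDeg (n + 1))
  (hr_d : ∀ x, r (totalCoboundary R K x) = 0)
  (hr : ∀ (n : ℕ) (f : SSetCochain S K (n + 1)) (hf : coboundary (n + 1) f = 0),
    (∀ x, f (constSimplex (n + 1) x) = 0) →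
    r (DirectSum.of (SSetCochain R K) n
      (L.fst.prism (n + 1) n rfl f + L.snd.prism (n + 1) n rfl f)) =
      (cochainAlgebra S K).toCohomology (ofCocycle hf))
  (h0 : ∀ f : SSetCochain S K 0, coboundary 0 f = 0 → ∀ s, f s = f L.base)

include hr_deg in
theorem apply_mem_cohomologyDeg {n : ℤ} {x : ⨁ n, SSetCochain R K n} (hx : x ∈ degree R K n) :
    r x ∈ (cochainAlgebra S K).cohomologyDeg (n + 1) := by
  obtain rfl | ⟨m, f, rfl, rfl⟩ := eq_of_mem_degree hx
  · rw [map_zero]; exact zero_mem _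
  · exact hr_deg m f

include hr_d in
theorem apply_transgression_mul {a b : ⨁ n, SSetCochain S K n} (ha : a ∈ reducedSubalgebra S K)
    (hb : b ∈ reducedSubalgebra S K) {n : ℤ} (hn : a ∈ degree S K n) :
    r (L.transgression K (a * b)) = augmentation K L.base a • r (L.transgression K b) +
      augmentation K L.base b • r (L.transgression K a) +
      r (L.pairing K (totalCoboundary S K a) b) +
      n.negOnePow • r (L.pairing K a (totalCoboundary S K b)) := by
  rw [L.transgression_mul ha hb, map_add, hr_d, add_zero, sign_eq_negOnePow_smul hn]
  simp only [Units.smul_def, map_add, map_smul, map_zsmul, LinearMap.smul_apply]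

include hr h0 in
theorem exists_toCohomology_eq {a : ⨁ n, SSetCochain S K n} (ha : a ∈ reducedSubalgebra S K)
    (hd : totalCoboundary S K a = 0) :
    ∃ h : a ∈ (cochainAlgebra S K).cocycles, (cochainAlgebra S K).toCohomology ⟨a, h⟩ =
      algebraMap K _ (augmentation K L.base a) +
        (cochainAlgebra S K).cohomologyReduced (r (L.transgression K a)) := by
  classical
  -- Bundling closedness with the equation makes the claim additive and reduces it to homogeneous
  -- components.
  let P : AddSubmonoid (⨁ n, SSetCochain S K n) :=
    { carrier := {a | ∃ h : a ∈ (cochainAlgebra S K).cocycles,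
        (cochainAlgebra S K).toCohomology ⟨a, h⟩ =
          algebraMap K _ (augmentation K L.base a) +
            (cochainAlgebra S K).cohomologyReduced (r (L.transgression K a))}
      zero_mem' := ⟨zero_mem _, by
        simp only [map_zero, add_zero]
        exact map_zero (cochainAlgebra S K).toCohomology⟩
      add_mem' := by
        rintro x y ⟨hx, ex⟩ ⟨hy, ey⟩
        refine ⟨add_mem hx hy, ?_⟩
        refine (map_add (cochainAlgebra S K).toCohomology ⟨x, hx⟩ ⟨y, hy⟩).trans ?_
        rw [ex, ey]
        simp only [map_add]
        abel }
  change a ∈ P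
  rw [← DirectSum.sum_support_of a]
  refine sum_mem fun n _ => ?_
  have hn : coboundary n (a n) = 0 := by
    rw [← totalCoboundary_apply, hd]; rfl
  refine ⟨(ofCocycle hn).2, ?_⟩
  change (cochainAlgebra S K).toCohomology (ofCocycle hn) = _
  cases n with
  | zero =>
    rw [L.transgression_of_zero, map_zero, map_zero, add_zero]
    have e : ofCocycle hn = algebraMap K (cochainAlgebra S K).cocycles (a 0 L.base) := by
      apply Subtype.ext
      change DirectSum.of (SSetCochain S K) 0 (a 0) = algebraMap K _ (a 0 L.base)
      rw [DirectSum.algebraMap_apply]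
      congr 1
      funext s
      exact h0 _ hn s
    rw [e, augmentation_apply, DirectSum.of_eq_same]
    rfl
  | succ n =>
    rw [L.transgression_of_succ, hr n _ hn fun x => mem_reducedSubalgebra.1 ha x n,
      augmentation_apply, DirectSum.of_eq_of_ne _ _ _ (by omega),
      DGAlgebra.cohomologyReduced_apply, (cochainAlgebra S K).cohomologyComponent_ne
        (by omega) (toCohomology_ofCocycle_mem hn), sub_zero]
    exact (zero_add _).symm.trans (congrArg (· + _) (map_zero (algebraMap K _)).symm)

/-- The map from reduced cochains to a square-zero extension determined by a homotopy loop. -/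
noncomputable def squareZeroMap :
    DGAlgebra.SquareZeroMap (reducedAlgebra S K) (cochainAlgebra S K).cohomologyDeg where
  ε := (augmentation K L.base).comp (reducedSubalgebra S K).val
  κ := r ∘ₗ L.transgression K ∘ₗ (reducedSubalgebra S K).val.toLinearMap
  F := ((L.pairing K).compr₂ r).compl₁₂ (reducedSubalgebra S K).val.toLinearMap
    (reducedSubalgebra S K).val.toLinearMap
  ε_deg {n a} ha hn := by
    change augmentation K L.base (a : reducedSubalgebra S K).1 = 0
    obtain h | ⟨m, f, rfl, h⟩ := eq_of_mem_degree (show (a : reducedSubalgebra S K).1 ∈ _ from ha)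
    · rw [h, map_zero]
    · rw [h, augmentation_apply, DirectSum.of_eq_of_ne _ _ _ (by rintro rfl; exact hn rfl)]
      rfl
  ε_d a := augmentation_totalCoboundary L.base _
  κ_deg {n a} ha := by
    have := apply_mem_cohomologyDeg r hr_deg
      (L.transgression_mem_degree (show (a : reducedSubalgebra S K).1 ∈ _ from ha))
    rwa [sub_add_cancel] at this
  κ_d a := by
    change r (L.transgression K (totalCoboundary S K (a : reducedSubalgebra S K).1)) = 0
    rw [L.totalCoboundary_transgression (a : reducedSubalgebra S K).2, hr_d]
  F_deg {m n a b} ha hb := by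
    have := apply_mem_cohomologyDeg r hr_deg
      (L.pairing_mem_degree (show (a : reducedSubalgebra S K).1 ∈ _ from ha)
        (show (b : reducedSubalgebra S K).1 ∈ _ from hb))
    rwa [show m - 1 + (n - 1) + 1 = m + n - 1 by ring] at this
  F_one_left b := (congrArg r (L.pairing_one_left _)).trans (map_zero r)
  F_one_right a := (congrArg r (L.pairing_one_right _)).trans (map_zero r)
  F_mul a b c := by
    have := congrArg r (L.pairing_mul (a : reducedSubalgebra S K).2 (b : reducedSubalgebra S K).1
      (c : reducedSubalgebra S K).2)
    rw [map_add, map_add, map_smul, map_smul] at this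
    exact this
  κ_mul {_ a} ha b := L.apply_transgression_mul r hr_d (a : reducedSubalgebra S K).2
    (b : reducedSubalgebra S K).2 ha

include hr_deg hr_d hr h0 in
theorem isFormal : (cochainAlgebra S K).IsFormal :=
  (L.squareZeroMap r hr_deg hr_d).isFormal reducedInclusion_isQuasiIso fun a ha =>
    (L.exists_toCohomology_eq r hr h0 (a : reducedSubalgebra S K).2
      (congrArg Subtype.val ha)).2

end HomotopyLoop

end SSetCochain

/-! ### The retraction of the transgression and the geometric cases. -/

theorem LinearMap.exists_comp_eq_of_ker_le_ker {K Z Q M : Type*} [Field K] [AddCommGroup Z]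
    [Module K Z] [AddCommGroup Q] [Module K Q] [AddCommGroup M] [Module K M] (p : Z →ₗ[K] Q)
    (q : Z →ₗ[K] M) (h : LinearMap.ker p ≤ LinearMap.ker q) : ∃ r : Q →ₗ[K] M, r ∘ₗ p = q := by
  obtain ⟨r, hr⟩ := LinearMap.exists_extend
    ((LinearMap.ker p).liftQ q h ∘ₗ p.quotKerEquivRange.symm.toLinearMap)
  refine ⟨r, LinearMap.ext fun z => ?_⟩
  have := LinearMap.congr_fun hr (p.quotKerEquivRange (Submodule.Quotient.mk z))
  simpa using this

namespace Sing

variable {X : Type u} [TopologicalSpace X] {K : Type v} [Field K] {n : ℕ} {U V : Set X}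

/-- The cocycles that vanish on constant simplices. -/
def reducedCocycles (S : SSet.{u}) (K : Type v) [Field K] (n : ℕ) :
    Submodule K (SSetCochain S K n) where
  carrier := {f | coboundary n f = 0 ∧ ∀ s, f (constSimplex n s) = 0}
  zero_mem' := ⟨map_zero _, fun _ => rfl⟩
  add_mem' := fun {f g} hf hg => ⟨by rw [map_add, hf.1, hg.1, add_zero], fun s => by
    rw [Pi.add_apply, hf.2, hg.2, add_zero]⟩
  smul_mem' := fun r f hf => ⟨by rw [map_smul, hf.1, smul_zero], fun s => by
    rw [Pi.smul_apply, hf.2, smul_zero]⟩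

variable {x y : X} (HU : (ContinuousMap.const U x).Homotopy (incl U))
  (HV : (incl V).Homotopy (ContinuousMap.const V y))

/-- The restriction to the intersection of a null-homotopy of the first subset. -/
noncomputable abbrev homotopyLeft : SimplexHomotopy (Sing (U ∩ V : Set X)) (Sing X) :=
  (ofHomotopy HU).precomp (ofMap (inclLeft U V))

/-- The restriction to the intersection of a null-homotopy of the second subset. -/
noncomputable abbrev homotopyRight : SimplexHomotopy (Sing (U ∩ V : Set X)) (Sing X) :=
  (ofHomotopy HV).precomp (ofMap (inclRight U V))

theorem pullback_const_eq_zero {W : Type u} [TopologicalSpace W] (x : X)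
    {a : SSetCochain (Sing X) K n} (ha : a ∈ reducedCocycles (Sing X) K n) :
    pullback (ofMap (ContinuousMap.const W x)) n a = 0 := by
  funext σ
  rw [pullback_apply, ofMap_const, ha.2]
  rfl

/-- The pullback of a reduced cocycle along a constant map is zero, so the prism formula gives
primitives of `a` on `U` and on `V`, the second with a minus sign because `HV` starts at the
inclusion. Their difference on `U ∩ V` is the transgression. -/
theorem exists_coboundary_eq_of_prism (hU : IsOpen U) (hV : IsOpen V) (hUV : U ∪ V = Set.univ)
    {a : SSetCochain (Sing X) K (n + 1)} (ha : a ∈ reducedCocycles (Sing X) K (n + 1))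
    {e : SSetCochain (Sing X) K n} (he : coboundary n e = 0)
    (h : (homotopyLeft (V := V) HU).prism (n + 1) n rfl a +
      (homotopyRight (U := U) HV).prism (n + 1) n rfl a = pullback (ofMap (incl (U ∩ V))) n e) :
    ∃ b : SSetCochain (Sing X) K n, coboundary n b = a := by
  refine exists_coboundary_eq_of_glue hU hV hUV ha.1
    (bU := (ofHomotopy HU).prism (n + 1) n rfl a) (bV := -(ofHomotopy HV).prism (n + 1) n rfl a)
    ?_ ?_ he ?_
  · have := (ofHomotopy HU).coboundary_prism_add a
    rwa [ha.1, map_zero, add_zero, ofHomotopy_endpoint_true, ofHomotopy_endpoint_false,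
      pullback_const_eq_zero x ha, sub_zero] at this
  · have := (ofHomotopy HV).coboundary_prism_add a
    rw [ha.1, map_zero, add_zero, ofHomotopy_endpoint_true, ofHomotopy_endpoint_false,
      pullback_const_eq_zero y ha, zero_sub] at this
    rw [map_neg, this, neg_neg]
  · rw [← h, SimplexHomotopy.precomp_prism, SimplexHomotopy.precomp_prism, map_neg, sub_neg_eq_add]

/-- Modulo restrictions of cocycles of `X`, the transgression detects cohomology classes by
`exists_coboundary_eq_of_prism`. So taking the class factors through it, and over a field the
factorization extends to all cochains. -/
theorem exists_retraction (hU : IsOpen U) (hV : IsOpen V) (hUV : U ∪ V = Set.univ) (n : ℕ) :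
    ∃ r : SSetCochain (Sing (U ∩ V : Set X)) K n →ₗ[K]
        (cochainAlgebra (Sing X) K).CohomologyRing,
      (∀ f, r f ∈ (cochainAlgebra (Sing X) K).cohomologyDeg (n + 1)) ∧
      (∀ e : SSetCochain (Sing X) K n, coboundary n e = 0 →
        r (pullback (ofMap (incl (U ∩ V))) n e) = 0) ∧
      ∀ (f : SSetCochain (Sing X) K (n + 1)) (hf : coboundary (n + 1) f = 0),
        (∀ s, f (constSimplex (n + 1) s) = 0) →
        r ((homotopyLeft (V := V) HU).prism (n + 1) n rfl f +
          (homotopyRight (U := U) HV).prism (n + 1) n rfl f) =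
          (cochainAlgebra (Sing X) K).toCohomology (ofCocycle hf) := by
  let B := cochainAlgebra (Sing X) K
  let E : Submodule K (SSetCochain (Sing (U ∩ V : Set X)) K n) :=
    (LinearMap.ker (coboundary n)).map (pullback (ofMap (incl (U ∩ V))) n)
  let c : reducedCocycles (Sing X) K (n + 1) →ₗ[K] B.cocycles :=
    { toFun := fun a => ofCocycle a.2.1
      map_add' := fun a b => Subtype.ext (map_add (DirectSum.lof K ℕ _ (n + 1)) a.1 b.1)
      map_smul' := fun r a => Subtype.ext (map_smul (DirectSum.lof K ℕ _ (n + 1)) r a.1) }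
  obtain ⟨r, hr⟩ := LinearMap.exists_comp_eq_of_ker_le_ker
    (E.mkQ ∘ₗ ((homotopyLeft (V := V) HU).prism (n + 1) n rfl +
      (homotopyRight (U := U) HV).prism (n + 1) n rfl) ∘ₗ
      (reducedCocycles (Sing X) K (n + 1)).subtype) (B.toCohomology ∘ₗ c) (by
    intro a ha
    rw [LinearMap.mem_ker, LinearMap.comp_apply, Submodule.mkQ_apply,
      Submodule.Quotient.mk_eq_zero] at ha
    obtain ⟨e, he, hea⟩ := ha
    obtain ⟨b, hb⟩ := exists_coboundary_eq_of_prism HU HV hU hV hUV a.2 he hea.symm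
    rw [LinearMap.mem_ker, LinearMap.comp_apply, B.toCohomology_eq_zero]
    refine ⟨DirectSum.of (SSetCochain (Sing X) K) n b, (totalCoboundary_of n b).trans ?_⟩
    rw [hb]
    rfl)
  -- Projecting to degree `n + 1` enforces homogeneity and does not change the classes already
  -- there.
  refine ⟨B.cohomologyComponent (n + 1) ∘ₗ r ∘ₗ E.mkQ, fun f => B.cohomologyComponent_mem _ _,
    fun e he => ?_, fun f hf hs => ?_⟩
  · have : E.mkQ (pullback (ofMap (incl (U ∩ V))) n e) = 0 := by
      rw [Submodule.mkQ_apply, Submodule.Quotient.mk_eq_zero]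
      exact ⟨e, he, rfl⟩
    rw [LinearMap.comp_apply, LinearMap.comp_apply, this, map_zero, map_zero]
  · have := LinearMap.congr_fun hr ⟨f, hf, hs⟩
    refine (congrArg (B.cohomologyComponent (n + 1)) this).trans ?_
    exact B.cohomologyComponent_same (toCohomology_ofCocycle_mem hf)

/-- The loop of homotopies on the intersection of two subsets with null-homotopies ending at the
same point. -/
noncomputable def homotopyLoop (HU : (ContinuousMap.const U x).Homotopy (incl U))
    (HV : (incl V).Homotopy (ContinuousMap.const V x)) :
    HomotopyLoop (Sing (U ∩ V : Set X)) (Sing X) where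
  middle := ofMap (incl (U ∩ V))
  base := point x
  fst := homotopyLeft HU
  snd := homotopyRight HV
  fst_true := by rw [SimplexHomotopy.precomp_endpoint, ofHomotopy_endpoint_true]; rfl
  fst_false _ _ := by rw [SimplexHomotopy.precomp_endpoint, ofHomotopy_endpoint_false]; rfl
  snd_true _ _ := by rw [SimplexHomotopy.precomp_endpoint, ofHomotopy_endpoint_true]; rfl
  snd_false := by rw [SimplexHomotopy.precomp_endpoint, ofHomotopy_endpoint_false]; rfl

/-- Each point is joined to `x` by the track of a null-homotopy; the degree-zero prism formula
compares the two values. -/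
theorem eq_point_of_coboundary_eq_zero (hUV : U ∪ V = Set.univ)
    (HU : (ContinuousMap.const U x).Homotopy (incl U))
    (HV : (incl V).Homotopy (ContinuousMap.const V x)) {f : SSetCochain (Sing X) K 0}
    (hf : coboundary 0 f = 0) (s : (Sing X) _⦋0⦌) : f s = f (point x) := by
  obtain ⟨y, rfl⟩ := exists_eq_point s
  obtain hy | hy : y ∈ U ∪ V := hUV ▸ Set.mem_univ y
  · have := congrFun ((ofHomotopy HU).prism_coboundary_zero f) (point ⟨y, hy⟩)
    rw [hf, map_zero, ofHomotopy_endpoint_true, ofHomotopy_endpoint_false, Pi.sub_apply,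
      pullback_apply, pullback_apply, ofMap_const, constSimplex_zero] at this
    exact sub_eq_zero.1 this.symm
  · have := congrFun ((ofHomotopy HV).prism_coboundary_zero f) (point ⟨y, hy⟩)
    rw [hf, map_zero, ofHomotopy_endpoint_true, ofHomotopy_endpoint_false, Pi.sub_apply,
      pullback_apply, pullback_apply, ofMap_const, constSimplex_zero] at this
    exact (sub_eq_zero.1 this.symm).symm

/-- A space covered by two open subsets that can be contracted to the same point is formal. -/
theorem isFormal_of_homotopy (hU : IsOpen U) (hV : IsOpen V) (hUV : U ∪ V = Set.univ)
    (HU : (ContinuousMap.const U x).Homotopy (incl U))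
    (HV : (incl V).Homotopy (ContinuousMap.const V x)) :
    (cochainAlgebra (Sing X) K).IsFormal := by
  choose r hdeg hker hr using exists_retraction (K := K) HU HV hU hV hUV
  have of n (f : SSetCochain (Sing (U ∩ V : Set X)) K n) :
      DirectSum.toModule K ℕ _ r (DirectSum.of _ n f) = r n f := DirectSum.toModule_lof K n f
  refine (homotopyLoop HU HV).isFormal (DirectSum.toModule K ℕ _ r) (fun n f => ?_) (fun z => ?_)
    (fun n f hf hs => ?_) (fun f hf s => eq_point_of_coboundary_eq_zero hUV HU HV hf s)
  · rw [of]; exact hdeg n f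
  · induction z using DirectSum.induction_on with
    | zero => simp
    | of n f =>
      -- Once `f` is extended by zero to `X`, its coboundary is the restriction of the cocycle `δb`,
      -- which `r` kills.
      obtain ⟨b, rfl⟩ := exists_extend f
      rw [totalCoboundary_of, of, ← pullback_coboundary, hker _ _ (coboundary_coboundary n b)]
    | add z z' h h' => rw [map_add, map_add, h, h', add_zero]
  · rw [of]; exact hr n f hf hs

theorem isFormal_of_forall_exists_coboundary
    (h : ∀ n, ∀ a ∈ reducedCocycles (Sing X) K (n + 1), ∃ b, coboundary n b = a) :
    (cochainAlgebra (Sing X) K).IsFormal := by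
  refine DGAlgebra.isFormal_of_acyclic _ (fun _ h => h) fun k hk a ha hd => ?_
  obtain rfl | ⟨n, f, rfl, rfl⟩ := eq_of_mem_degree ha
  · exact ⟨0, map_zero _⟩
  obtain ⟨n, rfl⟩ := Nat.exists_eq_succ_of_ne_zero (show n ≠ 0 by rintro rfl; exact hk rfl)
  change totalCoboundary (Sing X) K _ = 0 at hd
  -- Changing the cocycle by a coboundary makes it vanish on constant simplices, so the hypothesis
  -- applies to it.
  obtain ⟨c, hc⟩ := exists_sub_totalCoboundary_mem (T := Sing X)
    (a := DirectSum.of (SSetCochain (Sing X) K) (n + 1) f) (by rw [hd]; exact zero_mem _)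
  have hf : coboundary (n + 1) f = 0 := by
    have := totalCoboundary_apply (DirectSum.of (SSetCochain (Sing X) K) (n + 1) f) (n + 1)
    rw [hd, DirectSum.of_eq_same] at this
    exact this.symm
  obtain ⟨b, hb⟩ := h n (f - coboundary n (c n)) ⟨by
    rw [map_sub, hf, coboundary_coboundary, sub_zero], fun s => by
    have := mem_reducedSubalgebra.1 hc s n
    rwa [DirectSum.sub_apply, DirectSum.of_eq_same, totalCoboundary_apply] at this⟩
  refine ⟨DirectSum.of (SSetCochain (Sing X) K) n (b + c n), (totalCoboundary_of n _).trans ?_⟩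
  rw [map_add, hb, sub_add_cancel]

/-- A space covered by two disjoint open subsets that are contractible in it is formal. -/
theorem isFormal_of_disjoint (hU : IsOpen U) (hV : IsOpen V) (hUV : U ∪ V = Set.univ)
    (HU : (ContinuousMap.const U x).Homotopy (incl U))
    (HV : (incl V).Homotopy (ContinuousMap.const V y)) (h : IsEmpty (U ∩ V : Set X)) :
    (cochainAlgebra (Sing X) K).IsFormal :=
  isFormal_of_forall_exists_coboundary fun n _ ha =>
    exists_coboundary_eq_of_prism HU HV hU hV hUV ha (e := 0) (map_zero _)
      (funext fun σ => h.elim (equiv _ n σ (stdSimplex.vertex 0)))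

theorem isFormal_of_isEmpty [IsEmpty X] : (cochainAlgebra (Sing X) K).IsFormal :=
  isFormal_of_forall_exists_coboundary fun n _ _ =>
    ⟨0, funext fun σ => isEmptyElim (equiv X (n + 1) σ (stdSimplex.vertex 0))⟩

theorem isFormal_of_nullhomotopic (hU : IsOpen U) (hV : IsOpen V) (hUV : U ∪ V = Set.univ)
    (HU : (incl U).Nullhomotopic) (HV : (incl V).Nullhomotopic) :
    (cochainAlgebra (Sing X) K).IsFormal := by
  obtain ⟨x, hx⟩ := HU
  obtain ⟨y, hy⟩ := HV
  by_cases hxy : Joined x y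
  · obtain ⟨γ⟩ := hxy
    have e : (ContinuousMap.const V y).Homotopic (ContinuousMap.const V x) :=
      ⟨{ toFun := fun p => γ.symm p.1
         continuous_toFun := by fun_prop
         map_zero_left := fun _ => γ.symm.source
         map_one_left := fun _ => γ.symm.target }⟩
    exact isFormal_of_homotopy hU hV hUV hx.symm.some (hy.trans e).some
  -- A point of `U ∩ V` would be joined to `x` by one null-homotopy and to `y` by the other.
  · refine isFormal_of_disjoint hU hV hUV hx.symm.some hy.some ⟨fun z => hxy ?_⟩
    have h1 : Joined z.1 x := ⟨(hx.some.evalAt ⟨z.1, z.2.1⟩)⟩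
    have h2 : Joined z.1 y := ⟨(hy.some.evalAt ⟨z.1, z.2.2⟩)⟩
    exact h1.symm.trans h2

end Sing

/-! ### From the category to a cover by two sets. -/

theorem exists_hasCategoricalCover_of_lsCat_le {X : Type u} [TopologicalSpace X] {n : ℕ}
    (h : lsCat X ≤ n) : ∃ m ≤ n + 1, HasCategoricalCover X m := by
  by_contra! hn
  have : ((n + 1 : ℕ) : ℕ∞) ≤ lsCat X := le_iInf₂ fun k ⟨m, hm, hc⟩ => by
    by_contra! hk
    exact hn m (by have := Nat.cast_lt.1 hk; omega) hc
  exact absurd (Nat.cast_le.1 (this.trans h)) (by omega)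

theorem mainTheorem2 {X : Type*} [TopologicalSpace X] {K : Type*} [Field K] [CharZero K]
    (hX : lsCat X ≤ 1) : (singularCochainAlgebra X K).IsFormal := by
  obtain ⟨m, hm, U, hU, hUX, hc⟩ :=
    exists_hasCategoricalCover_of_lsCat_le (n := 1) (by simpa using hX)
  change (SSetCochain.cochainAlgebra (Sing X) K).IsFormal
  cases isEmpty_or_nonempty X with
  | inl h => exact Sing.isFormal_of_isEmpty
  | inr h =>
    obtain ⟨x⟩ := h
    obtain ⟨i, hi⟩ := Set.mem_iUnion.1 (hUX ▸ Set.mem_univ x : x ∈ ⋃ i, U i)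
    -- A cover by a single set is padded by repetition; among two indices the other one is `1 - i`.
    obtain ⟨j, hij⟩ : ∃ j, ∀ k, k = i ∨ k = j := by
      have : m = 1 ∨ m = 2 := by have := i.2; omega
      obtain rfl | rfl := this
      · exact ⟨i, fun k => Or.inl (Subsingleton.elim _ _)⟩
      · exact ⟨1 - i, by clear hi; revert i; decide⟩
    refine Sing.isFormal_of_nullhomotopic (hU i) (hU j) (Set.eq_univ_of_forall fun y => ?_)
      (hc i) (hc j)
    obtain ⟨k, hk⟩ := Set.mem_iUnion.1 (hUX ▸ Set.mem_univ y : y ∈ ⋃ i, U i)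
    obtain rfl | rfl := hij k
    · exact Or.inl hk
    · exact Or.inr hk
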